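/- Let $k$ be a field and $H$ a coquasitriangular Hopf algebra over $k$: a Hopf algebra with a convolution invertible form $r\colon H\otimes H\to k$, written $g\otimes h\mapsto r(g|h)$, with convolution inverse $r^{-1}$, satisfying (in Sweedler notation) $$r(gh|l)=r(g|l_{(1)})\,r(h|l_{(2)}),\qquad r(g|hl)=r(g_{(1)}|l)\,r(g_{(2)}|h),\qquad r(g_{(1)}|h_{(1)})\,g_{(2)}h_{(2)}=h_{(1)}g_{(1)}\,r(g_{(2)}|h_{(2)}).$$ The category $\mathcal B$ of all right $H$-comodules is monoidal with the codiagonal coaction $v\otimes w\mapsto v_{(0)}\otimes w_{(0)}\otimes v_{(1)}w_{(1)}$, and braided by $c_{V,W}(v\otimes w)=w_{(0)}\otimes v_{(0)}\,r(v_{(1)}|w_{(1)})$. *Module braidings and the reflective center.* Let $\mathcal M$ be a left $\mathcal B$-module category with action $\triangleright$ (associativity isomorphisms are suppressed). A module braiding on $\mathcal M$ is a natural family of isomorphisms $e_{V,M}\colon V\triangleright M\to V\triangleright M$ with $$e_{V\otimes W,M}=(V\triangleright e_{W,M})(c_{W,V}\triangleright M)(W\triangleright e_{V,M})(c_{W,V}^{-1}\triangleright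 M),$$ $$e_{V,W\triangleright M}=(c_{W,V}\triangleright M)(W\triangleright e_{V,M})(c_{V,W}\triangleright M).$$ The reflective center $\mathrm{refc}_{\mathcal B}(\mathcal M)$ has as objects the pairs $(M,e)$ of an object $M$ of $\mathcal M$ and isomorphisms $e_V\colon V\triangleright M\to V\triangleright M$, natural in $V\in\mathcal B$, with $e_I=\mathrm{id}$ that satisfy the first equation; its morphisms are the morphisms of $\mathcal M$ that commute with the $e_V$. It is a braided module category, with $W\triangleright(M,e)=(W\triangleright M,e')$, where $e'_V$ is given by the right-hand side of the second equation, and with module braiding $e$. *Module algebras.* A right $H$-module algebra is a $k$-algebra $B$ with a right $H$-module structure $b\otimes h\mapsto b.h$ such that $1.h=\varepsilon(h)1$ and $(ab).h=(a.h_{(1)})(b.h_{(2)})$. Then $\mathcal B$ acts on the category $B\text{-Mod}$ of left $B$-modules by $V\triangleright M=V\otimes M$ with $b(v\otimes m)=v_{(0)}\otimes(b.v_{(1)})m$. A reflective structure on $B$ is a convolution invertible linear map $K\colon H\to B$ with $$K(h_{(1)})(b.h_{(2)})=(b.h_{(1)})K(h_{(2)}),$$ $$K(gh)=K(h_{(1)})\,r(h_{(2)}|g_{(1)})\,K(g_{(2)})\,r^{-1}(h_{(3)}|g_{(3)}),$$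 $$K(g).h=r(h_{(1)}|g_{(1)})\,K(g_{(2)})\,r(g_{(3)}|h_{(2)}).$$ For $g,h\in H$ put $$h_{\langle0\rangle}\otimes h_{\langle1\rangle}=h_{(2)}\otimes S(h_{(1)})h_{(3)},\qquad g\bullet h=g_{(2)}h_{(3)}\,r(g_{(3)}|S(h_{(1)}))\,r(g_{(1)}|h_{(2)}),$$ $$h\leftharpoonup g=h_{(2)}\,r(g_{(1)}|h_{(1)})\,r(h_{(3)}|g_{(2)})$$ (the coadjoint coaction, Majid's transmuted product, and an action of $H$ on itself). **Proposition.** Let $A$ be a right $H$-module algebra. Then the vector space $A[H]=H\otimes A$, with $h\otimes x$ written $h\# x$, is an associative $k$-algebra with unit $1\#1$ under $$(g\#x)(h\#y)=g\bullet h_{\langle0\rangle}\#(x.h_{\langle1\rangle})y,$$ the map $x\mapsto 1\#x$ is an algebra map $A\to A[H]$, and $A[H]$ is a right $H$-module algebra under $$(g\#x).h=(g\leftharpoonup h_{(1)})\#(x.h_{(2)}).$$ The map $K\colon H\to A[H]$, $K(h)=h\#1$, is a reflective structure on $A[H]$, and $e_{V,M}(v\otimes m)=v_{(0)}\otimes K(v_{(1)})m$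 is a module braiding on the $\mathcal B$-module category $A[H]\text{-Mod}$. With this structure there is an equivalence of braided $\mathcal B$-module categories $$A[H]\text{-Mod}\;\simeq\;\mathrm{refc}_{\mathcal B}(A\text{-Mod})$$ under which the forgetful functor $\mathrm{refc}_{\mathcal B}(A\text{-Mod})\to A\text{-Mod}$ corresponds, up to an isomorphism of $\mathcal B$-module functors, to restriction of scalars along $x\mapsto1\#x$. -/

import Mathlib

open CategoryTheory MonoidalCategory
open scoped TensorProduct MonoidalLeftAction ModuleCat

universe u

noncomputable section

namespace ReflAlg

section Coactions

open Coalgebra TensorProduct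

variable {k : Type u} [Field k]
variable {V W C D E : Type u}
variable [AddCommGroup V] [Module k V] [AddCommGroup W] [Module k W]
variable [AddCommGroup C] [Module k C] [Coalgebra k C]
variable [AddCommGroup D] [Module k D] [Coalgebra k D]
variable [AddCommGroup E] [Module k E]

/-- `ρ : V → V ⊗ C` is a (coassociative and counital) right coaction of the coalgebra `C`. -/
structure IsCoaction (ρ : V →ₗ[k] V ⊗[k] C) : Prop where
  coassoc : (TensorProduct.assoc k V C C).toLinearMap ∘ₗ ρ.rTensor C ∘ₗ ρ =
    (comul (R := k) (A := C)).lTensor V ∘ₗ ρ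
  counit_id : (TensorProduct.rid k V).toLinearMap ∘ₗ (counit (R := k) (A := C)).lTensor V ∘ₗ ρ =
    LinearMap.id

/-- The action `v ↦ v₍₀₎ φ(v₍₁₎)` of a functional `φ` on a comodule. -/
def hit (ρ : V →ₗ[k] V ⊗[k] C) (φ : C →ₗ[k] k) : V →ₗ[k] V :=
  (TensorProduct.rid k V).toLinearMap ∘ₗ φ.lTensor V ∘ₗ ρ

/-- `v ⊗ w ↦ v₍₀₎ ⊗ w₍₀₎ ⊗ v₍₁₎ ⊗ w₍₁₎`. -/
def tensorCoact (ρ : V →ₗ[k] V ⊗[k] C) (ρ' : W →ₗ[k] W ⊗[k] D) :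
    V ⊗[k] W →ₗ[k] (V ⊗[k] W) ⊗[k] (C ⊗[k] D) :=
  (TensorProduct.tensorTensorTensorComm k V C W D).toLinearMap ∘ₗ TensorProduct.map ρ ρ'

lemma IsCoaction.coassoc_apply {ρ : V →ₗ[k] V ⊗[k] C} (h : IsCoaction ρ) (v : V) :
    TensorProduct.assoc k V C C (ρ.rTensor C (ρ v)) = (comul (R := k) (A := C)).lTensor V (ρ v) :=
  LinearMap.congr_fun h.coassoc v

lemma IsCoaction.counitApply {ρ : V →ₗ[k] V ⊗[k] C} (h : IsCoaction ρ) (v : V) :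
    TensorProduct.rid k V ((Coalgebra.counit (R := k) (A := C)).lTensor V (ρ v)) = v :=
  LinearMap.congr_fun h.counit_id v

lemma hit_counit {ρ : V →ₗ[k] V ⊗[k] C} (h : IsCoaction ρ) :
    hit ρ (counit (R := k)) = LinearMap.id := h.counit_id

lemma IsCoaction.lTensor_comp_hit {ρ : V →ₗ[k] V ⊗[k] C} (h : IsCoaction ρ)
    (f : C →ₗ[k] E) (φ : C →ₗ[k] k) :
    f.lTensor V ∘ₗ ρ ∘ₗ hit ρ φ =
      ((TensorProduct.rid k E).toLinearMap ∘ₗ TensorProduct.map f φ ∘ₗ comul).lTensor V ∘ₗ ρ := by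
  ext v
  have key := congrArg (((TensorProduct.rid k E).toLinearMap ∘ₗ TensorProduct.map f φ).lTensor V)
    (h.coassoc_apply v)
  simp only [LinearMap.comp_apply, hit, LinearMap.lTensor_comp] at key ⊢
  rw [← key]
  simp only [LinearEquiv.coe_coe]
  induction ρ v using TensorProduct.induction_on with
  | zero => simp
  | add x y hx hy => simp only [map_add, hx, hy]
  | tmul x c =>
    simp only [LinearMap.lTensor_tmul, LinearMap.rTensor_tmul, TensorProduct.rid_tmul, map_smul]
    induction ρ x using TensorProduct.induction_on with
    | zero => simp
    | add x y hx hy => simp only [map_add, hx, hy, add_tmul, smul_add]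
    | tmul x d => simp

lemma IsCoaction.rTensor_hit_comp {ρ : V →ₗ[k] V ⊗[k] C} (h : IsCoaction ρ)
    (f : C →ₗ[k] E) (φ : C →ₗ[k] k) :
    (hit ρ φ).rTensor E ∘ₗ f.lTensor V ∘ₗ ρ =
      ((TensorProduct.lid k E).toLinearMap ∘ₗ TensorProduct.map φ f ∘ₗ comul).lTensor V ∘ₗ ρ := by
  ext v
  have key := congrArg (((TensorProduct.lid k E).toLinearMap ∘ₗ TensorProduct.map φ f).lTensor V)
    (h.coassoc_apply v)
  simp only [LinearMap.comp_apply, hit, LinearMap.lTensor_comp] at key ⊢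
  rw [← key]
  induction ρ v using TensorProduct.induction_on with
  | zero => simp
  | add x y hx hy => simp only [map_add, hx, hy]
  | tmul x c =>
    simp only [LinearMap.lTensor_tmul, LinearMap.rTensor_tmul, LinearMap.comp_apply,
      LinearEquiv.coe_coe]
    induction ρ x using TensorProduct.induction_on with
    | zero => simp
    | add x y hx hy => simp only [map_add, hx, hy, add_tmul]
    | tmul x d => simp [smul_tmul]

/-- Functionals act through their convolution product. -/
lemma hit_comp_hit {ρ : V →ₗ[k] V ⊗[k] C} (h : IsCoaction ρ) (φ ψ : C →ₗ[k] k) :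
    hit ρ φ ∘ₗ hit ρ ψ = hit ρ (LinearMap.mul' k k ∘ₗ TensorProduct.map φ ψ ∘ₗ comul) := by
  have e : (TensorProduct.rid k k).toLinearMap = LinearMap.mul' k k := by
    ext; simp
  have := congrArg ((TensorProduct.rid k V).toLinearMap ∘ₗ ·) (h.lTensor_comp_hit φ ψ)
  simp only [e] at this
  conv_rhs => rw [hit]
  rw [← this]
  simp only [hit, LinearMap.comp_assoc]

lemma IsCoaction.tensor {ρ : V →ₗ[k] V ⊗[k] C} {ρ' : W →ₗ[k] W ⊗[k] D}
    (h : IsCoaction ρ) (h' : IsCoaction ρ') : IsCoaction (tensorCoact ρ ρ') where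
  coassoc := by
    ext v w
    let F : (V ⊗[k] (C ⊗[k] C)) ⊗[k] (W ⊗[k] (D ⊗[k] D)) →ₗ[k]
        (V ⊗[k] W) ⊗[k] ((C ⊗[k] D) ⊗[k] (C ⊗[k] D)) :=
      (TensorProduct.tensorTensorTensorComm k C C D D).toLinearMap.lTensor _ ∘ₗ
        (TensorProduct.tensorTensorTensorComm k V (C ⊗[k] C) W (D ⊗[k] D)).toLinearMap
    have key := congrArg F (congrArg₂ (fun x y => x ⊗ₜ[k] y)
      (h.coassoc_apply v) (h'.coassoc_apply w))
    simp only [TensorProduct.AlgebraTensorModule.curry_apply, TensorProduct.curry_apply,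
      LinearMap.restrictScalars_self, LinearMap.comp_apply, tensorCoact, TensorProduct.map_tmul,
      LinearEquiv.coe_coe]
    convert key using 1
    · generalize ρ v = x
      generalize ρ' w = y
      induction x using TensorProduct.induction_on with
      | zero => simp
      | add x y hx hy => simp only [map_add, add_tmul, hx, hy]
      | tmul x c =>
        induction y using TensorProduct.induction_on with
        | zero => simp
        | add x y hx hy => simp only [map_add, tmul_add, hx, hy]
        | tmul y d =>
          simp only [LinearMap.rTensor_tmul, tensorTensorTensorComm_tmul, LinearMap.comp_apply,
            TensorProduct.map_tmul, LinearEquiv.coe_coe]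
          generalize ρ x = a
          generalize ρ' y = b
          induction a using TensorProduct.induction_on with
          | zero => simp
          | add x y hx hy => simp only [map_add, add_tmul, hx, hy]
          | tmul a a' =>
            induction b using TensorProduct.induction_on with
            | zero => simp
            | add x y hx hy => simp only [map_add, tmul_add, add_tmul, hx, hy]
            | tmul b b' => simp [F]
    · generalize ρ v = x
      generalize ρ' w = y
      induction x using TensorProduct.induction_on with
      | zero => simp
      | add x y hx hy => simp only [map_add, add_tmul, hx, hy]
      | tmul x c =>
        induction y using TensorProduct.induction_on with
        | zero => simp
        | add x y hx hy => simp only [map_add, tmul_add, hx, hy]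
        | tmul y d => simp [F]; rfl
  counit_id := by
    ext v w
    have key := congrArg₂ (fun x y => x ⊗ₜ[k] y) (h.counitApply v) (h'.counitApply w)
    simp only [TensorProduct.AlgebraTensorModule.curry_apply, TensorProduct.curry_apply,
      LinearMap.restrictScalars_self, LinearMap.comp_apply, tensorCoact, TensorProduct.map_tmul,
      LinearEquiv.coe_coe, LinearMap.id_apply]
    refine Eq.trans ?_ key
    generalize ρ v = x
    generalize ρ' w = y
    induction x using TensorProduct.induction_on with
    | zero => simp
    | add x y hx hy => simp only [map_add, add_tmul, hx, hy]
    | tmul x c =>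
      induction y using TensorProduct.induction_on with
      | zero => simp
      | add x y hx hy => simp only [map_add, tmul_add, hx, hy]
      | tmul y d => simp [smul_tmul, smul_smul, mul_comm]

/-- Push-forward of a coaction along a coalgebra map. -/
lemma IsCoaction.push {ρ : V →ₗ[k] V ⊗[k] C} (h : IsCoaction ρ) (f : C →ₗc[k] D) :
    IsCoaction ((f : C →ₗ[k] D).lTensor V ∘ₗ ρ) where
  coassoc := by
    ext v
    have key := congrArg ((TensorProduct.map (f : C →ₗ[k] D) (f : C →ₗ[k] D)).lTensor V)
      (h.coassoc_apply v)
    have hf : ∀ x, comul (R := k) (f x) =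
        TensorProduct.map (f : C →ₗ[k] D) (f : C →ₗ[k] D) (comul x) := fun x =>
      (CoalgHomClass.map_comp_comul_apply f x).symm
    simp only [LinearMap.comp_apply, LinearEquiv.coe_coe]
    refine Eq.trans ?_ (key.trans ?_)
    · induction ρ v using TensorProduct.induction_on with
      | zero => simp
      | add x y hx hy => simp only [map_add, hx, hy]
      | tmul x c =>
        simp only [LinearMap.lTensor_tmul, LinearMap.rTensor_tmul, LinearMap.comp_apply]
        induction ρ x using TensorProduct.induction_on with
        | zero => simp
        | add x y hx hy => simp only [map_add, add_tmul, hx, hy]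
        | tmul x d => simp
    · induction ρ v using TensorProduct.induction_on with
      | zero => simp
      | add x y hx hy => simp only [map_add, hx, hy]
      | tmul x c => exact congrArg (x ⊗ₜ[k] ·) (hf c).symm
  counit_id := by
    ext v
    refine Eq.trans ?_ (h.counitApply v)
    simp only [LinearMap.comp_apply, LinearEquiv.coe_coe]
    induction ρ v using TensorProduct.induction_on with
    | zero => simp
    | add x y hx hy => simp only [map_add, hx, hy]
    | tmul x c => simp

end Coactions

/-! ### Coquasitriangular Hopf algebras -/

section Coquasitriangular

open Coalgebra TensorProduct

/-- A coquasitriangular structure on a Hopf algebra `H` over `k`: a convolution invertible form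
`r : H ⊗ H → k` with convolution inverse `rInv` and, in Sweedler notation,
* `r(g h ⊗ l) = r(g ⊗ l₍₁₎) r(h ⊗ l₍₂₎)`,
* `r(g ⊗ h l) = r(g₍₁₎ ⊗ l) r(g₍₂₎ ⊗ h)`,
* `r(g₍₁₎ ⊗ h₍₁₎) g₍₂₎ h₍₂₎ = h₍₁₎ g₍₁₎ r(g₍₂₎ ⊗ h₍₂₎)`.
Convolution refers to the tensor product coalgebra `H ⊗ H`. -/
class CoquasitriangularStructure (k H : Type u) [Field k] [Ring H] [HopfAlgebra k H] where
  r : H ⊗[k] H →ₗ[k] k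
  rInv : H ⊗[k] H →ₗ[k] k
  r_mul_rInv : LinearMap.mul' k k ∘ₗ TensorProduct.map r rInv ∘ₗ comul (R := k) (A := H ⊗[k] H) =
    counit (R := k) (A := H ⊗[k] H)
  rInv_mul_r : LinearMap.mul' k k ∘ₗ TensorProduct.map rInv r ∘ₗ comul (R := k) (A := H ⊗[k] H) =
    counit (R := k) (A := H ⊗[k] H)
  r_mul_left (g h l : H) : r ((g * h) ⊗ₜ[k] l) = LinearMap.mul' k k
    (TensorProduct.map (TensorProduct.curry r g) (TensorProduct.curry r h) (comul (R := k) l))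
  r_mul_right (g h l : H) : r (g ⊗ₜ[k] (h * l)) = LinearMap.mul' k k
    (TensorProduct.map ((TensorProduct.curry r).flip l) ((TensorProduct.curry r).flip h)
      (comul (R := k) g))
  comm_r : (TensorProduct.lid k H).toLinearMap ∘ₗ TensorProduct.map r (LinearMap.mul' k H) ∘ₗ
      comul (R := k) (A := H ⊗[k] H) =
    (TensorProduct.rid k H).toLinearMap ∘ₗ
      TensorProduct.map (LinearMap.mul' k H ∘ₗ (TensorProduct.comm k H H).toLinearMap) r ∘ₗ
        comul (R := k) (A := H ⊗[k] H)

end Coquasitriangular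

/-! ### Coactions of a Hopf algebra on tensor products -/

section HopfCoactions

open TensorProduct

variable {k H : Type u} [Field k] [Ring H] [HopfAlgebra k H]
variable {U V W V' W' : Type u}
variable [AddCommGroup U] [Module k U] [AddCommGroup V] [Module k V]
variable [AddCommGroup W] [Module k W] [AddCommGroup V'] [Module k V']
variable [AddCommGroup W'] [Module k W']

/-- The diagonal coaction `v ⊗ w ↦ v₍₀₎ ⊗ w₍₀₎ ⊗ v₍₁₎ w₍₁₎`. -/
def diagCoact (ρ : V →ₗ[k] V ⊗[k] H) (ρ' : W →ₗ[k] W ⊗[k] H) :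
    V ⊗[k] W →ₗ[k] (V ⊗[k] W) ⊗[k] H :=
  (LinearMap.mul' k H).lTensor _ ∘ₗ tensorCoact ρ ρ'

/-- The trivial coaction `x ↦ x ⊗ 1` on `k`. -/
def trivCoact (k H : Type u) [Field k] [Ring H] [HopfAlgebra k H] : k →ₗ[k] k ⊗[k] H :=
  (TensorProduct.mk k k H).flip 1

lemma IsCoaction.diag {ρ : V →ₗ[k] V ⊗[k] H} {ρ' : W →ₗ[k] W ⊗[k] H}
    (h : IsCoaction ρ) (h' : IsCoaction ρ') : IsCoaction (diagCoact ρ ρ') :=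
  (h.tensor h').push (Bialgebra.mulCoalgHom k H)

lemma isCoaction_triv : IsCoaction (trivCoact k H) :=
  ⟨by ext; simp [trivCoact, Algebra.TensorProduct.one_def], by ext; simp [trivCoact]⟩

lemma diagCoact_tmul (ρ : V →ₗ[k] V ⊗[k] H) (ρ' : W →ₗ[k] W ⊗[k] H) (v : V) (w : W) :
    diagCoact ρ ρ' (v ⊗ₜ[k] w) = (LinearMap.mul' k H).lTensor _
      (TensorProduct.tensorTensorTensorComm k V H W H (ρ v ⊗ₜ[k] ρ' w)) := rfl

lemma diagCoact_map {ρ : V →ₗ[k] V ⊗[k] H} {ρ' : W →ₗ[k] W ⊗[k] H}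
    {τ : V' →ₗ[k] V' ⊗[k] H} {τ' : W' →ₗ[k] W' ⊗[k] H}
    {f : V →ₗ[k] V'} {g : W →ₗ[k] W'} (hf : τ ∘ₗ f = f.rTensor H ∘ₗ ρ)
    (hg : τ' ∘ₗ g = g.rTensor H ∘ₗ ρ') :
    diagCoact τ τ' ∘ₗ TensorProduct.map f g =
      (TensorProduct.map f g).rTensor H ∘ₗ diagCoact ρ ρ' := by
  apply TensorProduct.ext'
  intro v w
  have hf' := LinearMap.congr_fun hf v
  have hg' := LinearMap.congr_fun hg w
  simp only [LinearMap.comp_apply, TensorProduct.map_tmul, diagCoact_tmul] at hf' hg' ⊢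
  rw [hf', hg']
  generalize ρ v = x
  generalize ρ' w = y
  induction x using TensorProduct.induction_on with
  | zero => simp
  | add x y hx hy => simp only [map_add, TensorProduct.add_tmul, hx, hy]
  | tmul x c =>
    induction y using TensorProduct.induction_on with
    | zero => simp
    | add x y hx hy => simp only [map_add, TensorProduct.tmul_add, hx, hy]
    | tmul y d => simp

lemma diagCoact_assoc (α : U →ₗ[k] U ⊗[k] H) (ρ : V →ₗ[k] V ⊗[k] H) (ρ' : W →ₗ[k] W ⊗[k] H) :
    diagCoact α (diagCoact ρ ρ') ∘ₗ (TensorProduct.assoc k U V W).toLinearMap =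
      (TensorProduct.assoc k U V W).toLinearMap.rTensor H ∘ₗ diagCoact (diagCoact α ρ) ρ' := by
  apply TensorProduct.ext_threefold
  intro u v w
  simp only [LinearMap.comp_apply, LinearEquiv.coe_coe, TensorProduct.assoc_tmul, diagCoact_tmul]
  generalize α u = x
  generalize ρ v = y
  generalize ρ' w = z
  induction x using TensorProduct.induction_on with
  | zero => simp
  | add x y hx hy => simp only [map_add, TensorProduct.add_tmul, hx, hy]
  | tmul x c =>
    induction y using TensorProduct.induction_on with
    | zero => simp
    | add x y hx hy =>
      simp only [map_add, TensorProduct.tmul_add, TensorProduct.add_tmul, hx, hy]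
    | tmul y d =>
      induction z using TensorProduct.induction_on with
      | zero => simp
      | add x y hx hy => simp only [map_add, TensorProduct.tmul_add, hx, hy]
      | tmul z e => simp [mul_assoc]

lemma diagCoact_lid (ρ : V →ₗ[k] V ⊗[k] H) :
    ρ ∘ₗ (TensorProduct.lid k V).toLinearMap =
      (TensorProduct.lid k V).toLinearMap.rTensor H ∘ₗ diagCoact (trivCoact k H) ρ := by
  apply TensorProduct.ext'
  intro a v
  simp only [LinearMap.comp_apply, LinearEquiv.coe_coe, diagCoact_tmul, TensorProduct.lid_tmul,
    map_smul]
  induction ρ v using TensorProduct.induction_on with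
  | zero => simp
  | add x y hx hy => simp only [map_add, TensorProduct.tmul_add, hx, hy, smul_add]
  | tmul x c => simp [TensorProduct.smul_tmul', trivCoact]

lemma diagCoact_rid (ρ : V →ₗ[k] V ⊗[k] H) :
    ρ ∘ₗ (TensorProduct.rid k V).toLinearMap =
      (TensorProduct.rid k V).toLinearMap.rTensor H ∘ₗ diagCoact ρ (trivCoact k H) := by
  apply TensorProduct.ext'
  intro v a
  simp only [LinearMap.comp_apply, LinearEquiv.coe_coe, diagCoact_tmul, TensorProduct.rid_tmul,
    map_smul]
  induction ρ v using TensorProduct.induction_on with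
  | zero => simp
  | add x y hx hy => simp only [map_add, TensorProduct.add_tmul, hx, hy, smul_add]
  | tmul x c => simp [TensorProduct.smul_tmul', trivCoact]

end HopfCoactions


section Braiding

open TensorProduct Coalgebra

variable {k H : Type u} [Field k] [Ring H] [HopfAlgebra k H]
variable {U V W V' W' : Type u}
variable [AddCommGroup U] [Module k U] [AddCommGroup V] [Module k V]
variable [AddCommGroup W] [Module k W] [AddCommGroup V'] [Module k V']
variable [AddCommGroup W'] [Module k W']

/-- `v ⊗ w ↦ w₍₀₎ ⊗ v₍₀₎ φ(v₍₁₎ ⊗ w₍₁₎)`. -/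
def braidMap (φ : H ⊗[k] H →ₗ[k] k) (ρ : V →ₗ[k] V ⊗[k] H) (ρ' : W →ₗ[k] W ⊗[k] H) :
    V ⊗[k] W →ₗ[k] W ⊗[k] V :=
  (TensorProduct.comm k V W).toLinearMap ∘ₗ hit (tensorCoact ρ ρ') φ

/-- `a ↦ w₍₀₎ φ(a ⊗ w₍₁₎)`. -/
def leftHit (φ : H ⊗[k] H →ₗ[k] k) (ρ' : W →ₗ[k] W ⊗[k] H) (w : W) : H →ₗ[k] W where
  toFun a := hit ρ' (TensorProduct.curry φ a) w
  map_add' a b := by simp [hit, LinearMap.lTensor_add]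
  map_smul' a b := by simp [hit, LinearMap.lTensor_smul]

/-- `b ↦ v₍₀₎ φ(v₍₁₎ ⊗ b)`. -/
def rightHit (φ : H ⊗[k] H →ₗ[k] k) (ρ : V →ₗ[k] V ⊗[k] H) (v : V) : H →ₗ[k] V where
  toFun b := hit ρ ((TensorProduct.curry φ).flip b) v
  map_add' a b := by simp [hit, LinearMap.lTensor_add]
  map_smul' a b := by simp [hit, LinearMap.lTensor_smul]

lemma braidMap_eq_left (φ : H ⊗[k] H →ₗ[k] k) (ρ : V →ₗ[k] V ⊗[k] H) (ρ' : W →ₗ[k] W ⊗[k] H)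
    (v : V) (w : W) : braidMap φ ρ ρ' (v ⊗ₜ[k] w) =
      TensorProduct.comm k V W ((leftHit φ ρ' w).lTensor V (ρ v)) := by
  simp only [braidMap, hit, tensorCoact, LinearMap.comp_apply, TensorProduct.map_tmul,
    LinearEquiv.coe_coe]
  induction ρ v using TensorProduct.induction_on with
  | zero => simp
  | add x y hx hy => simp only [map_add, TensorProduct.add_tmul, hx, hy]
  | tmul x c =>
    simp only [LinearMap.lTensor_tmul, leftHit, LinearMap.coe_mk, AddHom.coe_mk, hit,
      LinearMap.comp_apply, LinearEquiv.coe_coe]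
    induction ρ' w using TensorProduct.induction_on with
    | zero => simp
    | add x y hx hy => simp only [map_add, TensorProduct.tmul_add, hx, hy]
    | tmul y d => simp [TensorProduct.smul_tmul']

lemma braidMap_eq_right (φ : H ⊗[k] H →ₗ[k] k) (ρ : V →ₗ[k] V ⊗[k] H) (ρ' : W →ₗ[k] W ⊗[k] H)
    (v : V) (w : W) : braidMap φ ρ ρ' (v ⊗ₜ[k] w) = (rightHit φ ρ v).lTensor W (ρ' w) := by
  simp only [braidMap, hit, tensorCoact, LinearMap.comp_apply, TensorProduct.map_tmul,
    LinearEquiv.coe_coe]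
  induction ρ' w using TensorProduct.induction_on with
  | zero => simp
  | add x y hx hy => simp only [map_add, TensorProduct.tmul_add, hx, hy]
  | tmul x c =>
    simp only [LinearMap.lTensor_tmul, rightHit, LinearMap.coe_mk, AddHom.coe_mk, hit,
      LinearMap.comp_apply, LinearEquiv.coe_coe]
    induction ρ v using TensorProduct.induction_on with
    | zero => simp
    | add x y hx hy => simp only [map_add, TensorProduct.tmul_add, TensorProduct.add_tmul, hx, hy]
    | tmul y d => simp

lemma hit_map {ρ : V →ₗ[k] V ⊗[k] H} {τ : V' →ₗ[k] V' ⊗[k] H} {f : V →ₗ[k] V'}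
    (hf : τ ∘ₗ f = f.rTensor H ∘ₗ ρ) (φ : H →ₗ[k] k) : hit τ φ ∘ₗ f = f ∘ₗ hit ρ φ := by
  ext v
  have hf' := LinearMap.congr_fun hf v
  simp only [LinearMap.comp_apply, hit, LinearEquiv.coe_coe] at hf' ⊢
  rw [hf']
  induction ρ v using TensorProduct.induction_on with
  | zero => simp
  | add x y hx hy => simp only [map_add, hx, hy]
  | tmul x c => simp

lemma braidMap_naturality_left (φ : H ⊗[k] H →ₗ[k] k) {ρ : V →ₗ[k] V ⊗[k] H}
    {τ : V' →ₗ[k] V' ⊗[k] H} {f : V →ₗ[k] V'} (hf : τ ∘ₗ f = f.rTensor H ∘ₗ ρ)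
    (ρ' : W →ₗ[k] W ⊗[k] H) :
    braidMap φ τ ρ' ∘ₗ TensorProduct.map f LinearMap.id =
      TensorProduct.map LinearMap.id f ∘ₗ braidMap φ ρ ρ' := by
  apply TensorProduct.ext'
  intro v w
  have hf' := LinearMap.congr_fun hf v
  simp only [LinearMap.comp_apply, TensorProduct.map_tmul, braidMap_eq_left,
    LinearMap.id_apply] at hf' ⊢
  rw [hf']
  induction ρ v using TensorProduct.induction_on with
  | zero => simp
  | add x y hx hy => simp only [map_add, hx, hy]
  | tmul x c => simp

lemma braidMap_naturality_right (φ : H ⊗[k] H →ₗ[k] k) {ρ : W →ₗ[k] W ⊗[k] H}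
    {τ : W' →ₗ[k] W' ⊗[k] H} {f : W →ₗ[k] W'} (hf : τ ∘ₗ f = f.rTensor H ∘ₗ ρ)
    (ρ' : V →ₗ[k] V ⊗[k] H) :
    braidMap φ ρ' τ ∘ₗ TensorProduct.map LinearMap.id f =
      TensorProduct.map f LinearMap.id ∘ₗ braidMap φ ρ' ρ := by
  apply TensorProduct.ext'
  intro v w
  have hf' := LinearMap.congr_fun hf w
  simp only [LinearMap.comp_apply, TensorProduct.map_tmul, braidMap_eq_right,
    LinearMap.id_apply] at hf' ⊢
  rw [hf']
  induction ρ w using TensorProduct.induction_on with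
  | zero => simp
  | add x y hx hy => simp only [map_add, hx, hy]
  | tmul x c => simp

variable [CoquasitriangularStructure k H]

open CoquasitriangularStructure

/-- The braiding `v ⊗ w ↦ w₍₀₎ ⊗ v₍₀₎ r(v₍₁₎ ⊗ w₍₁₎)` as a linear isomorphism. -/
def braidEquiv {ρ : V →ₗ[k] V ⊗[k] H} {ρ' : W →ₗ[k] W ⊗[k] H}
    (h : IsCoaction ρ) (h' : IsCoaction ρ') : V ⊗[k] W ≃ₗ[k] W ⊗[k] V :=
  LinearEquiv.ofLinearMap (braidMap r ρ ρ')
    (hit (tensorCoact ρ ρ') rInv ∘ₗ (TensorProduct.comm k W V).toLinearMap)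
    (by
      have e := hit_comp_hit (h.tensor h') r (rInv (k := k) (H := H))
      rw [r_mul_rInv, hit_counit (h.tensor h')] at e
      apply LinearMap.ext
      intro t
      change TensorProduct.comm k V W ((hit (tensorCoact ρ ρ') r ∘ₗ hit (tensorCoact ρ ρ') rInv)
        (TensorProduct.comm k W V t)) = t
      rw [e]
      simp)
    (by
      have e := hit_comp_hit (h.tensor h') (rInv (k := k) (H := H)) r
      rw [rInv_mul_r, hit_counit (h.tensor h')] at e
      rw [← e]
      ext; simp [braidMap])

lemma braidMap_coact {ρ : V →ₗ[k] V ⊗[k] H} {ρ' : W →ₗ[k] W ⊗[k] H}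
    (h : IsCoaction ρ) (h' : IsCoaction ρ') :
    diagCoact ρ' ρ ∘ₗ braidMap r ρ ρ' = (braidMap r ρ ρ').rTensor H ∘ₗ diagCoact ρ ρ' := by
  have e : diagCoact ρ' ρ ∘ₗ (TensorProduct.comm k V W).toLinearMap =
      (TensorProduct.comm k V W).toLinearMap.rTensor H ∘ₗ
        (LinearMap.mul' k H ∘ₗ (TensorProduct.comm k H H).toLinearMap).lTensor _ ∘ₗ
          tensorCoact ρ ρ' := by
    apply TensorProduct.ext'
    intro v w
    simp only [LinearMap.comp_apply, LinearEquiv.coe_coe, TensorProduct.comm_tmul,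
      diagCoact_tmul, tensorCoact, TensorProduct.map_tmul]
    generalize ρ v = x
    generalize ρ' w = y
    induction x using TensorProduct.induction_on with
    | zero => simp
    | add x y hx hy => simp only [map_add, TensorProduct.add_tmul, TensorProduct.tmul_add, hx, hy]
    | tmul x c =>
      induction y using TensorProduct.induction_on with
      | zero => simp
      | add x y hx hy =>
        simp only [map_add, TensorProduct.add_tmul, TensorProduct.tmul_add, hx, hy]
      | tmul y d => simp
  rw [braidMap, ← LinearMap.comp_assoc, e, LinearMap.comp_assoc, LinearMap.comp_assoc,
    (h.tensor h').lTensor_comp_hit, LinearMap.rTensor_comp, LinearMap.comp_assoc]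
  rw [diagCoact, (h.tensor h').rTensor_hit_comp, comm_r]

lemma braidMap_hexagon_forward {α : U →ₗ[k] U ⊗[k] H} (h : IsCoaction α)
    (ρ : V →ₗ[k] V ⊗[k] H) (ρ' : W →ₗ[k] W ⊗[k] H) (u : U) (v : V) (w : W) :
    TensorProduct.assoc k V W U (braidMap r α (diagCoact ρ ρ') (u ⊗ₜ[k] (v ⊗ₜ[k] w))) =
      (braidMap r α ρ').lTensor V (TensorProduct.assoc k V U W
        (braidMap r α ρ (u ⊗ₜ[k] v) ⊗ₜ[k] w)) := by
  have key (a b : H) : rightHit r α u (a * b) = rightHit r α (rightHit r α u a) b := by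
    have e := LinearMap.congr_fun (hit_comp_hit h ((TensorProduct.curry (r (k := k) (H := H))).flip b)
      ((TensorProduct.curry r).flip a)) u
    refine Eq.trans ?_ e.symm
    change hit α _ u = hit α _ u
    congr 2
    ext g
    exact r_mul_right g a b
  rw [braidMap_eq_right, braidMap_eq_right, diagCoact_tmul]
  generalize ρ v = x
  induction x using TensorProduct.induction_on with
  | zero => simp
  | add x y hx hy => simp only [map_add, TensorProduct.add_tmul, hx, hy]
  | tmul x c =>
    simp only [LinearMap.lTensor_tmul, TensorProduct.assoc_tmul, braidMap_eq_right]
    induction ρ' w using TensorProduct.induction_on with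
    | zero => simp
    | add x y hx hy => simp only [map_add, TensorProduct.tmul_add, hx, hy]
    | tmul y d => simp [key]

lemma braidMap_hexagon_reverse {α : U →ₗ[k] U ⊗[k] H} (h : IsCoaction α)
    (ρ : V →ₗ[k] V ⊗[k] H) (ρ' : W →ₗ[k] W ⊗[k] H) (u : U) (v : V) (w : W) :
    (TensorProduct.assoc k U V W).symm (braidMap r (diagCoact ρ ρ') α ((v ⊗ₜ[k] w) ⊗ₜ[k] u)) =
      (braidMap r ρ α).rTensor W ((TensorProduct.assoc k V U W).symm
        (v ⊗ₜ[k] braidMap r ρ' α (w ⊗ₜ[k] u))) := by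
  have key (a b : H) : leftHit r α u (a * b) = leftHit r α (leftHit r α u b) a := by
    have e := LinearMap.congr_fun (hit_comp_hit h (TensorProduct.curry (r (k := k) (H := H)) a)
      (TensorProduct.curry r b)) u
    refine Eq.trans ?_ e.symm
    change hit α _ u = hit α _ u
    congr 2
    ext g
    exact r_mul_left a b g
  rw [braidMap_eq_left, braidMap_eq_left, diagCoact_tmul]
  generalize ρ' w = x
  induction x using TensorProduct.induction_on with
  | zero => simp
  | add x y hx hy => simp only [map_add, TensorProduct.tmul_add, hx, hy]
  | tmul x c =>
    simp only [LinearMap.lTensor_tmul, TensorProduct.comm_tmul, TensorProduct.assoc_symm_tmul,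
      LinearMap.rTensor_tmul, braidMap_eq_left]
    induction ρ v using TensorProduct.induction_on with
    | zero => simp
    | add x y hx hy => simp only [map_add, TensorProduct.add_tmul, hx, hy]
    | tmul y d => simp [key]

end Braiding

/-! ### The braided monoidal category of right comodules -/

/-- Right comodules over the `k`-coalgebra `H`. -/
structure RComod (k H : Type u) [Field k] [Ring H] [HopfAlgebra k H] where
  carrier : Type u
  [addCommGroup : AddCommGroup carrier]
  [module : Module k carrier]
  coact : carrier →ₗ[k] carrier ⊗[k] H
  isCoaction : IsCoaction coact

namespace RComod

attribute [instance] addCommGroup module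

variable {k H : Type u} [Field k] [Ring H] [HopfAlgebra k H]

instance : CoeSort (RComod k H) (Type u) := ⟨carrier⟩

/-- Comodule maps. -/
@[ext]
structure Hom (V W : RComod k H) where
  hom : V →ₗ[k] W
  coact_hom : W.coact ∘ₗ hom = hom.rTensor H ∘ₗ V.coact

lemma Hom.coact_apply {V W : RComod k H} (f : Hom V W) (v : V) :
    W.coact (f.hom v) = f.hom.rTensor H (V.coact v) := LinearMap.congr_fun f.coact_hom v

instance : Category (RComod k H) where
  Hom := Hom
  id V := ⟨LinearMap.id, by simp⟩
  comp f g := ⟨g.hom ∘ₗ f.hom, by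
    rw [LinearMap.rTensor_comp, LinearMap.comp_assoc, ← f.coact_hom, ← LinearMap.comp_assoc,
      g.coact_hom, LinearMap.comp_assoc]⟩

@[ext]
lemma hom_ext {V W : RComod k H} {f g : V ⟶ W} (h : f.hom = g.hom) : f = g := Hom.ext h

@[simp] lemma id_hom (V : RComod k H) : Hom.hom (𝟙 V) = LinearMap.id := rfl

@[simp] lemma comp_hom {U V W : RComod k H} (f : U ⟶ V) (g : V ⟶ W) :
    Hom.hom (f ≫ g) = g.hom ∘ₗ f.hom := rfl

/-- A bijective comodule map is an isomorphism. -/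
@[simps]
def mkIso {V W : RComod k H} (e : V ≃ₗ[k] W)
    (h : W.coact ∘ₗ e.toLinearMap = e.toLinearMap.rTensor H ∘ₗ V.coact) : V ≅ W where
  hom := ⟨e.toLinearMap, h⟩
  inv := ⟨e.symm.toLinearMap, by
    have : V.coact = e.symm.toLinearMap.rTensor H ∘ₗ W.coact ∘ₗ e.toLinearMap := by
      rw [h, ← LinearMap.comp_assoc, ← LinearMap.rTensor_comp]
      simp
    rw [this]
    ext w
    simp⟩
  hom_inv_id := by ext v; simp
  inv_hom_id := by ext v; simp

/-- The forgetful functor to vector spaces. -/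
@[simps]
def forgetModule (k H : Type u) [Field k] [Ring H] [HopfAlgebra k H] :
    RComod k H ⥤ ModuleCat.{u} k where
  obj V := ModuleCat.of k V
  map f := ModuleCat.ofHom f.hom

instance : (forgetModule k H).Faithful where
  map_injective h := by
    ext v
    exact congrArg (fun f => f.hom v) h

/-- The tensor product: `v ⊗ w ↦ v₍₀₎ ⊗ w₍₀₎ ⊗ v₍₁₎ w₍₁₎`. -/
def tensor (V W : RComod k H) : RComod k H where
  carrier := V ⊗[k] W
  coact := diagCoact V.coact W.coact
  isCoaction := V.isCoaction.diag W.isCoaction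

/-- The trivial comodule `k`: `x ↦ x ⊗ 1`. -/
def unit (k H : Type u) [Field k] [Ring H] [HopfAlgebra k H] : RComod k H where
  carrier := k
  coact := trivCoact k H
  isCoaction := isCoaction_triv

/-- Tensor product of comodule maps. -/
def tensorMap {V V' W W' : RComod k H} (f : V ⟶ V') (g : W ⟶ W') :
    tensor V W ⟶ tensor V' W' where
  hom := TensorProduct.map f.hom g.hom
  coact_hom := diagCoact_map f.coact_hom g.coact_hom

/-- The associativity isomorphism. -/
def assocIso (U V W : RComod k H) : tensor (tensor U V) W ≅ tensor U (tensor V W) :=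
  mkIso (V := tensor (tensor U V) W) (W := tensor U (tensor V W)) (TensorProduct.assoc k U V W)
    (diagCoact_assoc _ _ _)

/-- The left unit isomorphism. -/
def lidIso (V : RComod k H) : tensor (unit k H) V ≅ V :=
  mkIso (V := tensor (unit k H) V) (TensorProduct.lid k V) (diagCoact_lid _)

/-- The right unit isomorphism. -/
def ridIso (V : RComod k H) : tensor V (unit k H) ≅ V :=
  mkIso (V := tensor V (unit k H)) (TensorProduct.rid k V) (diagCoact_rid _)

instance : MonoidalCategoryStruct (RComod k H) where
  tensorObj := tensor
  tensorUnit := unit k H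
  tensorHom := tensorMap
  whiskerLeft V _ _ f := tensorMap (𝟙 V) f
  whiskerRight f V := tensorMap f (𝟙 V)
  associator := assocIso
  leftUnitor := lidIso
  rightUnitor := ridIso

/-- Right comodules form a monoidal category. -/
instance : MonoidalCategory (RComod k H) :=
  Monoidal.induced (forgetModule k H)
    { μIso := fun _ _ => Iso.refl _
      εIso := Iso.refl _
      whiskerLeft_eq := fun X Y Z f => by
        ext : 1
        apply TensorProduct.ext'
        intro x y
        rfl
      whiskerRight_eq := fun f X => by
        ext : 1
        apply TensorProduct.ext'
        intro x y
        rfl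
      tensorHom_eq := fun f X => by
        ext : 1
        apply TensorProduct.ext'
        intro x y
        rfl
      associator_eq := fun X Y Z => by
        ext : 1
        apply TensorProduct.ext_threefold
        intro x y z
        rfl
      leftUnitor_eq := fun X => by
        ext : 1
        apply TensorProduct.ext'
        intro x y
        rfl
      rightUnitor_eq := fun X => by
        ext : 1
        apply TensorProduct.ext'
        intro x y
        rfl }

lemma whiskerLeft_hom_tmul (V : RComod k H) {W W' : RComod k H} (f : W ⟶ W') (v : V) (w : W) :
    Hom.hom (V ◁ f) (v ⊗ₜ[k] w) = v ⊗ₜ[k] f.hom w := rfl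

lemma whiskerRight_hom_tmul (V : RComod k H) {W W' : RComod k H} (f : W ⟶ W') (v : V) (w : W) :
    Hom.hom (f ▷ V) (w ⊗ₜ[k] v) = f.hom w ⊗ₜ[k] v := rfl

lemma associator_hom_tmul (U V W : RComod k H) (u : U) (v : V) (w : W) :
    Hom.hom (α_ U V W).hom ((u ⊗ₜ[k] v) ⊗ₜ[k] w) = u ⊗ₜ[k] (v ⊗ₜ[k] w) := rfl

lemma associator_inv_tmul (U V W : RComod k H) (u : U) (v : V) (w : W) :
    Hom.hom (α_ U V W).inv (u ⊗ₜ[k] (v ⊗ₜ[k] w)) = (u ⊗ₜ[k] v) ⊗ₜ[k] w := rfl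


variable [CoquasitriangularStructure k H]

open CoquasitriangularStructure

/-- The braiding `c(v ⊗ w) = w₍₀₎ ⊗ v₍₀₎ r(v₍₁₎ ⊗ w₍₁₎)`. -/
def braidIso (V W : RComod k H) : V ⊗ W ≅ W ⊗ V :=
  mkIso (V := tensor V W) (W := tensor W V) (braidEquiv V.isCoaction W.isCoaction)
    (braidMap_coact V.isCoaction W.isCoaction)

/-- The category of right comodules over a coquasitriangular Hopf algebra is braided. -/
instance : BraidedCategory (RComod k H) where
  braiding := braidIso
  braiding_naturality_right X {Y Z} f := by
    ext : 1
    exact braidMap_naturality_right r f.coact_hom X.coact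
  braiding_naturality_left f Z := by
    ext : 1
    exact braidMap_naturality_left r f.coact_hom Z.coact
  hexagon_forward X Y Z := by
    ext : 1
    apply TensorProduct.ext_threefold
    intro x y z
    exact braidMap_hexagon_forward X.isCoaction Y.coact Z.coact x y z
  hexagon_reverse X Y Z := by
    ext : 1
    apply LinearMap.ext
    intro t
    obtain ⟨s, rfl⟩ := (TensorProduct.assoc k X Y Z).surjective t
    revert s
    refine LinearMap.congr_fun
      (f := (Hom.hom ((α_ X Y Z).inv ≫ (braidIso (X ⊗ Y) Z).hom ≫ (α_ Z X Y).inv)) ∘ₗ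
        (TensorProduct.assoc k X Y Z).toLinearMap)
      (g := (Hom.hom (X ◁ (braidIso Y Z).hom ≫ (α_ X Z Y).inv ≫ (braidIso X Z).hom ▷ Y)) ∘ₗ
        (TensorProduct.assoc k X Y Z).toLinearMap) ?_
    apply TensorProduct.ext_threefold
    intro x y z
    exact braidMap_hexagon_reverse Z.isCoaction X.coact Y.coact z x y

lemma braiding_hom_hom (V W : RComod k H) :
    Hom.hom (β_ V W).hom = braidMap r V.coact W.coact := rfl

end RComod


/-! ### Module algebras and the action of comodules on modules -/

/-- A right `H`-module algebra structure `(a, h) ↦ a.h` on the `k`-algebra `A`: a right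
`H`-module structure with `1.h = ε(h) 1` and `(a b).h = (a.h₍₁₎) (b.h₍₂₎)`. -/
class RightModuleAlgebra (k H A : Type u) [Field k] [Ring H] [HopfAlgebra k H]
    [Ring A] [Algebra k A] where
  act : A →ₗ[k] H →ₗ[k] A
  act_unit (a : A) : act a 1 = a
  act_mul (a : A) (g h : H) : act a (g * h) = act (act a g) h
  one_act (h : H) : act 1 h = Coalgebra.counit (R := k) h • (1 : A)
  mul_act (a b : A) (h : H) : act (a * b) h =
    LinearMap.mul' k A (TensorProduct.map (act a) (act b) (Coalgebra.comul (R := k) h))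

section Action

variable {k H A : Type u} [Field k] [Ring H] [HopfAlgebra k H] [Ring A] [Algebra k A]
variable [RightModuleAlgebra k H A]
variable {V W : Type u} [AddCommGroup V] [Module k V] [AddCommGroup W] [Module k W]
variable {M N : Type u} [AddCommGroup M] [Module k M] [Module A M] [IsScalarTower k A M]
variable [AddCommGroup N] [Module k N] [Module A N] [IsScalarTower k A N]

open RightModuleAlgebra

/-- `h ⊗ m ↦ (a.h) m`. -/
def preAct (a : A) : H ⊗[k] M →ₗ[k] M :=
  TensorProduct.lift ((Algebra.lsmul k k M).toLinearMap ∘ₗ act a)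

@[simp] lemma preAct_tmul (a : A) (h : H) (m : M) :
    preAct a (h ⊗ₜ[k] m) = act (k := k) a h • m := rfl

/-- `v ⊗ m ↦ v₍₀₎ ⊗ (a.v₍₁₎) m`. -/
def actMap (ρ : V →ₗ[k] V ⊗[k] H) (a : A) : V ⊗[k] M →ₗ[k] V ⊗[k] M :=
  (preAct a).lTensor V ∘ₗ (TensorProduct.assoc k V H M).toLinearMap ∘ₗ ρ.rTensor M

lemma actMap_tmul (ρ : V →ₗ[k] V ⊗[k] H) (a : A) (v : V) (m : M) :
    actMap ρ a (v ⊗ₜ[k] m) =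
      (preAct a).lTensor V (TensorProduct.assoc k V H M (ρ v ⊗ₜ[k] m)) := rfl

lemma actMap_add (ρ : V →ₗ[k] V ⊗[k] H) (a b : A) :
    actMap ρ (a + b) = (actMap ρ a + actMap ρ b : V ⊗[k] M →ₗ[k] V ⊗[k] M) := by
  have : preAct (k := k) (H := H) (M := M) (a + b) = preAct a + preAct b := by
    apply TensorProduct.ext'
    intro h m
    simp [add_smul]
  simp [actMap, this, LinearMap.lTensor_add, LinearMap.add_comp]

lemma actMap_algebraMap {ρ : V →ₗ[k] V ⊗[k] H} (hρ : IsCoaction ρ) (c : k) (t : V ⊗[k] M) :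
    actMap ρ (algebraMap k A c) t = c • t := by
  induction t using TensorProduct.induction_on with
  | zero => simp
  | add x y hx hy => simp only [map_add, hx, hy, smul_add]
  | tmul v m =>
    rw [actMap_tmul]
    conv_rhs => rw [← hρ.counitApply v]
    induction ρ v using TensorProduct.induction_on with
    | zero => simp
    | add x y hx hy => simp only [map_add, TensorProduct.add_tmul, hx, hy, smul_add]
    | tmul x h =>
      simp [Algebra.algebraMap_eq_smul_one, one_act, TensorProduct.smul_tmul']

lemma actMap_mul {ρ : V →ₗ[k] V ⊗[k] H} (hρ : IsCoaction ρ) (a b : A) (t : V ⊗[k] M) :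
    actMap ρ (a * b) t = actMap ρ a (actMap ρ b t) := by
  induction t using TensorProduct.induction_on with
  | zero => simp
  | add x y hx hy => simp only [map_add, hx, hy]
  | tmul v m =>
    rw [actMap_tmul, actMap_tmul]
    let F : V ⊗[k] (H ⊗[k] H) →ₗ[k] V ⊗[k] M := LinearMap.lTensor V
      ((Algebra.lsmul k k M).toLinearMap.flip m ∘ₗ LinearMap.mul' k A ∘ₗ
        TensorProduct.map (act a) (act b))
    have key := congrArg F (hρ.coassoc_apply v)
    refine Eq.trans ?_ (key.symm.trans ?_)
    · induction ρ v using TensorProduct.induction_on with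
      | zero => simp
      | add x y hx hy => simp only [map_add, TensorProduct.add_tmul, hx, hy]
      | tmul x h => simp [F, mul_act]
    · induction ρ v using TensorProduct.induction_on with
      | zero => simp
      | add x y hx hy => simp only [map_add, TensorProduct.add_tmul, hx, hy]
      | tmul x h =>
        simp only [LinearMap.rTensor_tmul, TensorProduct.assoc_tmul, LinearMap.lTensor_tmul,
          actMap_tmul]
        induction ρ x using TensorProduct.induction_on with
        | zero => simp
        | add x y hx hy => simp only [map_add, TensorProduct.add_tmul, hx, hy]
        | tmul x g => simp [F]

lemma actMap_map {ρ : V →ₗ[k] V ⊗[k] H} {τ : W →ₗ[k] W ⊗[k] H} {f : V →ₗ[k] W}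
    (hf : τ ∘ₗ f = f.rTensor H ∘ₗ ρ) (g : M →ₗ[A] N) (a : A) (t : V ⊗[k] M) :
    actMap τ a (TensorProduct.map f (g.restrictScalars k) t) =
      TensorProduct.map f (g.restrictScalars k) (actMap ρ a t) := by
  induction t using TensorProduct.induction_on with
  | zero => simp
  | add x y hx hy => simp only [map_add, hx, hy]
  | tmul v m =>
    have hf' := LinearMap.congr_fun hf v
    simp only [LinearMap.comp_apply] at hf'
    rw [TensorProduct.map_tmul, actMap_tmul, actMap_tmul, hf']
    induction ρ v using TensorProduct.induction_on with
    | zero => simp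
    | add x y hx hy => simp only [map_add, TensorProduct.add_tmul, hx, hy]
    | tmul x h => simp

lemma actMap_assoc {Q : Type u} [AddCommGroup Q] [Module k Q] [Module A Q] [IsScalarTower k A Q]
    (ρ : V →ₗ[k] V ⊗[k] H) (ρ' : W →ₗ[k] W ⊗[k] H) (i : W ⊗[k] M →ₗ[k] Q)
    (hi : ∀ (a : A) t, i (actMap ρ' a t) = a • i t) (a : A) (t : (V ⊗[k] W) ⊗[k] M) :
    i.lTensor V (TensorProduct.assoc k V W M (actMap (diagCoact ρ ρ') a t)) =
      actMap ρ a (i.lTensor V (TensorProduct.assoc k V W M t)) := by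
  induction t using TensorProduct.induction_on with
  | zero => simp
  | add x y hx hy => simp only [map_add, hx, hy]
  | tmul x m =>
    induction x using TensorProduct.induction_on with
    | zero => simp
    | add x y hx hy => simp only [map_add, TensorProduct.add_tmul, hx, hy]
    | tmul v w =>
      rw [actMap_tmul, diagCoact_tmul, TensorProduct.assoc_tmul, LinearMap.lTensor_tmul,
        actMap_tmul]
      induction ρ v using TensorProduct.induction_on with
      | zero => simp
      | add x y hx hy => simp only [map_add, TensorProduct.add_tmul, hx, hy]
      | tmul x g =>
        simp only [TensorProduct.assoc_tmul, LinearMap.lTensor_tmul, preAct_tmul, ← hi,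
          actMap_tmul]
        induction ρ' w using TensorProduct.induction_on with
        | zero => simp
        | add x y hx hy =>
          simp only [map_add, TensorProduct.add_tmul, TensorProduct.tmul_add, hx, hy]
        | tmul y h => simp [act_mul]

lemma actMap_lid (a : A) (t : k ⊗[k] M) :
    TensorProduct.lid k M (actMap (trivCoact k H) a t) = a • TensorProduct.lid k M t := by
  induction t using TensorProduct.induction_on with
  | zero => simp
  | add x y hx hy => simp only [map_add, hx, hy, smul_add]
  | tmul c m => simp [actMap_tmul, trivCoact, act_unit, smul_algebra_smul_comm]

/-- The tensor product `V ⊗ M` of an `H`-comodule `V` and an `A`-module `M`, to be equipped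
with the `A`-module structure `a (v ⊗ m) = v₍₀₎ ⊗ (a.v₍₁₎) m`. -/
def Act (A : Type u) [Ring A] (V : RComod k H) (M : Type u)
    [AddCommGroup M] [Module k M] [Module A M] : Type u := V ⊗[k] M

namespace Act

instance (V : RComod k H) : AddCommGroup (Act A V M) :=
  inferInstanceAs (AddCommGroup (V ⊗[k] M))

/-- The identity map `V ⊗ M → V ▷ M`. -/
def of (A : Type u) [Ring A] (V : RComod k H) (M : Type u)
    [AddCommGroup M] [Module k M] [Module A M] : V ⊗[k] M ≃+ Act A V M := AddEquiv.refl _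

/-- The elementary tensor `v ⊗ m` in `V ▷ M`. -/
def tmul (A : Type u) [Ring A] {V : RComod k H} {M : Type u}
    [AddCommGroup M] [Module k M] [Module A M] (v : V) (m : M) : Act A V M :=
  of A V M (v ⊗ₜ[k] m)

/-- `a (v ⊗ m) = v₍₀₎ ⊗ (a.v₍₁₎) m`. -/
instance (V : RComod k H) : Module A (Act A V M) where
  smul a t := of A V M (actMap V.coact a ((of A V M).symm t))
  one_smul t := by
    change of A V M (actMap V.coact 1 ((of A V M).symm t)) = t
    have := actMap_algebraMap (A := A) V.isCoaction 1 ((of A V M).symm t)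
    rw [map_one, one_smul] at this
    rw [this]
    rfl
  mul_smul a b t := actMap_mul V.isCoaction a b ((of A V M).symm t)
  smul_zero a := map_zero (actMap V.coact a)
  zero_smul t := by
    have := actMap_algebraMap (A := A) V.isCoaction 0 ((of A V M).symm t)
    rw [map_zero, zero_smul] at this
    exact this
  smul_add a := map_add (actMap V.coact a)
  add_smul a b t := LinearMap.congr_fun (actMap_add V.coact a b) ((of A V M).symm t)

lemma smul_def (V : RComod k H) (a : A) (t : Act A V M) :
    a • t = of A V M (actMap V.coact a ((of A V M).symm t)) := rfl

/-- The `k`-module structure on `V ▷ M` that underlies its `A`-module structure. -/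
instance (V : RComod k H) : Module k (Act A V M) := Module.restrictScalars k A (Act A V M)

instance (V : RComod k H) : IsScalarTower k A (Act A V M) :=
  IsScalarTower.restrictScalars k A (Act A V M)

/-- The identity map `V ⊗ M → V ▷ M` is `k`-linear. -/
def ofₗ (A : Type u) [Ring A] [Algebra k A] [RightModuleAlgebra k H A] (V : RComod k H)
    (M : Type u) [AddCommGroup M] [Module k M] [Module A M] [IsScalarTower k A M] :
    V ⊗[k] M ≃ₗ[k] Act A V M :=
  { of A V M with
    map_smul' := fun c t => (actMap_algebraMap (A := A) V.isCoaction c t).symm.trans rfl }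

/-- Functoriality of `V ▷ M`. -/
def map {V W : RComod k H} (f : V ⟶ W) (g : M →ₗ[A] N) : Act A V M →ₗ[A] Act A W N where
  toFun t := of A W N (TensorProduct.map f.hom (g.restrictScalars k) ((of A V M).symm t))
  map_add' s t := map_add (TensorProduct.map f.hom (g.restrictScalars k)) _ _
  map_smul' a t := (actMap_map f.coact_hom g a ((of A V M).symm t)).symm

lemma map_tmul {V W : RComod k H} (f : V ⟶ W) (g : M →ₗ[A] N) (v : V) (m : M) :
    map f g (tmul A v m) = tmul A (f.hom v) (g m) := rfl

@[elab_as_elim]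
lemma induction_on {V : RComod k H} {P : Act A V M → Prop} (t : Act A V M)
    (h0 : P 0) (ht : ∀ v m, P (tmul A v m)) (ha : ∀ s t, P s → P t → P (s + t)) : P t :=
  TensorProduct.induction_on (motive := P) t h0 ht ha

lemma ext_tmul {V : RComod k H} {f g : Act A V M →ₗ[A] N}
    (h : ∀ v m, f (tmul A v m) = g (tmul A v m)) : f = g := by
  apply LinearMap.ext
  intro t
  induction t using induction_on with
  | h0 => simp
  | ht v m => exact h v m
  | ha s t hs ht => rw [map_add, map_add, hs, ht]

lemma ext_tmul₂ {V W : RComod k H} {f g : Act A (V ⊗ W) M →ₗ[A] N}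
    (h : ∀ (v : V) (w : W) m,
      f (tmul A (V := V ⊗ W) (v ⊗ₜ[k] w) m) = g (tmul A (V := V ⊗ W) (v ⊗ₜ[k] w) m)) :
    f = g := by
  refine ext_tmul fun t m => ?_
  have key : ∀ f : Act A (V ⊗ W) M →ₗ[A] N, ∀ s t : V ⊗[k] W,
      f (tmul A (V := V ⊗ W) (s + t) m) = f (tmul A (V := V ⊗ W) s m) +
        f (tmul A (V := V ⊗ W) t m) := fun f s t => by
    rw [← map_add]
    exact congrArg f (TensorProduct.add_tmul s t m)
  have key0 : ∀ f : Act A (V ⊗ W) M →ₗ[A] N, f (tmul A (V := V ⊗ W) (0 : V ⊗[k] W) m) = 0 :=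
    fun f => by
      rw [← map_zero f]
      exact congrArg f (TensorProduct.zero_tmul _ m)
  refine TensorProduct.induction_on (motive := fun t : V ⊗[k] W =>
    f (tmul A (V := V ⊗ W) t m) = g (tmul A (V := V ⊗ W) t m)) t ?_ (fun v w => h v w m) ?_
  · rw [key0, key0]
  · intro s t hs ht
    rw [key, key, hs, ht]

lemma ext_tmul₃ {U V W : RComod k H} {f g : Act A ((U ⊗ V) ⊗ W) M →ₗ[A] N}
    (h : ∀ (u : U) (v : V) (w : W) m,
      f (tmul A (V := (U ⊗ V) ⊗ W) ((u ⊗ₜ[k] v) ⊗ₜ[k] w) m) =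
        g (tmul A (V := (U ⊗ V) ⊗ W) ((u ⊗ₜ[k] v) ⊗ₜ[k] w) m)) : f = g := by
  refine ext_tmul₂ fun t w m => ?_
  have key : ∀ f : Act A ((U ⊗ V) ⊗ W) M →ₗ[A] N, ∀ s t : U ⊗[k] V,
      f (tmul A (V := (U ⊗ V) ⊗ W) ((s + t) ⊗ₜ[k] w) m) =
        f (tmul A (V := (U ⊗ V) ⊗ W) (s ⊗ₜ[k] w) m) +
          f (tmul A (V := (U ⊗ V) ⊗ W) (t ⊗ₜ[k] w) m) := fun f s t => by
    rw [← map_add]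
    exact congrArg f ((congrArg (fun x : (U ⊗[k] V) ⊗[k] W => x ⊗ₜ[k] m)
      (TensorProduct.add_tmul s t w)).trans
        (TensorProduct.add_tmul (s ⊗ₜ[k] w) (t ⊗ₜ[k] w) m))
  have key0 : ∀ f : Act A ((U ⊗ V) ⊗ W) M →ₗ[A] N,
      f (tmul A (V := (U ⊗ V) ⊗ W) ((0 : U ⊗[k] V) ⊗ₜ[k] w) m) = 0 :=
    fun f => by
      rw [← map_zero f]
      exact congrArg f ((congrArg (fun x : (U ⊗[k] V) ⊗[k] W => x ⊗ₜ[k] m)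
        (TensorProduct.zero_tmul _ w)).trans (TensorProduct.zero_tmul _ m))
  refine TensorProduct.induction_on (motive := fun t : U ⊗[k] V =>
    f (tmul A (V := (U ⊗ V) ⊗ W) (t ⊗ₜ[k] w) m) =
      g (tmul A (V := (U ⊗ V) ⊗ W) (t ⊗ₜ[k] w) m)) t ?_ (fun u v => h u v w m) ?_
  · rw [key0, key0]
  · intro s t hs ht
    rw [key, key, hs, ht]

/-- `(V ⊗ W) ▷ M ≅ V ▷ (W ▷ M)`, `(v ⊗ w) ⊗ m ↦ v ⊗ (w ⊗ m)`. -/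
def assoc (V W : RComod k H) : Act A (V ⊗ W) M ≃ₗ[A] Act A V (Act A W M) :=
  { (TensorProduct.assoc k V W M ≪≫ₗ (ofₗ A W M).lTensor V).toAddEquiv with
    map_smul' := actMap_assoc V.coact W.coact (ofₗ A W M).toLinearMap (fun _ _ => rfl) }

/-- `k ▷ M ≅ M`, `c ⊗ m ↦ c m`. -/
def lid : Act A (𝟙_ (RComod k H)) M ≃ₗ[A] M :=
  { (TensorProduct.lid k M).toAddEquiv with
    map_smul' := actMap_lid (H := H) }

lemma assoc_tmul (V W : RComod k H) (v : V) (w : W) (m : M) :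
    assoc V W (tmul A (V := V ⊗ W) (v ⊗ₜ[k] w) m) = tmul A v (tmul A w m) := rfl

lemma lid_tmul (c : k) (m : M) :
    lid (H := H) (tmul A (V := 𝟙_ (RComod k H)) c m) = c • m := rfl

end Act

end Action

section ModuleCategory

variable {k H A : Type u} [Field k] [Ring H] [HopfAlgebra k H] [Ring A] [Algebra k A]
variable [RightModuleAlgebra k H A]

/-- The action of the monoidal category of right `H`-comodules on the category of left `A`-modules
for a right `H`-module algebra `A`: `V ▷ M = V ⊗ M` with `a (v ⊗ m) = v₍₀₎ ⊗ (a.v₍₁₎) m`. -/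
instance : MonoidalLeftAction (RComod k H) (ModuleCat.{u} A) where
  actionObj V M := ModuleCat.of A (Act A V M)
  actionHomLeft {V W} f M := ModuleCat.ofHom (Act.map f (LinearMap.id : M →ₗ[A] M))
  actionHomRight V {M N} g := ModuleCat.ofHom (Act.map (𝟙 V) g.hom)
  actionHom {V W} {M N} f g := ModuleCat.ofHom (Act.map f g.hom)
  actionAssocIso V W M := (Act.assoc V W).toModuleIso
  actionUnitIso M := Act.lid.toModuleIso
  actionHom_def f g := by
    ext : 1
    exact Act.ext_tmul fun v m => rfl
  actionHomRight_id V M := by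
    ext : 1
    exact Act.ext_tmul fun v m => rfl
  id_actionHomLeft V M := by
    ext : 1
    exact Act.ext_tmul fun v m => rfl
  actionHom_comp f₁ f₂ g₁ g₂ := by
    ext : 1
    exact Act.ext_tmul fun v m => rfl
  actionAssocIso_hom_naturality f g h := by
    ext : 1
    exact Act.ext_tmul₂ fun v w m => rfl
  actionUnitIso_hom_naturality f := by
    ext : 1
    refine Act.ext_tmul fun (c : k) m => ?_
    exact f.hom.map_smul_of_tower c m
  whiskerLeft_actionHomLeft V {W W'} f M := by
    ext : 1
    exact Act.ext_tmul₂ fun v w m => rfl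
  whiskerRight_actionHomLeft V f M := by
    ext : 1
    exact Act.ext_tmul₂ fun v w m => rfl
  associator_actionHom U V W M := by
    ext : 1
    exact Act.ext_tmul₃ fun u v w m => rfl
  leftUnitor_actionHom V M := by
    ext : 1
    refine Act.ext_tmul₂ fun (c : k) v m => ?_
    change Act.tmul A (c • v) m = c • Act.tmul A v m
    exact (congrArg (Act.of A V M) (TensorProduct.smul_tmul' c v m).symm).trans
      (map_smul (Act.ofₗ A V M) c (v ⊗ₜ[k] m))
  rightUnitor_actionHom V M := by
    ext : 1
    refine Act.ext_tmul₂ fun v (c : k) m => ?_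
    change Act.tmul A (c • v) m = Act.tmul A v (c • m)
    exact congrArg (Act.of A V M) (TensorProduct.smul_tmul c v m)

lemma actionHomLeft_tmul {V W : RComod k H} (f : V ⟶ W) (M : ModuleCat.{u} A) (v : V) (m : M) :
    (f ⊵ₗ M).hom (Act.tmul A v m) = Act.tmul A (f.hom v) m := rfl

lemma actionHomRight_tmul (V : RComod k H) {M N : ModuleCat.{u} A} (g : M ⟶ N) (v : V) (m : M) :
    (V ⊴ₗ g).hom (Act.tmul A v m) = Act.tmul A v (g.hom m) := rfl

lemma actionAssocIso_hom_tmul (V W : RComod k H) (M : ModuleCat.{u} A) (v : V) (w : W) (m : M) :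
    (αₗ V W M).hom.hom (Act.tmul A (V := V ⊗ W) (v ⊗ₜ[k] w) m) =
      Act.tmul A v (Act.tmul A w m) := rfl

lemma actionUnitIso_hom_tmul (M : ModuleCat.{u} A) (c : k) (m : M) :
    (λₗ[RComod k H] M).hom.hom (Act.tmul A (V := 𝟙_ (RComod k H)) c m) = c • m := rfl

end ModuleCategory


/-! ### Braided module categories and the reflective center -/

section ReflectiveCenter

open BraidedCategory MonoidalLeftAction

universe v₁ u₁ v₂ u₂

variable {C : Type u₁} [Category.{v₁} C] [MonoidalCategory C] [BraidedCategory C]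
variable {D : Type u₂} [Category.{v₂} D] [MonoidalLeftAction C D]

/-- The braiding `c_{X,Y} ▷ V`, as an isomorphism `X ▷ (Y ▷ V) ≅ Y ▷ (X ▷ V)`. -/
def swap (X Y : C) (V : D) : X ⊙ₗ Y ⊙ₗ V ≅ Y ⊙ₗ X ⊙ₗ V where
  hom := (αₗ X Y V).inv ≫ (β_ X Y).hom ⊵ₗ V ≫ (αₗ Y X V).hom
  inv := (αₗ Y X V).inv ≫ (β_ X Y).inv ⊵ₗ V ≫ (αₗ X Y V).hom
  hom_inv_id := by simp
  inv_hom_id := by simp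

lemma swap_naturality (X Y : C) {V W : D} (f : V ⟶ W) :
    X ⊴ₗ Y ⊴ₗ f ≫ (swap X Y W).hom = (swap X Y V).hom ≫ Y ⊴ₗ X ⊴ₗ f := by
  have h := action_exchange (β_ X Y).hom f
  simp only [tensor_actionHomRight] at h
  simp only [swap, Category.assoc]
  rw [← cancel_epi (αₗ X Y V).hom, ← cancel_mono (αₗ Y X W).inv]
  simpa using h

lemma swap_naturality_left {X X' : C} (f : X ⟶ X') (Y : C) (V : D) :
    f ⊵ₗ (Y ⊙ₗ V) ≫ (swap X' Y V).hom = (swap X Y V).hom ≫ Y ⊴ₗ (f ⊵ₗ V) := by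
  have h := congrArg (fun g => g ⊵ₗ V) (braiding_naturality_left f Y)
  simp only [comp_actionHomLeft, whiskerLeft_actionHomLeft] at h
  simp only [swap, Category.assoc]
  rw [← cancel_epi (αₗ X Y V).hom, ← cancel_mono (αₗ Y X' V).inv]
  simpa using h

lemma swap_naturality_right (X : C) {Y Y' : C} (f : Y ⟶ Y') (V : D) :
    X ⊴ₗ (f ⊵ₗ V) ≫ (swap X Y' V).hom = (swap X Y V).hom ≫ f ⊵ₗ (X ⊙ₗ V) := by
  have h := congrArg (fun g => g ⊵ₗ V) (braiding_naturality_right X f)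
  simp only [comp_actionHomLeft, whiskerLeft_actionHomLeft] at h
  simp only [swap, Category.assoc]
  rw [← cancel_epi (αₗ X Y V).hom, ← cancel_mono (αₗ Y' X V).inv]
  simpa using h

lemma associator_hom_actionHomLeft (X Y Z : C) (V : D) :
    (α_ X Y Z).hom ⊵ₗ V = (αₗ (X ⊗ Y) Z V).hom ≫ (αₗ X Y (Z ⊙ₗ V)).hom ≫
      X ⊴ₗ (αₗ Y Z V).inv ≫ (αₗ X (Y ⊗ Z) V).inv := by
  rw [← associator_actionHom_assoc]
  simp

lemma associator_inv_actionHomLeft (X Y Z : C) (V : D) :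
    (α_ X Y Z).inv ⊵ₗ V = (αₗ X (Y ⊗ Z) V).hom ≫ X ⊴ₗ (αₗ Y Z V).hom ≫
      (αₗ X Y (Z ⊙ₗ V)).inv ≫ (αₗ (X ⊗ Y) Z V).inv := by
  rw [← cancel_epi ((α_ X Y Z).hom ⊵ₗ V), hom_inv_actionHomLeft, associator_hom_actionHomLeft]
  simp

lemma swap_tensor_left (X Z Y : C) (V : D) :
    (swap (X ⊗ Z) Y V).hom = (αₗ X Z (Y ⊙ₗ V)).hom ≫ X ⊴ₗ (swap Z Y V).hom ≫
      (swap X Y (Z ⊙ₗ V)).hom ≫ Y ⊴ₗ (αₗ X Z V).inv := by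
  simp only [swap, braiding_tensor_left_hom, comp_actionHomLeft, whiskerLeft_actionHomLeft,
    whiskerRight_actionHomLeft, associator_hom_actionHomLeft, associator_inv_actionHomLeft,
    actionHomRight_comp, Category.assoc, Iso.inv_hom_id_assoc, Iso.hom_inv_id_assoc,
    actionHomRight_inv_hom_assoc, actionHomRight_hom_inv_assoc, Iso.inv_hom_id, Category.comp_id]

lemma swap_tensor_right (X Y Z : C) (V : D) :
    (swap X (Y ⊗ Z) V).hom = X ⊴ₗ (αₗ Y Z V).hom ≫ (swap X Y (Z ⊙ₗ V)).hom ≫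
      Y ⊴ₗ (swap X Z V).hom ≫ (αₗ Y Z (X ⊙ₗ V)).inv := by
  simp only [swap, braiding_tensor_right_hom, comp_actionHomLeft, whiskerLeft_actionHomLeft,
    whiskerRight_actionHomLeft, associator_hom_actionHomLeft, associator_inv_actionHomLeft,
    actionHomRight_comp, Category.assoc, Iso.inv_hom_id_assoc, Iso.hom_inv_id_assoc,
    actionHomRight_inv_hom_assoc, actionHomRight_hom_inv_assoc, Iso.inv_hom_id, Category.comp_id]

lemma swap_unit_left (Y : C) (V : D) :
    (swap (𝟙_ C) Y V).hom = (λₗ (Y ⊙ₗ V)).hom ≫ Y ⊴ₗ (λₗ V).inv := by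
  have e : (β_ (𝟙_ C) Y).hom = (λ_ Y).hom ≫ (ρ_ Y).inv := by simp
  have e2 : (ρ_ Y).inv ⊵ₗ V = Y ⊴ₗ (λₗ V).inv ≫ (αₗ _ _ _).inv := by
    rw [← cancel_epi ((ρ_ Y).hom ⊵ₗ V), hom_inv_actionHomLeft]
    simp
  simp only [swap, e, comp_actionHomLeft, leftUnitor_actionHom, e2]
  simp

lemma swap_unit_right (X : C) (V : D) :
    (swap X (𝟙_ C) V).hom = X ⊴ₗ (λₗ V).hom ≫ (λₗ (X ⊙ₗ V)).inv := by
  have e : (β_ X (𝟙_ C)).hom = (ρ_ X).hom ≫ (λ_ X).inv := by simp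
  have e2 : (λ_ X).inv ⊵ₗ V = (λₗ (X ⊙ₗ V)).inv ≫ (αₗ _ _ _).inv := by
    rw [← cancel_epi ((λ_ X).hom ⊵ₗ V), hom_inv_actionHomLeft]
    simp
  simp only [swap, e, comp_actionHomLeft, rightUnitor_actionHom, e2]
  simp

lemma swap_yang_baxter (X Y Z : C) (V : D) :
    X ⊴ₗ (swap Y Z V).hom ≫ (swap X Z (Y ⊙ₗ V)).hom ≫ Z ⊴ₗ (swap X Y V).hom =
      (swap X Y (Z ⊙ₗ V)).hom ≫ Y ⊴ₗ (swap X Z V).hom ≫ (swap Y Z (X ⊙ₗ V)).hom := by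
  have h := swap_naturality_left (β_ X Y).hom Z V
  have e (U : D) : (β_ X Y).hom ⊵ₗ U = (αₗ X Y U).hom ≫ (swap X Y U).hom ≫ (αₗ Y X U).inv := by
    simp [swap]
  rw [e, e, swap_tensor_left, swap_tensor_left] at h
  simp only [Category.assoc, Iso.inv_hom_id_assoc, actionHomRight_comp, cancel_epi,
    actionHomRight_inv_hom_assoc] at h
  simp only [← Category.assoc, cancel_mono] at h
  simpa only [Category.assoc] using h.symm

variable (C D) in
/-- A braiding on the left `C`-module category `D`: natural isomorphisms
`e_{X,V} : X ▷ V → X ▷ V` such that (suppressing associativity)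
`e_{X ⊗ Y, V} = (X ▷ e_{Y,V}) c_{Y,X} (Y ▷ e_{X,V}) c_{Y,X}⁻¹` and
`e_{X, Y ▷ V} = c_{Y,X} (Y ▷ e_{X,V}) c_{X,Y}`. -/
class BraidedModuleCategory where
  e (X : C) (V : D) : X ⊙ₗ V ≅ X ⊙ₗ V
  e_naturality_left {X Y : C} (f : X ⟶ Y) (V : D) :
    f ⊵ₗ V ≫ (e Y V).hom = (e X V).hom ≫ f ⊵ₗ V
  e_naturality_right (X : C) {V W : D} (g : V ⟶ W) :
    X ⊴ₗ g ≫ (e X W).hom = (e X V).hom ≫ X ⊴ₗ g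
  e_tensor (X Y : C) (V : D) : (e (X ⊗ Y) V).hom =
    (αₗ X Y V).hom ≫ (swap Y X V).inv ≫ Y ⊴ₗ (e X V).hom ≫ (swap Y X V).hom ≫
      X ⊴ₗ (e Y V).hom ≫ (αₗ X Y V).inv
  e_action (X Y : C) (V : D) : (e X (Y ⊙ₗ V)).hom =
    (swap X Y V).hom ≫ Y ⊴ₗ (e X V).hom ≫ (swap Y X V).hom

variable (C D) in
/-- Objects of the reflective center of the `C`-module category `D`: objects `V` of `D` with
isomorphisms `e_X : X ▷ V → X ▷ V`, natural in `X`, such that `e_I = id` and (suppressing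
associativity) `e_{X ⊗ Y} = (X ▷ e_Y) c_{Y,X} (Y ▷ e_X) c_{Y,X}⁻¹`. -/
structure ReflectiveCenter where
  obj : D
  e (X : C) : X ⊙ₗ obj ≅ X ⊙ₗ obj
  naturality {X Y : C} (f : X ⟶ Y) : f ⊵ₗ obj ≫ (e Y).hom = (e X).hom ≫ f ⊵ₗ obj
  e_unit : (e (𝟙_ C)).hom = 𝟙 _
  e_tensor (X Y : C) : (e (X ⊗ Y)).hom =
    (αₗ X Y obj).hom ≫ (swap Y X obj).inv ≫ Y ⊴ₗ (e X).hom ≫ (swap Y X obj).hom ≫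
      X ⊴ₗ (e Y).hom ≫ (αₗ X Y obj).inv

namespace ReflectiveCenter

/-- Morphisms in the reflective center: morphisms of `D` that commute with the `e_X`. -/
@[ext]
structure Hom (V W : ReflectiveCenter C D) where
  hom : V.obj ⟶ W.obj
  comm (X : C) : X ⊴ₗ hom ≫ (W.e X).hom = (V.e X).hom ≫ X ⊴ₗ hom

instance : Category (ReflectiveCenter C D) where
  Hom := Hom
  id V := ⟨𝟙 _, by simp⟩
  comp f g := ⟨f.hom ≫ g.hom, fun X => by
    rw [actionHomRight_comp, Category.assoc, g.comm, reassoc_of% f.comm]⟩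

@[ext]
lemma hom_ext {V W : ReflectiveCenter C D} {f g : V ⟶ W} (h : f.hom = g.hom) : f = g := Hom.ext h

@[simp] lemma id_hom (V : ReflectiveCenter C D) : Hom.hom (𝟙 V) = 𝟙 V.obj := rfl

@[simp] lemma comp_hom {U V W : ReflectiveCenter C D} (f : U ⟶ V) (g : V ⟶ W) :
    Hom.hom (f ≫ g) = f.hom ≫ g.hom := rfl

variable (C D) in
/-- The underlying functor to `D`. -/
@[simps]
def forget : ReflectiveCenter C D ⥤ D where
  obj V := V.obj
  map f := f.hom

/-- An isomorphism of `D` that commutes with the `e_X` is an isomorphism in the center. -/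
@[simps]
def mkIso {V W : ReflectiveCenter C D} (f : V.obj ≅ W.obj)
    (h : ∀ X : C, X ⊴ₗ f.hom ≫ (W.e X).hom = (V.e X).hom ≫ X ⊴ₗ f.hom) : V ≅ W where
  hom := ⟨f.hom, h⟩
  inv := ⟨f.inv, fun X => by
    rw [← cancel_epi (X ⊴ₗ f.hom), ← cancel_mono (X ⊴ₗ f.hom)]
    simp [h]⟩

/-- The isomorphism `e_{X, Y ▷ V} = c_{Y,X} (Y ▷ e_{X,V}) c_{X,Y}`. -/
@[simps]
def eAct (V : ReflectiveCenter C D) (X Y : C) : X ⊙ₗ Y ⊙ₗ V.obj ≅ X ⊙ₗ Y ⊙ₗ V.obj where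
  hom := (swap X Y V.obj).hom ≫ Y ⊴ₗ (V.e X).hom ≫ (swap Y X V.obj).hom
  inv := (swap Y X V.obj).inv ≫ Y ⊴ₗ (V.e X).inv ≫ (swap X Y V.obj).inv

lemma eAct_tensor (V : ReflectiveCenter C D) (X Z Y : C) :
    (V.eAct (X ⊗ Z) Y).hom =
    (αₗ X Z (Y ⊙ₗ V.obj)).hom ≫ (swap Z X (Y ⊙ₗ V.obj)).inv ≫ Z ⊴ₗ (V.eAct X Y).hom ≫
      (swap Z X (Y ⊙ₗ V.obj)).hom ≫ X ⊴ₗ (V.eAct Z Y).hom ≫ (αₗ X Z (Y ⊙ₗ V.obj)).inv := by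
  have h1 := swap_yang_baxter Z Y X V.obj
  have h2 : (swap Z X (Y ⊙ₗ V.obj)).inv ≫ Z ⊴ₗ (swap X Y V.obj).hom ≫
      (swap Z Y (X ⊙ₗ V.obj)).hom = X ⊴ₗ (swap Z Y V.obj).hom ≫ (swap X Y (Z ⊙ₗ V.obj)).hom ≫
        Y ⊴ₗ (swap Z X V.obj).inv := by
    have h := swap_yang_baxter Z X Y V.obj
    rw [Iso.inv_comp_eq, ← cancel_mono (Y ⊴ₗ (swap Z X V.obj).hom)]
    simpa using h
  simp only [eAct_hom, swap_tensor_left, swap_tensor_right, V.e_tensor, actionHomRight_comp,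
    Category.assoc, actionHomRight_inv_hom_assoc]
  have h3 := swap_naturality Z Y (V.e X).hom
  have h4 := swap_naturality Y X (V.e Z).hom
  rw [reassoc_of% h1, reassoc_of% h3, reassoc_of% h2, reassoc_of% h4]

/-- The module braiding at `X ▷ V` commutes with `X ▷ e_Y`. -/
lemma eAct_comm (V : ReflectiveCenter C D) (X Y : C) :
    Y ⊴ₗ (V.e X).hom ≫ (V.eAct Y X).hom = (V.eAct Y X).hom ≫ Y ⊴ₗ (V.e X).hom := by
  have h := V.naturality (β_ X Y).hom
  have e : (β_ X Y).hom ⊵ₗ V.obj =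
      (αₗ X Y V.obj).hom ≫ (swap X Y V.obj).hom ≫ (αₗ Y X V.obj).inv := by
    simp [swap]
  simp only [e, V.e_tensor, Category.assoc, Iso.inv_hom_id_assoc, Iso.hom_inv_id_assoc,
    cancel_epi] at h
  rw [Iso.eq_inv_comp] at h
  simp only [← Category.assoc, cancel_mono] at h
  simpa using h.symm

/-- The action of `C` on the reflective center: `Y ▷ (V, e) = (Y ▷ V, e_{-, Y ▷ V})`. -/
@[simps]
def act (Y : C) (V : ReflectiveCenter C D) : ReflectiveCenter C D where
  obj := Y ⊙ₗ V.obj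
  e X := V.eAct X Y
  naturality {X X'} f := by
    simp only [eAct_hom, Category.assoc]
    rw [reassoc_of% swap_naturality_left, ← swap_naturality_right, ← actionHomRight_comp_assoc,
      V.naturality, actionHomRight_comp_assoc]
  e_unit := by
    simp [eAct, V.e_unit, swap_unit_left, swap_unit_right]
  e_tensor X Z := V.eAct_tensor X Z Y

/-- The action of a morphism of `C` on the identity of `V`. -/
def actLeft {Y Y' : C} (f : Y ⟶ Y') (V : ReflectiveCenter C D) : act Y V ⟶ act Y' V :=
  ⟨f ⊵ₗ V.obj, fun X => by
    change X ⊴ₗ (f ⊵ₗ V.obj) ≫ (V.eAct X Y').hom = (V.eAct X Y).hom ≫ X ⊴ₗ (f ⊵ₗ V.obj)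
    simp only [eAct_hom, Category.assoc]
    rw [reassoc_of% swap_naturality_right, ← action_exchange_assoc, swap_naturality_left]⟩

/-- The action of the identity of `Y` on a morphism of the center. -/
def actRight (Y : C) {V W : ReflectiveCenter C D} (g : V ⟶ W) : act Y V ⟶ act Y W :=
  ⟨Y ⊴ₗ g.hom, fun X => by
    change X ⊴ₗ (Y ⊴ₗ g.hom) ≫ (W.eAct X Y).hom = (V.eAct X Y).hom ≫ X ⊴ₗ (Y ⊴ₗ g.hom)
    simp only [eAct_hom, Category.assoc]
    rw [reassoc_of% swap_naturality, ← swap_naturality, ← actionHomRight_comp_assoc, g.comm,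
      actionHomRight_comp_assoc]⟩

instance : MonoidalLeftAction C (ReflectiveCenter C D) where
  actionObj Y V := act Y V
  actionHomLeft f V := actLeft f V
  actionHomRight Y _ _ g := actRight Y g
  actionHom {Y Y'} {V W} f g := ⟨f ⊙ₗₘ g.hom, fun X => by
    rw [actionHom_def]
    exact (actLeft f V ≫ actRight Y' g).comm X⟩
  actionAssocIso Y Z V := mkIso (V := act (Y ⊗ Z) V) (W := act Y (act Z V)) (αₗ Y Z V.obj)
    (fun X => by
      change X ⊴ₗ (αₗ Y Z V.obj).hom ≫ ((act Z V).eAct X Y).hom =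
        (V.eAct X (Y ⊗ Z)).hom ≫ X ⊴ₗ (αₗ Y Z V.obj).hom
      change X ⊴ₗ (αₗ Y Z V.obj).hom ≫ (swap X Y (Z ⊙ₗ V.obj)).hom ≫
        Y ⊴ₗ (V.eAct X Z).hom ≫ (swap Y X (Z ⊙ₗ V.obj)).hom = _
      simp [swap_tensor_left, swap_tensor_right])
  actionUnitIso V := mkIso (V := act (𝟙_ C) V) (W := V) (λₗ V.obj) (fun X => by
      change X ⊴ₗ (λₗ V.obj).hom ≫ (V.e X).hom =
        (V.eAct X (𝟙_ C)).hom ≫ X ⊴ₗ (λₗ V.obj).hom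
      simp [swap_unit_left, swap_unit_right])
  actionHom_def f g := hom_ext (actionHom_def f g.hom)
  actionHomRight_id X V := hom_ext (actionHomRight_id X V.obj)
  id_actionHomLeft X V := hom_ext (id_actionHomLeft X V.obj)
  actionHom_comp f₁ f₂ g₁ g₂ := hom_ext (actionHom_comp f₁ f₂ g₁.hom g₂.hom)
  actionAssocIso_hom_naturality f g h := hom_ext (actionAssocIso_hom_naturality f g h.hom)
  actionUnitIso_hom_naturality f := hom_ext (actionUnitIso_hom_naturality f.hom)
  whiskerLeft_actionHomLeft X _ _ f V := hom_ext (whiskerLeft_actionHomLeft X f V.obj)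
  whiskerRight_actionHomLeft X f V := hom_ext (whiskerRight_actionHomLeft X f V.obj)
  associator_actionHom X Y Z V := hom_ext (associator_actionHom X Y Z V.obj)
  leftUnitor_actionHom X V := hom_ext (leftUnitor_actionHom X V.obj)
  rightUnitor_actionHom X V := hom_ext (rightUnitor_actionHom X V.obj)

/-- The reflective center is a braided module category. -/
instance : BraidedModuleCategory C (ReflectiveCenter C D) where
  e X V := mkIso (V := act X V) (W := act X V) (V.e X) (fun Y => V.eAct_comm X Y)
  e_naturality_left f V := by
    ext : 1
    exact V.naturality f
  e_naturality_right X {V W} g := by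
    ext : 1
    exact g.comm X
  e_tensor X Y V := by
    ext : 1
    exact V.e_tensor X Y
  e_action X Y V := by
    ext : 1
    rfl

end ReflectiveCenter

end ReflectiveCenter

/-! ### The data of the reflective algebra -/

section ReflectiveAlgebra

open TensorProduct Coalgebra CoquasitriangularStructure

/-- `(a ⊗ b) ⊗ (c ⊗ d) ↦ φ(b ⊗ c) a ⊗ d`. -/
def contractMid {k H : Type u} [Field k] [AddCommGroup H] [Module k H]
    (φ : H ⊗[k] H →ₗ[k] k) : (H ⊗[k] H) ⊗[k] (H ⊗[k] H) →ₗ[k] H ⊗[k] H :=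
  ((TensorProduct.lid k H).toLinearMap ∘ₗ φ.rTensor H ∘ₗ
      (TensorProduct.assoc k H H H).symm.toLinearMap).lTensor H ∘ₗ
    (TensorProduct.assoc k H H (H ⊗[k] H)).toLinearMap

section

variable (k H : Type u) [Field k] [Ring H] [HopfAlgebra k H]

/-- The coadjoint coaction `h ↦ h₍₂₎ ⊗ S(h₍₁₎) h₍₃₎`. -/
def coad : H →ₗ[k] H ⊗[k] H :=
  (LinearMap.mul' k H ∘ₗ (HopfAlgebra.antipode k (A := H)).rTensor H).lTensor H ∘ₗ
    (TensorProduct.leftComm k H H H).toLinearMap ∘ₗ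
      (comul (R := k) (A := H)).lTensor H ∘ₗ comul (R := k) (A := H)

variable [CoquasitriangularStructure k H]

/-- The transmuted product
`g • h = g₍₂₎ h₍₃₎ r(g₍₃₎ ⊗ S(h₍₁₎)) r(g₍₁₎ ⊗ h₍₂₎)`, obtained as the composite of
`g ⊗ h ↦ r(g₍₂₎ ⊗ S(h₍₁₎)) g₍₁₎ ⊗ h₍₂₎` and `g ⊗ h ↦ r(g₍₁₎ ⊗ h₍₁₎) g₍₂₎ h₍₂₎`. -/
def transMul : H →ₗ[k] H →ₗ[k] H :=
  TensorProduct.curry <|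
    ((TensorProduct.lid k H).toLinearMap ∘ₗ TensorProduct.map r (LinearMap.mul' k H) ∘ₗ
        comul (R := k) (A := H ⊗[k] H)) ∘ₗ
      contractMid (r ∘ₗ (HopfAlgebra.antipode k (A := H)).lTensor H) ∘ₗ
        TensorProduct.map (comul (R := k) (A := H)) (comul (R := k) (A := H))

/-- The action `h ↼ g = h₍₂₎ r(g₍₁₎ ⊗ h₍₁₎) r(h₍₃₎ ⊗ g₍₂₎)`, obtained as the composite of
`h ⊗ g ↦ h₍₁₎ ⊗ g₍₁₎ r(h₍₂₎ ⊗ g₍₂₎)` and `h ⊗ g ↦ r(g ⊗ h₍₁₎) h₍₂₎`. -/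
def centralHit : H →ₗ[k] H →ₗ[k] H :=
  TensorProduct.curry <|
    ((TensorProduct.lid k H).toLinearMap ∘ₗ r.rTensor H ∘ₗ
        (TensorProduct.assoc k H H H).symm.toLinearMap ∘ₗ
          (comul (R := k) (A := H)).lTensor H ∘ₗ (TensorProduct.comm k H H).toLinearMap) ∘ₗ
      ((TensorProduct.rid k (H ⊗[k] H)).toLinearMap ∘ₗ r.lTensor (H ⊗[k] H) ∘ₗ
        comul (R := k) (A := H ⊗[k] H))

end

section

variable {k H B : Type u} [Field k] [Ring H] [HopfAlgebra k H] [CoquasitriangularStructure k H]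
variable [Ring B] [Algebra k B]

/-- A reflective structure on the right `H`-module algebra `B`: a convolution invertible map
`K : H → B` with
* `K(h₍₁₎) (b.h₍₂₎) = (b.h₍₁₎) K(h₍₂₎)`,
* `K(g h) = K(h₍₁₎) r(h₍₂₎ ⊗ g₍₁₎) K(g₍₂₎) r⁻¹(h₍₃₎ ⊗ g₍₃₎)`,
* `K(g).h = r(h₍₁₎ ⊗ g₍₁₎) K(g₍₂₎) r(g₍₃₎ ⊗ h₍₂₎)`, that is, `K(g).h = K(g ↼ h)`. -/
structure IsReflectiveStructure [RightModuleAlgebra k H B] (K : H →ₗ[k] B) : Prop where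
  exists_inv : ∃ K' : H →ₗ[k] B,
    LinearMap.mul' k B ∘ₗ TensorProduct.map K K' ∘ₗ comul =
      Algebra.linearMap k B ∘ₗ counit (R := k) (A := H) ∧
    LinearMap.mul' k B ∘ₗ TensorProduct.map K' K ∘ₗ comul =
      Algebra.linearMap k B ∘ₗ counit (R := k) (A := H)
  comm (b : B) (h : H) :
    LinearMap.mul' k B (TensorProduct.map K
        (RightModuleAlgebra.act (k := k) (H := H) b) (comul (R := k) h)) =
      LinearMap.mul' k B (TensorProduct.map
        (RightModuleAlgebra.act (k := k) (H := H) b) K (comul (R := k) h))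
  map_mul : K ∘ₗ LinearMap.mul' k H =
    (LinearMap.mul' k B ∘ₗ TensorProduct.map K K ∘ₗ contractMid r ∘ₗ
        TensorProduct.map (comul (R := k) (A := H)) (comul (R := k) (A := H)) ∘ₗ
          (TensorProduct.comm k H H).toLinearMap) ∘ₗ
      ((TensorProduct.rid k (H ⊗[k] H)).toLinearMap ∘ₗ
        (rInv ∘ₗ (TensorProduct.comm k H H).toLinearMap).lTensor (H ⊗[k] H) ∘ₗ
          comul (R := k) (A := H ⊗[k] H))
  act_map (g h : H) : RightModuleAlgebra.act (k := k) (K g) h = K (centralHit k H g h)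

/-- `v ⊗ m ↦ v₍₀₎ ⊗ K(v₍₁₎) m`. -/
def kMap (K : H →ₗ[k] B) (V : RComod k H) (M : Type u) [AddCommGroup M] [Module k M] [Module B M]
    [IsScalarTower k B M] : V ⊗[k] M →ₗ[k] V ⊗[k] M :=
  (TensorProduct.lift ((Algebra.lsmul k k M).toLinearMap ∘ₗ K)).lTensor V ∘ₗ
    (TensorProduct.assoc k V H M).toLinearMap ∘ₗ V.coact.rTensor M

end

end ReflectiveAlgebra

end ReflAlg

end

/-!
All identities that involve the coproduct are treated as identities in convolution algebras
`WithConv (C →ₗ[k] R)`. For functionals on `H ⊗ H` the ring homomorphisms `slot₁` and `slot₂` put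
a functional `φ` on `H` in one of the two variables; write `φ₁`, `φ₂` for the results, `m` for the
product of `H`, and `r₂₁` for the flipped form, with values in the scalars of `R`. The product
formula for a reflective structure `K` is then the reflection equation
`(K ∘ m) * r₂₁ = K₂ * r₂₁ * K₁`, and the functional `g ⊗ h ↦ K(g ↼ h)` is `r₂₁ * K₁ * r`
(`map_centralHit`).

A *reflective pair* in an algebra `R` (`IsReflectivePair`) is an algebra map `ι : A → R` with a
linear map `κ : H → R` such that `κ(1) = 1`, `κ(h₍₁₎) ι(a.h₍₂₎) = ι(a.h₍₁₎) κ(h₍₂₎)`, and `κ`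
solves the reflection equation. A solution of the reflection equation is multiplicative for the
transmuted product (`map_transMul_of_reflection`), and it follows that `h ⊗ a ↦ κ(h) ι(a)` is
multiplicative for the product of `A[H]` (`IsReflectivePair.pairLift_mul`). This is the universal
property of `A[H]`, and everything else is an application of it to a suitable `R`.

* `R = End (H ⊗ A)` gives associativity. The transmuted product is right multiplication followed
  by `r` along the coadjoint coaction, `g • x = x₍₀₎ g₍₁₎ r(g₍₂₎ | x₍₁₎)` (`transMul_eq`); an
  exchange relation between these two factors shows that left multiplication `g ↦ (x ↦ g • x)`
  solves the reflection equation (`mulPull_transMul`). Together with `A` acting through the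
  coadjoint coaction it is a reflective pair (`isReflectivePair_smash`), hence left
  multiplications of `A[H]` are multiplicative. The pair `(x ↦ 1 # x, h ↦ h # 1)` is the universal
  one.
* `R = Conv(H, A[H])` gives the module algebra structure: if `(ι, κ)` is a reflective pair, then
  so is the pair of the families `h ↦ ι(a.h)` and `h ↦ κ(g ↼ h)` (`IsReflectivePair.hit`), where
  the reflection equation rests on the Yang-Baxter equation for `r`.
* `R = End M` gives modules over `A[H]`. A functional `φ : H → End M` acts on `V ⊗ M` by
  `v ⊗ m ↦ v₍₀₎ ⊗ φ(v₍₁₎) m` (`coactOp`), and convolution becomes composition. The braiding of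
  comodules is the operator of `r` followed by the flip (`swap_hom_actTensor`), so the tensor
  axiom of the reflective center is the reflection equation for `φ` (`reflHom_tensor_iff`),
  `A`-linearity is the relation between `κ` and `ι`, and the reflection on `V ▷ (W ▷ M)` is
  `r₂₁ * φ₁ * r` (`eAct_reflObj`), which is the formula for `K(g).h`. Hence an invertible
  reflective pair in `End M` is an object of the reflective center (`reflObj`). Conversely, the
  reflections of an object are determined by the one on the regular comodule `H`, by naturality
  along the matrix coefficients of a comodule, and the latter is determined by the functional
  `c ↦ (m ↦ (ε ⊗ 1) e_H(c ⊗ m))` (`ReflectiveCenter.op_eq`), which is therefore part of a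
  reflective pair (`ReflectiveCenter.isReflectivePair_functional`). This makes restriction of
  scalars essentially surjective onto the reflective center; it is full because `A[H]` is spanned
  by the products `K(h) (1 # x)`.

What remains is that `K` is convolution invertible. By `transMul_eq` this reduces to the
convolution invertibility of the identity of `H` with values in the opposite algebra, that is, to
the existence of a skew antipode (`exists_convOp_inv`). It is obtained by conjugating the antipode
with the functional `u(x) = r(x₍₂₎ | S(x₍₁₎))`, which implements the square of the antipode
(`drinfeldForm_mul_id`).
-/

noncomputable section

namespace ReflAlg

/-! ### Convolution algebras and their slots -/

section Convolution

open Coalgebra TensorProduct WithConv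

variable {k : Type*} [Field k]
variable {C D E : Type*} [AddCommGroup C] [Module k C] [Coalgebra k C]
variable [AddCommGroup D] [Module k D] [Coalgebra k D]
variable [AddCommGroup E] [Module k E] [Coalgebra k E]
variable {R S : Type*} [Ring R] [Algebra k R] [Ring S] [Algebra k S]

/-- Precomposition with a coalgebra map is a map of convolution algebras. -/
def convPull (R : Type*) [Ring R] [Algebra k R] (f : D →ₗc[k] C) :
    WithConv (C →ₗ[k] R) →+* WithConv (D →ₗ[k] R) where
  toFun φ := toConv (φ.ofConv ∘ₗ f.toLinearMap)
  map_one' := by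
    ext d
    simp
  map_mul' φ ψ := congrArg toConv (LinearMap.convMul_comp_coalgHom_distrib φ ψ f)
  map_zero' := rfl
  map_add' _ _ := rfl

@[simp] lemma convPull_apply (f : D →ₗc[k] C) (φ : WithConv (C →ₗ[k] R)) (d : D) :
    convPull R f φ d = φ (f d) := rfl

/-- Postcomposition with an algebra map is a map of convolution algebras. -/
def convPush (C : Type*) [AddCommGroup C] [Module k C] [Coalgebra k C] (h : R →ₐ[k] S) :
    WithConv (C →ₗ[k] R) →+* WithConv (C →ₗ[k] S) where
  toFun φ := toConv (h.toLinearMap ∘ₗ φ.ofConv)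
  map_one' := by
    ext d
    simp
  map_mul' φ ψ := congrArg toConv (LinearMap.algHom_comp_convMul_distrib h φ ψ)
  map_zero' := by ext; simp
  map_add' _ _ := by ext; simp

@[simp] lemma convPush_apply (h : R →ₐ[k] S) (φ : WithConv (C →ₗ[k] R)) (c : C) :
    convPush C h φ c = h (φ c) := rfl

/-- `c ⊗ d ↦ ε(d) c`. -/
def coalgFst (k C D : Type*) [Field k] [AddCommGroup C] [Module k C] [Coalgebra k C]
    [AddCommGroup D] [Module k D] [Coalgebra k D] : C ⊗[k] D →ₗc[k] C :=
  (Coalgebra.TensorProduct.rid k k C).toCoalgHom.comp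
    (Coalgebra.TensorProduct.map (CoalgHom.id k C) (Coalgebra.counitCoalgHom k D))

/-- `c ⊗ d ↦ ε(c) d`. -/
def coalgSnd (k C D : Type*) [Field k] [AddCommGroup C] [Module k C] [Coalgebra k C]
    [AddCommGroup D] [Module k D] [Coalgebra k D] : C ⊗[k] D →ₗc[k] D :=
  (Coalgebra.TensorProduct.lid k D).toCoalgHom.comp
    (Coalgebra.TensorProduct.map (Coalgebra.counitCoalgHom k C) (CoalgHom.id k D))

@[simp] lemma coalgFst_tmul (c : C) (d : D) :
    coalgFst k C D (c ⊗ₜ d) = counit (R := k) d • c := rfl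

@[simp] lemma coalgSnd_tmul (c : C) (d : D) :
    coalgSnd k C D (c ⊗ₜ d) = counit (R := k) c • d := rfl

/-- A convolution factor in the first slot: `c ⊗ d ↦ ε(d) φ(c)`. -/
def slot₁ (D : Type*) [AddCommGroup D] [Module k D] [Coalgebra k D] :
    WithConv (C →ₗ[k] R) →+* WithConv (C ⊗[k] D →ₗ[k] R) := convPull R (coalgFst k C D)

/-- A convolution factor in the second slot: `c ⊗ d ↦ ε(c) φ(d)`. -/
def slot₂ (C : Type*) [AddCommGroup C] [Module k C] [Coalgebra k C] :
    WithConv (D →ₗ[k] R) →+* WithConv (C ⊗[k] D →ₗ[k] R) := convPull R (coalgSnd k C D)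

@[simp] lemma slot₁_apply_tmul (φ : WithConv (C →ₗ[k] R)) (c : C) (d : D) :
    slot₁ D φ (c ⊗ₜ d) = counit (R := k) d • φ c := by
  simp [slot₁]

@[simp] lemma slot₂_apply_tmul (φ : WithConv (D →ₗ[k] R)) (c : C) (d : D) :
    slot₂ C φ (c ⊗ₜ d) = counit (R := k) c • φ d := by
  simp [slot₂]

lemma sum_counit_right_smul {ι : Type*} {c : C} (𝓒 : Coalgebra.Repr k c ι) :
    ∑ i ∈ 𝓒.index, counit (R := k) (𝓒.right i) • 𝓒.left i = c := by
  have := congrArg (TensorProduct.rid k C) (sum_tmul_counit_eq 𝓒)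
  rw [map_sum] at this
  simpa only [TensorProduct.rid_tmul, one_smul] using this

lemma conv_ext_tmul {φ ψ : WithConv (C ⊗[k] D →ₗ[k] R)} (h : ∀ c d, φ (c ⊗ₜ d) = ψ (c ⊗ₜ d)) :
    φ = ψ := WithConv.ext (TensorProduct.ext' h)

lemma convMul_tmul_apply {ι κ : Type*} (φ ψ : WithConv (C ⊗[k] D →ₗ[k] R)) {c : C} {d : D}
    (𝓒 : Coalgebra.Repr k c ι) (𝓓 : Coalgebra.Repr k d κ) :
    (φ * ψ) (c ⊗ₜ d) = ∑ i ∈ 𝓒.index, ∑ j ∈ 𝓓.index,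
      φ (𝓒.left i ⊗ₜ 𝓓.left j) * ψ (𝓒.right i ⊗ₜ 𝓓.right j) := by
  rw [LinearMap.convMul_apply, TensorProduct.comul_tmul, ← 𝓒.eq, ← 𝓓.eq]
  simp only [TensorProduct.sum_tmul, TensorProduct.tmul_sum, map_sum, LinearEquiv.coe_coe,
    TensorProduct.AlgebraTensorModule.tensorTensorTensorComm_tmul, TensorProduct.map_tmul,
    LinearMap.mul'_apply]
  exact Finset.sum_comm

lemma slot₁_mul_apply (φ : WithConv (C →ₗ[k] R)) (ψ : WithConv (C ⊗[k] D →ₗ[k] R)) {ι : Type*}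
    {c : C} (𝓒 : Coalgebra.Repr k c ι) (d : D) :
    (slot₁ D φ * ψ) (c ⊗ₜ d) = ∑ i ∈ 𝓒.index, φ (𝓒.left i) * ψ (𝓒.right i ⊗ₜ d) := by
  rw [convMul_tmul_apply _ _ 𝓒 (ℛ k d)]
  refine Finset.sum_congr rfl fun i _ => ?_
  conv_rhs => rw [← sum_counit_smul (ℛ k d)]
  simp [TensorProduct.tmul_sum, Finset.mul_sum]

lemma slot₂_mul_apply (φ : WithConv (D →ₗ[k] R)) (ψ : WithConv (C ⊗[k] D →ₗ[k] R)) {ι : Type*}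
    (c : C) {d : D} (𝓓 : Coalgebra.Repr k d ι) :
    (slot₂ C φ * ψ) (c ⊗ₜ d) = ∑ i ∈ 𝓓.index, φ (𝓓.left i) * ψ (c ⊗ₜ 𝓓.right i) := by
  rw [convMul_tmul_apply _ _ (ℛ k c) 𝓓, Finset.sum_comm]
  refine Finset.sum_congr rfl fun i _ => ?_
  conv_rhs => rw [← sum_counit_smul (ℛ k c)]
  simp [TensorProduct.sum_tmul, Finset.mul_sum, ← TensorProduct.smul_tmul']

lemma mul_slot₁_apply (φ : WithConv (C →ₗ[k] R)) (ψ : WithConv (C ⊗[k] D →ₗ[k] R)) {ι : Type*}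
    {c : C} (𝓒 : Coalgebra.Repr k c ι) (d : D) :
    (ψ * slot₁ D φ) (c ⊗ₜ d) = ∑ i ∈ 𝓒.index, ψ (𝓒.left i ⊗ₜ d) * φ (𝓒.right i) := by
  rw [convMul_tmul_apply _ _ 𝓒 (ℛ k d)]
  refine Finset.sum_congr rfl fun i _ => ?_
  conv_rhs => rw [← sum_counit_right_smul (ℛ k d)]
  simp [TensorProduct.tmul_sum, Finset.sum_mul]

lemma mul_slot₂_apply (φ : WithConv (D →ₗ[k] R)) (ψ : WithConv (C ⊗[k] D →ₗ[k] R)) {ι : Type*}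
    (c : C) {d : D} (𝓓 : Coalgebra.Repr k d ι) :
    (ψ * slot₂ C φ) (c ⊗ₜ d) = ∑ i ∈ 𝓓.index, ψ (c ⊗ₜ 𝓓.left i) * φ (𝓓.right i) := by
  rw [convMul_tmul_apply _ _ (ℛ k c) 𝓓, Finset.sum_comm]
  refine Finset.sum_congr rfl fun i _ => ?_
  conv_rhs => rw [← sum_counit_right_smul (ℛ k c)]
  simp [TensorProduct.sum_tmul, Finset.sum_mul, ← TensorProduct.smul_tmul']

lemma slot₁_mul_slot₂_apply (φ : WithConv (C →ₗ[k] R)) (ψ : WithConv (D →ₗ[k] R)) (c : C) (d : D) :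
    (slot₁ D φ * slot₂ C ψ) (c ⊗ₜ d) = φ c * ψ d := by
  rw [slot₁_mul_apply _ _ (ℛ k c)]
  conv_rhs => rw [← sum_counit_right_smul (ℛ k c)]
  simp [Finset.sum_mul]

lemma slot₂_mul_slot₁_apply (φ : WithConv (C →ₗ[k] R)) (ψ : WithConv (D →ₗ[k] R)) (c : C) (d : D) :
    (slot₂ C ψ * slot₁ D φ) (c ⊗ₜ d) = ψ d * φ c := by
  rw [slot₂_mul_apply _ _ _ (ℛ k d)]
  conv_rhs => rw [← sum_counit_right_smul (ℛ k d)]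
  simp [Finset.sum_mul]

/-- Factors in different slots commute if their values do. -/
lemma slot₁_slot₂_comm {φ : WithConv (C →ₗ[k] R)} {ψ : WithConv (D →ₗ[k] R)}
    (h : ∀ c d, φ c * ψ d = ψ d * φ c) : slot₁ D φ * slot₂ C ψ = slot₂ C ψ * slot₁ D φ :=
  conv_ext_tmul fun c d => by rw [slot₁_mul_slot₂_apply, slot₂_mul_slot₁_apply, h]

/-- Precomposition with the flip. -/
def convFlip (k C D R : Type*) [Field k] [AddCommGroup C] [Module k C] [Coalgebra k C]
    [AddCommGroup D] [Module k D] [Coalgebra k D] [Ring R] [Algebra k R] :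
    WithConv (C ⊗[k] D →ₗ[k] R) →+* WithConv (D ⊗[k] C →ₗ[k] R) where
  toFun φ := toConv (φ.ofConv ∘ₗ (TensorProduct.comm k D C).toLinearMap)
  map_one' := conv_ext_tmul fun d c => by simp [mul_comm]
  map_mul' φ ψ := conv_ext_tmul fun d c => by
    rw [convMul_tmul_apply _ _ (ℛ k d) (ℛ k c)]
    simp only [LinearMap.comp_apply, LinearEquiv.coe_coe, TensorProduct.comm_tmul]
    rw [convMul_tmul_apply _ _ (ℛ k c) (ℛ k d), Finset.sum_comm]
  map_zero' := rfl
  map_add' _ _ := rfl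

@[simp] lemma convFlip_apply_tmul (φ : WithConv (C ⊗[k] D →ₗ[k] R)) (c : C) (d : D) :
    convFlip k C D R φ (d ⊗ₜ c) = φ (c ⊗ₜ d) := rfl

@[simp] lemma convFlip_slot₁ (φ : WithConv (C →ₗ[k] R)) :
    convFlip k C D R (slot₁ D φ) = slot₂ D φ := conv_ext_tmul fun d c => by simp

@[simp] lemma convFlip_slot₂ (φ : WithConv (D →ₗ[k] R)) :
    convFlip k C D R (slot₂ C φ) = slot₁ C φ := conv_ext_tmul fun d c => by simp

@[simp] lemma convFlip_convFlip (φ : WithConv (C ⊗[k] D →ₗ[k] R)) :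
    convFlip k D C R (convFlip k C D R φ) = φ := conv_ext_tmul fun d c => by simp

end Convolution

/-! ### The form `r` in convolution algebras -/

section Quasitriangular

open Coalgebra TensorProduct WithConv CoquasitriangularStructure

/-- Scalar valued functionals among the `R`-valued ones. -/
def convScalar {k C : Type*} (R : Type*) [Field k] [AddCommGroup C] [Module k C] [Coalgebra k C]
    [Ring R] [Algebra k R] : WithConv (C →ₗ[k] k) →+* WithConv (C →ₗ[k] R) :=
  convPush C (Algebra.ofId k R)

lemma convScalar_apply {k C R : Type*} [Field k] [AddCommGroup C] [Module k C] [Coalgebra k C]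
    [Ring R] [Algebra k R] (φ : WithConv (C →ₗ[k] k)) (c : C) :
    convScalar R φ c = algebraMap k R (φ c) := rfl

variable {k H : Type u} [Field k] [Ring H] [HopfAlgebra k H]
variable {R S : Type*} [Ring R] [Algebra k R] [Ring S] [Algebra k S]

/-- Precomposition with the product of `H`. -/
def mulPull : WithConv (H →ₗ[k] R) →+* WithConv (H ⊗[k] H →ₗ[k] R) :=
  convPull R (Bialgebra.mulCoalgHom k H)

@[simp] lemma mulPull_apply_tmul (φ : WithConv (H →ₗ[k] R)) (g h : H) :
    mulPull φ (g ⊗ₜ[k] h) = φ (g * h) := rfl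

lemma mulPull_of_map_mul {φ : WithConv (H →ₗ[k] R)} (hφ : ∀ g h, φ (g * h) = φ g * φ h) :
    mulPull φ = slot₁ H φ * slot₂ H φ :=
  conv_ext_tmul fun g h => by rw [slot₁_mul_slot₂_apply, mulPull_apply_tmul, hφ]

/-- For an antimultiplicative `φ` the two slots of `φ(gh)` appear in reverse order. -/
lemma mulPull_of_map_mul_rev {φ : WithConv (H →ₗ[k] R)} (hφ : ∀ g h, φ (g * h) = φ h * φ g) :
    mulPull φ = slot₂ H φ * slot₁ H φ :=
  conv_ext_tmul fun g h => by rw [slot₂_mul_slot₁_apply, mulPull_apply_tmul, hφ]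

/-- The convolution inverse of an algebra map is its composite with the antipode. -/
lemma conv_mul_comp_antipode (f : H →ₐ[k] R) :
    toConv f.toLinearMap * toConv (f.toLinearMap ∘ₗ HopfAlgebra.antipode k (A := H)) = 1 := by
  have := congrArg (convPush H f) (LinearMap.id_mul_antipode (R := k) (C := H))
  rw [map_mul, map_one] at this
  exact this

lemma conv_comp_antipode_mul (f : H →ₐ[k] R) :
    toConv (f.toLinearMap ∘ₗ HopfAlgebra.antipode k (A := H)) * toConv f.toLinearMap = 1 := by
  have := congrArg (convPush H f) (LinearMap.antipode_mul_id (R := k) (C := H))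
  rw [map_mul, map_one] at this
  exact this

variable [CoquasitriangularStructure k H]

variable (k H R) in
/-- The form `r` with values in the scalars of `R`. -/
def rConv : WithConv (H ⊗[k] H →ₗ[k] R) := convScalar R (toConv r)

variable (k H R) in
/-- The convolution inverse of the form `r`, with values in the scalars of `R`. -/
def rConvInv : WithConv (H ⊗[k] H →ₗ[k] R) := convScalar R (toConv rInv)

variable (k H R) in
/-- The form `g ⊗ h ↦ r(h ⊗ g)` with values in the scalars of `R`. -/
def rFlip : WithConv (H ⊗[k] H →ₗ[k] R) := convFlip k H H R (rConv k H R)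

variable (k H R) in
/-- The convolution inverse of `g ⊗ h ↦ r(h ⊗ g)`. -/
def rFlipInv : WithConv (H ⊗[k] H →ₗ[k] R) := convFlip k H H R (rConvInv k H R)

lemma rConv_apply (g h : H) : rConv k H R (g ⊗ₜ h) = algebraMap k R (r (g ⊗ₜ h)) := rfl

lemma rFlip_apply (g h : H) : rFlip k H R (g ⊗ₜ h) = algebraMap k R (r (h ⊗ₜ g)) := rfl

lemma rConv_mul_rConvInv : rConv k H R * rConvInv k H R = 1 := by
  rw [rConv, rConvInv, ← map_mul]
  exact (congrArg (convScalar R) (congrArg toConv r_mul_rInv)).trans (map_one _)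

lemma rConvInv_mul_rConv : rConvInv k H R * rConv k H R = 1 := by
  rw [rConv, rConvInv, ← map_mul]
  exact (congrArg (convScalar R) (congrArg toConv rInv_mul_r)).trans (map_one _)

lemma rFlip_mul_rFlipInv : rFlip k H R * rFlipInv k H R = 1 := by
  rw [rFlip, rFlipInv, ← map_mul, rConv_mul_rConvInv, map_one]

lemma rFlipInv_mul_rFlip : rFlipInv k H R * rFlip k H R = 1 := by
  rw [rFlip, rFlipInv, ← map_mul, rConvInv_mul_rConv, map_one]

@[simp] lemma convFlip_rFlip : convFlip k H H R (rFlip k H R) = rConv k H R := convFlip_convFlip _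

lemma comul_tmul_repr {ι κ : Type*} {g h : H} (𝓖 : Coalgebra.Repr k g ι)
    (𝓗 : Coalgebra.Repr k h κ) : comul (R := k) (g ⊗ₜ[k] h) =
      ∑ i ∈ 𝓖.index, ∑ j ∈ 𝓗.index,
        (𝓖.left i ⊗ₜ[k] 𝓗.left j) ⊗ₜ[k] (𝓖.right i ⊗ₜ[k] 𝓗.right j) := by
  rw [TensorProduct.comul_tmul, ← 𝓖.eq, ← 𝓗.eq]
  simp only [TensorProduct.sum_tmul, TensorProduct.tmul_sum, map_sum, LinearEquiv.coe_coe,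
    TensorProduct.AlgebraTensorModule.tensorTensorTensorComm_tmul]
  exact Finset.sum_comm

lemma r_comm_repr {ι κ : Type*} {g h : H} (𝓖 : Coalgebra.Repr k g ι)
    (𝓗 : Coalgebra.Repr k h κ) :
    ∑ i ∈ 𝓖.index, ∑ j ∈ 𝓗.index,
        r (𝓖.left i ⊗ₜ[k] 𝓗.left j) • (𝓖.right i * 𝓗.right j) =
      ∑ i ∈ 𝓖.index, ∑ j ∈ 𝓗.index,
        r (𝓖.right i ⊗ₜ[k] 𝓗.right j) • (𝓗.left j * 𝓖.left i) := by
  have := LinearMap.congr_fun (comm_r (k := k) (H := H)) (g ⊗ₜ h)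
  simpa [comul_tmul_repr 𝓖 𝓗] using this

/-- The commutation rule of a coquasitriangular structure: `r` intertwines the product and the
opposite product, also after any linear map. -/
lemma rConv_mul_mulPull (φ : WithConv (H →ₗ[k] R)) :
    rConv k H R * mulPull φ = convFlip k H H R (mulPull φ) * rConv k H R := by
  refine conv_ext_tmul fun g h => ?_
  have := congrArg φ.ofConv (r_comm_repr (ℛ k g) (ℛ k h))
  rw [convMul_tmul_apply _ _ (ℛ k g) (ℛ k h), convMul_tmul_apply _ _ (ℛ k g) (ℛ k h)]
  simpa [rConv_apply, Algebra.algebraMap_eq_smul_one] using this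

lemma rFlip_mul_flip_mulPull (φ : WithConv (H →ₗ[k] R)) :
    rFlip k H R * convFlip k H H R (mulPull φ) = mulPull φ * rFlip k H R := by
  rw [rFlip, ← map_mul, rConv_mul_mulPull, map_mul, convFlip_convFlip]

variable (k H) in
/-- `g ↦ r(g ⊗ -)`, with values in the convolution algebra of functionals. -/
def rLeft : H →ₗ[k] WithConv (H →ₗ[k] k) :=
  (WithConv.linearEquiv k _).symm.toLinearMap ∘ₗ TensorProduct.curry r

variable (k H) in
/-- `h ↦ r(- ⊗ h)`, with values in the convolution algebra of functionals. -/
def rRight : H →ₗ[k] WithConv (H →ₗ[k] k) :=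
  (WithConv.linearEquiv k _).symm.toLinearMap ∘ₗ (TensorProduct.curry r).flip

@[simp] lemma rLeft_apply_apply (g h : H) : rLeft k H g h = r (g ⊗ₜ[k] h) := rfl

@[simp] lemma rRight_apply_apply (g h : H) : rRight k H h g = r (g ⊗ₜ[k] h) := rfl

lemma rLeft_mul (g h : H) : rLeft k H (g * h) = rLeft k H g * rLeft k H h := by
  ext l
  exact r_mul_left g h l

lemma rRight_mul (g h : H) : rRight k H (g * h) = rRight k H h * rRight k H g := by
  ext l
  exact r_mul_right l g h

lemma r_one_left (h : H) : r ((1 : H) ⊗ₜ[k] h) = counit (R := k) h := by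
  have e : rLeft k H 1 * toConv ((TensorProduct.curry rInv) (1 : H)) = 1 := by
    ext l
    have := congrArg (fun φ => φ.ofConv (1 ⊗ₜ l)) (rConv_mul_rConvInv (k := k) (H := H) (R := k))
    refine Eq.trans ?_ (this.trans ?_)
    · rw [LinearMap.convMul_apply, LinearMap.convMul_apply, TensorProduct.comul_tmul, ← (ℛ k l).eq]
      simp [Algebra.TensorProduct.one_def, TensorProduct.tmul_sum]
      rfl
    · simp
  have e2 := rLeft_mul (k := k) (1 : H) 1
  rw [one_mul] at e2
  have e3 : rLeft k H 1 = 1 := by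
    have := congrArg (· * toConv ((TensorProduct.curry rInv) (1 : H))) e2
    simp only [mul_assoc, e, mul_one] at this
    exact this.symm
  exact congrArg (fun φ => φ.ofConv h) e3

lemma r_one_right (h : H) : r (h ⊗ₜ[k] (1 : H)) = counit (R := k) h := by
  have e : rRight k H 1 * toConv ((TensorProduct.curry rInv).flip (1 : H)) = 1 := by
    ext l
    have := congrArg (fun φ => φ.ofConv (l ⊗ₜ 1)) (rConv_mul_rConvInv (k := k) (H := H) (R := k))
    refine Eq.trans ?_ (this.trans ?_)
    · rw [LinearMap.convMul_apply, LinearMap.convMul_apply, TensorProduct.comul_tmul, ← (ℛ k l).eq]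
      simp [Algebra.TensorProduct.one_def, TensorProduct.sum_tmul]
      rfl
    · simp
  have e2 := rRight_mul (k := k) (1 : H) 1
  rw [one_mul] at e2
  have e3 : rRight k H 1 = 1 := by
    have := congrArg (· * toConv ((TensorProduct.curry rInv).flip (1 : H))) e2
    simp only [mul_assoc, e, mul_one] at this
    exact this.symm
  exact congrArg (fun φ => φ.ofConv h) e3

variable (k H) in
/-- `g ↦ r(g ⊗ -)` as an algebra map. -/
def rLeftHom : H →ₐ[k] WithConv (H →ₗ[k] k) :=
  AlgHom.ofLinearMap (rLeft k H) (by ext h; exact r_one_left h) rLeft_mul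

end Quasitriangular

/-! ### The form `r` and the antipode, and the skew antipode -/

section SkewAntipode

open Coalgebra TensorProduct WithConv CoquasitriangularStructure

/-- Currying of functionals on `C ⊗ D`. -/
def convCurry (k C D R : Type*) [Field k] [AddCommGroup C] [Module k C] [Coalgebra k C]
    [AddCommGroup D] [Module k D] [Coalgebra k D] [Ring R] [Algebra k R] :
    WithConv (C ⊗[k] D →ₗ[k] R) →+* WithConv (C →ₗ[k] WithConv (D →ₗ[k] R)) where
  toFun φ := toConv ((WithConv.linearEquiv k _).symm.toLinearMap ∘ₗ TensorProduct.curry φ.ofConv)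
  map_one' := by
    ext c d
    simp [Algebra.algebraMap_eq_smul_one, smul_smul, mul_comm]
  map_mul' φ ψ := by
    ext c d
    rw [(ℛ k c).convMul_apply]
    simp only [LinearMap.comp_apply, LinearEquiv.coe_coe, WithConv.symm_linearEquiv_apply,
      TensorProduct.curry_apply, WithConv.ofConv_sum, LinearMap.sum_apply]
    rw [convMul_tmul_apply _ _ (ℛ k c) (ℛ k d)]
    refine Finset.sum_congr rfl fun i _ => ?_
    rw [(ℛ k d).convMul_apply]
    rfl
  map_zero' := by ext; rfl
  map_add' _ _ := by ext; rfl

@[simp] lemma convCurry_apply_apply {k C D R : Type*} [Field k] [AddCommGroup C] [Module k C]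
    [Coalgebra k C] [AddCommGroup D] [Module k D] [Coalgebra k D] [Ring R] [Algebra k R]
    (φ : WithConv (C ⊗[k] D →ₗ[k] R)) (c : C) (d : D) :
    convCurry k C D R φ c d = φ (c ⊗ₜ d) := rfl

/-- Postcomposition with a map that is linear over a subalgebra on the left. -/
lemma comp_convPush_mul {k C R S : Type*} [Field k] [AddCommGroup C] [Module k C] [Coalgebra k C]
    [Ring R] [Algebra k R] [Ring S] [Algebra k S] (i : R →ₐ[k] S) (L : S →ₗ[k] R)
    (hL : ∀ x y, L (i x * y) = x * L y) (φ : WithConv (C →ₗ[k] R)) (ψ : WithConv (C →ₗ[k] S)) :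
    toConv (L ∘ₗ (convPush C i φ * ψ).ofConv) = φ * toConv (L ∘ₗ ψ.ofConv) := by
  ext c
  simp only [LinearMap.comp_apply]
  rw [(ℛ k c).convMul_apply, (ℛ k c).convMul_apply]
  simp [hL]

/-- Postcomposition with a map that is linear over a subalgebra on the right. -/
lemma comp_mul_convPush {k C R S : Type*} [Field k] [AddCommGroup C] [Module k C] [Coalgebra k C]
    [Ring R] [Algebra k R] [Ring S] [Algebra k S] (i : R →ₐ[k] S) (L : S →ₗ[k] R)
    (hL : ∀ x y, L (y * i x) = L y * x) (φ : WithConv (C →ₗ[k] R)) (ψ : WithConv (C →ₗ[k] S)) :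
    toConv (L ∘ₗ (ψ * convPush C i φ).ofConv) = toConv (L ∘ₗ ψ.ofConv) * φ := by
  ext c
  simp only [LinearMap.comp_apply]
  rw [(ℛ k c).convMul_apply, (ℛ k c).convMul_apply]
  simp [hL]

/-- Two linear images of convolution products agree if they agree factor by factor. -/
lemma comp_convMul_congr {k C R S M : Type*} [Field k] [AddCommGroup C] [Module k C]
    [Coalgebra k C] [Ring R] [Algebra k R] [Ring S] [Algebra k S] [AddCommGroup M] [Module k M]
    {L : R →ₗ[k] M} {L' : S →ₗ[k] M} {φ ψ : WithConv (C →ₗ[k] R)} {φ' ψ' : WithConv (C →ₗ[k] S)}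
    (h : ∀ c d, L (φ c * ψ d) = L' (φ' c * ψ' d)) :
    L ∘ₗ (φ * ψ).ofConv = L' ∘ₗ (φ' * ψ').ofConv := by
  ext c
  simp only [LinearMap.comp_apply]
  rw [(ℛ k c).convMul_apply, (ℛ k c).convMul_apply]
  simp [h]

variable {k H : Type u} [Field k] [Ring H] [HopfAlgebra k H]

local notation "𝑺" => HopfAlgebra.antipode k (A := H)

/-- The antipode reverses the coproduct. -/
lemma comul_antipode_repr {ι : Type*} {h : H} (𝓗 : Coalgebra.Repr k h ι) :
    comul (R := k) (𝑺 h) = ∑ i ∈ 𝓗.index, 𝑺 (𝓗.right i) ⊗ₜ[k] 𝑺 (𝓗.left i) := by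
  let i₁ : H →ₐ[k] H ⊗[k] H := Algebra.TensorProduct.includeLeft
  let i₂ : H →ₐ[k] H ⊗[k] H := Algebra.TensorProduct.includeRight
  have e₁ : toConv (comul (R := k) (A := H)) = toConv i₁.toLinearMap * toConv i₂.toLinearMap := by
    ext h
    rw [(ℛ k h).convMul_apply]
    simpa [i₁, i₂] using (ℛ k h).eq.symm
  have e₂ : toConv (comul (R := k) (A := H)) * toConv (comul (R := k) (A := H) ∘ₗ 𝑺) = 1 :=
    conv_mul_comp_antipode (Bialgebra.comulAlgHom k H)
  have e₃ : toConv (i₂.toLinearMap ∘ₗ 𝑺) * toConv (i₁.toLinearMap ∘ₗ 𝑺) *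
      toConv (comul (R := k) (A := H)) = 1 := by
    rw [e₁, mul_assoc, ← mul_assoc (toConv (i₁.toLinearMap ∘ₗ 𝑺)), conv_comp_antipode_mul, one_mul,
      conv_comp_antipode_mul]
  have := congrArg (fun φ => φ.ofConv h) (left_inv_eq_right_inv e₃ e₂)
  refine Eq.trans this.symm ?_
  rw [𝓗.convMul_apply]
  simp [i₁, i₂]

/-- A representation of the coproduct of `S(h)` from one of the coproduct of `h`. -/
def reprAntipode {ι : Type*} {h : H} (𝓗 : Coalgebra.Repr k h ι) : Coalgebra.Repr k (𝑺 h) ι where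
  index := 𝓗.index
  left i := 𝑺 (𝓗.right i)
  right i := 𝑺 (𝓗.left i)
  eq := (comul_antipode_repr 𝓗).symm

lemma conv_mul_comp_antipode_of_map_mul {R : Type*} [Ring R] [Algebra k R]
    {φ : WithConv (H →ₗ[k] R)} (h1 : φ 1 = 1) (hφ : ∀ g h, φ (g * h) = φ g * φ h) :
    φ * toConv (φ.ofConv ∘ₗ 𝑺) = 1 :=
  conv_mul_comp_antipode (AlgHom.ofLinearMap φ.ofConv h1 hφ)

/-- The inverse of an antimultiplicative map is multiplicative, hence has the original map as its
composite with the antipode. -/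
lemma eq_inv_comp_antipode {R : Type*} [Ring R] [Algebra k R] {φ ψ : WithConv (H →ₗ[k] R)}
    (e₁ : φ * ψ = 1) (e₂ : ψ * φ = 1) (h1 : φ 1 = 1) (hφ : ∀ g h, φ (g * h) = φ h * φ g) :
    φ = toConv (ψ.ofConv ∘ₗ 𝑺) := by
  have hψ : mulPull ψ = slot₁ H ψ * slot₂ H ψ := by
    refine left_inv_eq_right_inv (a := mulPull φ) ?_ ?_
    · rw [← map_mul, e₂, map_one]
    · rw [mulPull_of_map_mul_rev hφ, mul_assoc, ← mul_assoc (slot₁ H φ), ← map_mul (slot₁ H), e₁,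
        map_one, one_mul, ← map_mul, e₁, map_one]
  have h1' : ψ 1 = 1 := by
    have := congrArg (fun φ => φ.ofConv 1) e₁
    simp only [LinearMap.convMul_apply, Bialgebra.comul_one, Algebra.TensorProduct.one_def,
      TensorProduct.map_tmul, LinearMap.mul'_apply] at this
    rw [h1, one_mul] at this
    simpa using this
  refine left_inv_eq_right_inv e₁ (conv_mul_comp_antipode_of_map_mul h1' fun g h => ?_)
  rw [← slot₁_mul_slot₂_apply, ← hψ, mulPull_apply_tmul]

variable [CoquasitriangularStructure k H]

/-- `r(S(g) | h) = r⁻¹(g | h)`: both are convolution inverses of the algebra map `g ↦ r(g | -)`.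
-/
lemma r_antipode_left (g h : H) : r (𝑺 g ⊗ₜ[k] h) = rInv (k := k) (g ⊗ₜ[k] h) := by
  have e₁ := conv_comp_antipode_mul (rLeftHom k H)
  have e₂ : toConv (rLeftHom k H).toLinearMap * convCurry k H H k (rConvInv k H k) = 1 := by
    refine Eq.trans ?_ (congrArg (convCurry k H H k) (rConv_mul_rConvInv (R := k))) |>.trans
      (map_one _)
    rw [map_mul]
    rfl
  exact congrArg (fun φ => (φ.ofConv g).ofConv h) (left_inv_eq_right_inv e₁ e₂)

/-- `r⁻¹(g | S(h)) = r(g | h)`: the map `h ↦ r(- | h)` is antimultiplicative, so its convolution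
inverse `h ↦ r⁻¹(- | h)` is multiplicative and is inverted by the antipode. -/
lemma rInv_antipode_right (g h : H) : rInv (g ⊗ₜ[k] 𝑺 h) = r (k := k) (g ⊗ₜ[k] h) := by
  have e₁ : toConv (rRight k H) * convCurry k H H k (rFlipInv k H k) = 1 := by
    refine Eq.trans ?_ (congrArg (convCurry k H H k) (rFlip_mul_rFlipInv (R := k))) |>.trans
      (map_one _)
    rw [map_mul]
    rfl
  have e₂ : convCurry k H H k (rFlipInv k H k) * toConv (rRight k H) = 1 := by
    refine Eq.trans ?_ (congrArg (convCurry k H H k) (rFlipInv_mul_rFlip (R := k))) |>.trans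
      (map_one _)
    rw [map_mul]
    rfl
  have key := eq_inv_comp_antipode e₁ e₂ (by ext l; exact r_one_right l) rRight_mul
  exact (congrArg (fun φ => (φ.ofConv h).ofConv g) key).symm

lemma r_antipode_antipode (g h : H) : r (𝑺 g ⊗ₜ[k] 𝑺 h) = r (k := k) (g ⊗ₜ[k] h) := by
  rw [r_antipode_left, rInv_antipode_right]

variable (k H) in
/-- The functional `u(x) = r(x₍₂₎ ⊗ S(x₍₁₎))`, which implements the square of the antipode. -/
def drinfeldForm : WithConv (H →ₗ[k] k) :=
  toConv (r ∘ₗ (TensorProduct.comm k H H).toLinearMap ∘ₗ 𝑺.rTensor H ∘ₗ comul)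

variable (k H) in
/-- The functional `x ↦ r(S²(x₍₂₎) ⊗ x₍₁₎)`, the convolution inverse of `drinfeldForm`. -/
def drinfeldFormInv : WithConv (H →ₗ[k] k) :=
  toConv (r ∘ₗ (TensorProduct.comm k H H).toLinearMap ∘ₗ (𝑺 ∘ₗ 𝑺).lTensor H ∘ₗ comul)

lemma drinfeldForm_repr {ι : Type*} {h : H} (𝓗 : Coalgebra.Repr k h ι) :
    drinfeldForm k H h = ∑ i ∈ 𝓗.index, r (𝓗.right i ⊗ₜ[k] 𝑺 (𝓗.left i)) := by
  simp [drinfeldForm, ← 𝓗.eq]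

lemma drinfeldFormInv_repr {ι : Type*} {h : H} (𝓗 : Coalgebra.Repr k h ι) :
    drinfeldFormInv k H h = ∑ i ∈ 𝓗.index, r (𝑺 (𝑺 (𝓗.right i)) ⊗ₜ[k] 𝓗.left i) := by
  simp [drinfeldFormInv, ← 𝓗.eq]

section Legs

variable (R : Type u) [Ring R] [Algebra k R]

variable (k H) in
/-- `(a ⊗ c) ⊗ x ↦ r(c ⊗ a) x`. -/
def pairLegs : (H ⊗[k] H) ⊗[k] R →ₗ[k] R :=
  (TensorProduct.lid k R).toLinearMap ∘ₗ
    (r ∘ₗ (TensorProduct.comm k H H).toLinearMap).rTensor R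

@[simp] lemma pairLegs_tmul (a c : H) (x : R) :
    pairLegs k H R ((a ⊗ₜ c) ⊗ₜ x) = r (c ⊗ₜ[k] a) • x := rfl

variable (k H) in
/-- The first leg of `(H ⊗ H) ⊗ R`. -/
def legA : H →ₐ[k] (H ⊗[k] H) ⊗[k] R :=
  Algebra.TensorProduct.includeLeft.comp Algebra.TensorProduct.includeLeft

variable (k H) in
/-- The second leg of `(H ⊗ H) ⊗ R`. -/
def legC : H →ₐ[k] (H ⊗[k] H) ⊗[k] R :=
  Algebra.TensorProduct.includeLeft.comp Algebra.TensorProduct.includeRight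

variable (k H) in
/-- The third leg of `(H ⊗ H) ⊗ R`. -/
def legB : R →ₐ[k] (H ⊗[k] H) ⊗[k] R := Algebra.TensorProduct.includeRight

@[simp] lemma legA_apply (a : H) : legA k H R a = (a ⊗ₜ 1) ⊗ₜ 1 := rfl
@[simp] lemma legC_apply (a : H) : legC k H R a = (1 ⊗ₜ a) ⊗ₜ 1 := rfl
@[simp] lemma legB_apply (a : R) : legB k H R a = (1 ⊗ₜ 1) ⊗ₜ a := rfl

lemma pairLegs_legB_mul (x : R) (y : (H ⊗[k] H) ⊗[k] R) :
    pairLegs k H R (legB k H R x * y) = x * pairLegs k H R y := by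
  induction y using TensorProduct.induction_on with
  | zero => simp
  | add y z hy hz => rw [mul_add, map_add, map_add, hy, hz, mul_add]
  | tmul p y =>
    induction p using TensorProduct.induction_on with
    | zero => simp
    | add y z hy hz => rw [TensorProduct.add_tmul, mul_add, map_add, map_add, hy, hz, mul_add]
    | tmul a c => simp

lemma pairLegs_mul_legB (x : R) (y : (H ⊗[k] H) ⊗[k] R) :
    pairLegs k H R (y * legB k H R x) = pairLegs k H R y * x := by
  induction y using TensorProduct.induction_on with
  | zero => simp
  | add y z hy hz => rw [add_mul, map_add, map_add, hy, hz, add_mul]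
  | tmul p y =>
    induction p using TensorProduct.induction_on with
    | zero => simp
    | add y z hy hz => rw [TensorProduct.add_tmul, add_mul, map_add, map_add, hy, hz, add_mul]
    | tmul a c => simp

/-- The functional `u` as a linear image of the convolution product of `S` and `id` in two legs;
the third leg keeps track of the values. -/
lemma convScalar_drinfeldForm : convScalar R (drinfeldForm k H) =
    toConv (pairLegs k H R ∘ₗ (toConv ((legA k H R).toLinearMap ∘ₗ 𝑺) *
      toConv (legC k H R).toLinearMap).ofConv) := by
  ext x
  simp only [LinearMap.comp_apply]
  rw [convScalar_apply, drinfeldForm_repr (ℛ k x), (ℛ k x).convMul_apply]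
  simp [Algebra.algebraMap_eq_smul_one]

end Legs

variable (k H) in
/-- The identity of `H` with values in the opposite algebra. -/
def convOp : WithConv (H →ₗ[k] Hᵐᵒᵖ) := toConv (MulOpposite.opLinearEquiv k).toLinearMap

variable (k H) in
/-- The antipode of `H`, an algebra map to the opposite algebra. -/
def convAntipodeOp : WithConv (H →ₗ[k] Hᵐᵒᵖ) :=
  toConv (HopfAlgebra.antipodeAlgHomOp k H).toLinearMap

/-- `u(x₍₂₎) x₍₃₎ S(x₍₁₎) = u(x) 1`. -/
lemma antipode_mul_drinfeldForm_mul :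
    convAntipodeOp k H * convScalar Hᵐᵒᵖ (drinfeldForm k H) * convOp k H =
      convScalar Hᵐᵒᵖ (drinfeldForm k H) := by
  rw [convScalar_drinfeldForm, ← comp_convPush_mul _ _ (pairLegs_legB_mul Hᵐᵒᵖ),
    ← comp_mul_convPush _ _ (pairLegs_mul_legB Hᵐᵒᵖ), ← convScalar_drinfeldForm]
  -- Inserting `S(x₍₂₎) x₍₃₎` in the last leg splits `u(x)` into a factor in `S(x₍₁₎)` and one in
  -- `x₍₂₎`, to which the commutation rule of `r` applies.
  have e : toConv ((legA k H H).toLinearMap ∘ₗ 𝑺) * toConv (legC k H H).toLinearMap =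
      toConv ((legA k H H).toLinearMap ∘ₗ 𝑺) * toConv ((legB k H H).toLinearMap ∘ₗ 𝑺) *
        (toConv (legB k H H).toLinearMap * toConv (legC k H H).toLinearMap) := by
    rw [mul_assoc, ← mul_assoc (toConv ((legB k H H).toLinearMap ∘ₗ 𝑺)), conv_comp_antipode_mul,
      one_mul]
  have e' : convScalar Hᵐᵒᵖ (drinfeldForm k H) =
      toConv ((MulOpposite.opLinearEquiv k).toLinearMap ∘ₗ pairLegs k H H ∘ₗ
        (toConv ((legA k H H).toLinearMap ∘ₗ 𝑺) * toConv (legC k H H).toLinearMap).ofConv) := by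
    have := convScalar_drinfeldForm (k := k) (H := H) H
    exact congrArg (fun φ => toConv ((MulOpposite.opLinearEquiv k).toLinearMap ∘ₗ φ.ofConv)) this
  rw [e', e, ← mul_assoc, mul_assoc]
  refine congrArg toConv (comp_convMul_congr
    (L' := (MulOpposite.opLinearEquiv k).toLinearMap ∘ₗ pairLegs k H H) fun x g => ?_)
  have := congrArg MulOpposite.op (r_comm_repr (ℛ k g) (reprAntipode (ℛ k x)))
  rw [(ℛ k x).convMul_apply, (ℛ k g).convMul_apply, (ℛ k x).convMul_apply, (ℛ k g).convMul_apply]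
  simp only [Finset.sum_mul_sum, map_sum]
  rw [Finset.sum_comm]
  conv_rhs => rw [Finset.sum_comm]
  simpa [convOp, convAntipodeOp, reprAntipode] using this

lemma antipodeOp_comp_antipode_mul :
    toConv ((convAntipodeOp k H).ofConv ∘ₗ 𝑺) * convAntipodeOp k H = 1 :=
  conv_comp_antipode_mul (HopfAlgebra.antipodeAlgHomOp k H)

/-- `u(x₍₁₎) x₍₂₎ = S²(x₍₁₎) u(x₍₂₎)`. -/
lemma drinfeldForm_mul_op : convScalar Hᵐᵒᵖ (drinfeldForm k H) * convOp k H =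
    toConv ((convAntipodeOp k H).ofConv ∘ₗ 𝑺) * convScalar Hᵐᵒᵖ (drinfeldForm k H) := by
  conv_rhs => rw [← antipode_mul_drinfeldForm_mul]
  rw [mul_assoc, ← mul_assoc, antipodeOp_comp_antipode_mul, one_mul]

lemma convPush_convScalar {C R S : Type*} [AddCommGroup C] [Module k C] [Coalgebra k C]
    [Ring R] [Algebra k R] [Ring S] [Algebra k S] (f : R →ₐ[k] S) (φ : WithConv (C →ₗ[k] k)) :
    convPush C f (convScalar R φ) = convScalar S φ := by
  ext c
  simp [convScalar_apply]

variable (k H) in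
/-- `p ⊗ q ↦ r(q ⊗ p)`. -/
def pairOp : H ⊗[k] Hᵐᵒᵖ →ₗ[k] k :=
  r ∘ₗ (TensorProduct.comm k H H).toLinearMap ∘ₗ
    (MulOpposite.opLinearEquiv k).symm.toLinearMap.lTensor H

@[simp] lemma pairOp_tmul (p : H) (q : Hᵐᵒᵖ) : pairOp k H (p ⊗ₜ q) = r (q.unop ⊗ₜ[k] p) := rfl

local notation "𝑫" => H ⊗[k] Hᵐᵒᵖ
local notation "𝑷" => (Algebra.TensorProduct.includeLeft : H →ₐ[k] H ⊗[k] Hᵐᵒᵖ)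
local notation "𝑸" => (Algebra.TensorProduct.includeRight : Hᵐᵒᵖ →ₐ[k] H ⊗[k] Hᵐᵒᵖ)

lemma comp_mul_convScalar {C R : Type*} [AddCommGroup C] [Module k C] [Coalgebra k C]
    [Ring R] [Algebra k R] (L : R →ₗ[k] k) (φ : WithConv (C →ₗ[k] R)) (ψ : WithConv (C →ₗ[k] k)) :
    toConv (L ∘ₗ (φ * convScalar R ψ).ofConv) = toConv (L ∘ₗ φ.ofConv) * ψ :=
  comp_mul_convPush (Algebra.ofId k R) L (fun x y => by
    rw [Algebra.ofId_apply, ← Algebra.commutes, ← Algebra.smul_def, map_smul, smul_eq_mul,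
      mul_comm]) ψ φ

lemma comp_convScalar_mul {C R : Type*} [AddCommGroup C] [Module k C] [Coalgebra k C]
    [Ring R] [Algebra k R] (L : R →ₗ[k] k) (φ : WithConv (C →ₗ[k] R)) (ψ : WithConv (C →ₗ[k] k)) :
    toConv (L ∘ₗ (convScalar R ψ * φ).ofConv) = ψ * toConv (L ∘ₗ φ.ofConv) :=
  comp_convPush_mul (Algebra.ofId k R) L (fun x y => by
    rw [Algebra.ofId_apply, ← Algebra.smul_def, map_smul, smul_eq_mul]) ψ φ

/-- `r(x₍₃₎ ⊗ x₍₁₎) u(x₍₂₎) = ε(x)`. -/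
lemma pairOp_drinfeldForm :
    toConv (pairOp k H ∘ₗ (toConv 𝑷.toLinearMap * convScalar 𝑫 (drinfeldForm k H) *
      convPush H 𝑸 (convOp k H)).ofConv) = 1 := by
  rw [convScalar_drinfeldForm]
  have e : toConv 𝑷.toLinearMap = convPush H 𝑷 (toConv LinearMap.id) := rfl
  rw [e, ← comp_convPush_mul _ _ (pairLegs_legB_mul 𝑫), ← comp_mul_convPush _ _
    (pairLegs_mul_legB 𝑫), ← mul_assoc, mul_assoc, ← mul_one (1 : WithConv (H →ₗ[k] k))]
  -- Factor by factor, `r(g | x₍₁₎ S(x₍₂₎)) = ε(x) ε(g)`.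
  refine congrArg toConv (comp_convMul_congr (L := pairOp k H ∘ₗ pairLegs k H 𝑫)
    (L' := LinearMap.id) fun x g => ?_)
  have h₁ : r (g ⊗ₜ[k] (∑ i ∈ (ℛ k x).index, (ℛ k x).left i * 𝑺 ((ℛ k x).right i))) =
      counit (R := k) x * counit (R := k) g := by
    rw [HopfAlgebra.sum_mul_antipode_eq_smul, TensorProduct.tmul_smul, map_smul, r_one_right,
      smul_eq_mul]
  refine Eq.trans ?_ h₁
  rw [(ℛ k x).convMul_apply, (ℛ k g).convMul_apply, TensorProduct.tmul_sum, map_sum,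
    Finset.sum_mul_sum, map_sum]
  refine Finset.sum_congr rfl fun i _ => ?_
  rw [r_mul_right, ← (ℛ k g).eq]
  simp [convOp, mul_comm]

/-- The inverse functional as a linear image of a convolution product in `H ⊗ Hᵐᵒᵖ`. -/
lemma drinfeldFormInv_eq : drinfeldFormInv k H = toConv (pairOp k H ∘ₗ
    (toConv 𝑷.toLinearMap *
      convPush H 𝑸 (toConv ((convAntipodeOp k H).ofConv ∘ₗ 𝑺))).ofConv) := by
  ext x
  simp only [LinearMap.comp_apply]
  rw [drinfeldFormInv_repr (ℛ k x), (ℛ k x).convMul_apply]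
  simp [convAntipodeOp]

lemma drinfeldFormInv_mul_drinfeldForm : drinfeldFormInv k H * drinfeldForm k H = 1 := by
  rw [drinfeldFormInv_eq, ← comp_mul_convScalar, mul_assoc, ← convPush_convScalar 𝑸,
    ← map_mul, ← drinfeldForm_mul_op, map_mul, convPush_convScalar, ← mul_assoc,
    pairOp_drinfeldForm]

/-- `u(x₍₁₎) x₍₂₎ = S²(x₍₁₎) u(x₍₂₎)`, with values in `H` itself. -/
lemma drinfeldForm_mul_id : convScalar H (drinfeldForm k H) * toConv LinearMap.id =
    toConv (𝑺 ∘ₗ 𝑺) * convScalar H (drinfeldForm k H) := by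
  ext x
  have := congrArg (fun φ => (φ.ofConv x).unop) (drinfeldForm_mul_op (k := k) (H := H))
  rw [(ℛ k x).convMul_apply, (ℛ k x).convMul_apply] at this ⊢
  simpa [convOp, convAntipodeOp, convScalar_apply, Algebra.commutes] using this

lemma drinfeldForm_mul_drinfeldFormInv : drinfeldForm k H * drinfeldFormInv k H = 1 := by
  have e : toConv 𝑷.toLinearMap = convPush H 𝑷 (toConv LinearMap.id) := rfl
  rw [drinfeldFormInv_eq, ← comp_convScalar_mul, ← mul_assoc, e, ← convPush_convScalar 𝑷,
    ← map_mul, drinfeldForm_mul_id, ← pairOp_drinfeldForm]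
  refine congrArg toConv (comp_convMul_congr fun x g => ?_)
  rw [(ℛ k x).convMul_apply]
  conv_lhs => rw [convPush_apply, (ℛ k x).convMul_apply]
  simp only [Finset.sum_mul, map_sum]
  refine Finset.sum_congr rfl fun i _ => ?_
  simp [convOp, convAntipodeOp, convScalar_apply, Algebra.algebraMap_eq_smul_one,
    r_antipode_antipode, smul_mul_assoc, Algebra.TensorProduct.tmul_mul_tmul, map_smul]

/-- The identity is convolution invertible with values in the opposite algebra: `H` has a skew
antipode, namely the conjugate of the antipode by `u`. -/
lemma exists_convOp_inv :
    ∃ s : WithConv (H →ₗ[k] Hᵐᵒᵖ), s * convOp k H = 1 ∧ convOp k H * s = 1 := by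
  have e₁ : convScalar Hᵐᵒᵖ (drinfeldFormInv k H) * convScalar Hᵐᵒᵖ (drinfeldForm k H) = 1 := by
    rw [← map_mul, drinfeldFormInv_mul_drinfeldForm, map_one]
  have e₂ : convScalar Hᵐᵒᵖ (drinfeldForm k H) * convScalar Hᵐᵒᵖ (drinfeldFormInv k H) = 1 := by
    rw [← map_mul, drinfeldForm_mul_drinfeldFormInv, map_one]
  refine ⟨convScalar Hᵐᵒᵖ (drinfeldFormInv k H) * convAntipodeOp k H *
    convScalar Hᵐᵒᵖ (drinfeldForm k H), ?_, ?_⟩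
  · rw [mul_assoc, mul_assoc, ← mul_assoc (convAntipodeOp k H), antipode_mul_drinfeldForm_mul, e₁]
  · have e₃ : convOp k H * convScalar Hᵐᵒᵖ (drinfeldFormInv k H) =
        convScalar Hᵐᵒᵖ (drinfeldFormInv k H) *
          toConv ((convAntipodeOp k H).ofConv ∘ₗ 𝑺) := by
      rw [← one_mul (convOp k H), ← e₁, mul_assoc (convScalar _ _) (convScalar _ _),
        drinfeldForm_mul_op, mul_assoc, mul_assoc, e₂, mul_one]
    rw [← mul_assoc, ← mul_assoc, e₃, mul_assoc (convScalar _ _), antipodeOp_comp_antipode_mul,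
      mul_one, e₁]

end SkewAntipode

/-! ### Functionals acting on comodules -/

section ConvAct

open Coalgebra TensorProduct WithConv

variable {k : Type u} [Field k] {V W C D M N : Type u}
variable [AddCommGroup V] [Module k V] [AddCommGroup W] [Module k W]
variable [AddCommGroup C] [Module k C] [Coalgebra k C]
variable [AddCommGroup D] [Module k D] [Coalgebra k D]
variable [AddCommGroup M] [Module k M] [AddCommGroup N] [Module k N]

/-- The operator `v ⊗ m ↦ v₍₀₎ ⊗ φ(v₍₁₎) m` of a functional `φ` with values in endomorphisms. -/
def coactOp (ρ : V →ₗ[k] V ⊗[k] C) : (C →ₗ[k] Module.End k M) →ₗ[k] Module.End k (V ⊗[k] M) where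
  toFun φ := (TensorProduct.lift φ).lTensor V ∘ₗ (TensorProduct.assoc k V C M).toLinearMap ∘ₗ
    ρ.rTensor M
  map_add' φ ψ := by
    have : TensorProduct.lift (φ + ψ) = TensorProduct.lift φ + TensorProduct.lift ψ :=
      map_add (TensorProduct.uncurry (.id k) C M M) φ ψ
    rw [this, LinearMap.lTensor_add, LinearMap.add_comp]
  map_smul' a φ := by
    have : TensorProduct.lift (a • φ) = a • TensorProduct.lift φ :=
      map_smul (TensorProduct.uncurry (.id k) C M M) a φ
    rw [this, LinearMap.lTensor_smul, LinearMap.smul_comp, RingHom.id_apply]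

lemma coactOp_tmul (ρ : V →ₗ[k] V ⊗[k] C) (φ : C →ₗ[k] Module.End k M) (v : V) (m : M) :
    coactOp ρ φ (v ⊗ₜ m) =
      (TensorProduct.lift φ).lTensor V (TensorProduct.assoc k V C M (ρ v ⊗ₜ m)) := rfl

lemma coactOp_tmul' (ρ : V →ₗ[k] V ⊗[k] C) (φ : C →ₗ[k] Module.End k M) (v : V) (m : M) :
    coactOp ρ φ (v ⊗ₜ m) = (φ.flip m).lTensor V (ρ v) := by
  rw [coactOp_tmul]
  induction ρ v using TensorProduct.induction_on with
  | zero => simp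
  | add x y hx hy => simp only [map_add, TensorProduct.add_tmul, hx, hy]
  | tmul x c => simp

lemma coactOp_one {ρ : V →ₗ[k] V ⊗[k] C} (hρ : IsCoaction ρ) :
    coactOp ρ (1 : WithConv (C →ₗ[k] Module.End k M)).ofConv = 1 := by
  refine TensorProduct.ext' fun v m => ?_
  rw [coactOp_tmul']
  conv_rhs => rw [← hρ.counitApply v]
  induction ρ v using TensorProduct.induction_on with
  | zero => simp
  | add x y hx hy => simp only [map_add, hx, hy, TensorProduct.add_tmul]
  | tmul x c => simp [Algebra.algebraMap_eq_smul_one, TensorProduct.smul_tmul']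

/-- Operators multiply as functionals do under convolution; this is coassociativity of the
coaction. -/
lemma coactOp_mul {ρ : V →ₗ[k] V ⊗[k] C} (hρ : IsCoaction ρ)
    (φ ψ : WithConv (C →ₗ[k] Module.End k M)) :
    coactOp ρ (φ * ψ).ofConv = coactOp ρ φ.ofConv * coactOp ρ ψ.ofConv := by
  refine TensorProduct.ext' fun v m => ?_
  rw [Module.End.mul_apply, coactOp_tmul', coactOp_tmul']
  let F : C ⊗[k] C →ₗ[k] M :=
    (LinearMap.applyₗ m) ∘ₗ LinearMap.mul' k (Module.End k M) ∘ₗ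
      TensorProduct.map φ.ofConv ψ.ofConv
  have key := congrArg (F.lTensor V) (hρ.coassoc_apply v)
  refine Eq.trans ?_ (key.symm.trans ?_)
  · generalize ρ v = x
    induction x using TensorProduct.induction_on with
    | zero => simp
    | add x y hx hy => simp only [map_add, hx, hy]
    | tmul x c => simp [F, LinearMap.convMul_apply]
  · generalize ρ v = x
    induction x using TensorProduct.induction_on with
    | zero => simp
    | add x y hx hy => simp only [map_add, hx, hy]
    | tmul x c =>
      rw [LinearMap.lTensor_tmul, coactOp_tmul', LinearMap.rTensor_tmul]
      induction ρ x using TensorProduct.induction_on with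
      | zero => simp
      | add x y hx hy => simp only [map_add, TensorProduct.add_tmul, hx, hy]
      | tmul x d => simp [F]

/-- A coaction on `V` makes the convolution algebra of `End M`-valued functionals act on
`V ⊗ M`. -/
def convAct {ρ : V →ₗ[k] V ⊗[k] C} (hρ : IsCoaction ρ) (M : Type u) [AddCommGroup M] [Module k M] :
    WithConv (C →ₗ[k] Module.End k M) →ₐ[k] Module.End k (V ⊗[k] M) :=
  AlgHom.ofLinearMap (coactOp ρ ∘ₗ (WithConv.linearEquiv k _).toLinearMap) (coactOp_one hρ)
    (coactOp_mul hρ)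

lemma convAct_tmul {ρ : V →ₗ[k] V ⊗[k] C} (hρ : IsCoaction ρ)
    (φ : WithConv (C →ₗ[k] Module.End k M)) (v : V) (m : M) :
    convAct hρ M φ (v ⊗ₜ m) = (φ.ofConv.flip m).lTensor V (ρ v) := coactOp_tmul' _ _ _ _

/-- Functionals act on a comodule through an algebra map. -/
def hitHom {ρ : V →ₗ[k] V ⊗[k] C} (hρ : IsCoaction ρ) :
    WithConv (C →ₗ[k] k) →ₐ[k] Module.End k V :=
  AlgHom.ofLinearMap
    { toFun := fun φ => hit ρ φ.ofConv
      map_add' := fun φ ψ => by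
        simp [hit, LinearMap.lTensor_add, LinearMap.add_comp, LinearMap.comp_add]
      map_smul' := fun a φ => by
        simp [hit, LinearMap.lTensor_smul, LinearMap.smul_comp, LinearMap.comp_smul] }
    ((congrArg (hit ρ) (by ext; simp)).trans (hit_counit hρ))
    (fun φ ψ => (hit_comp_hit hρ φ.ofConv ψ.ofConv).symm)

lemma hitHom_apply {ρ : V →ₗ[k] V ⊗[k] C} (hρ : IsCoaction ρ) (φ : WithConv (C →ₗ[k] k)) (v : V) :
    hitHom hρ φ v = TensorProduct.rid k V (φ.ofConv.lTensor V (ρ v)) := rfl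

lemma convAct_convScalar {ρ : V →ₗ[k] V ⊗[k] C} (hρ : IsCoaction ρ) (φ : WithConv (C →ₗ[k] k)) :
    convAct hρ M (convScalar _ φ) = (hitHom hρ φ).rTensor M := by
  refine TensorProduct.ext' fun v m => ?_
  rw [convAct_tmul, LinearMap.rTensor_tmul, hitHom_apply]
  induction ρ v using TensorProduct.induction_on with
  | zero => simp
  | add x y hx hy => simp only [map_add, TensorProduct.add_tmul, hx, hy]
  | tmul x c =>
    simp [convScalar, Algebra.ofId_apply, Algebra.algebraMap_eq_smul_one, TensorProduct.smul_tmul']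

end ConvAct

/-! ### The coadjoint coaction -/

section Coadjoint

open Coalgebra TensorProduct WithConv CoquasitriangularStructure

variable {k H : Type u} [Field k] [Ring H] [HopfAlgebra k H]

local notation "𝑺" => HopfAlgebra.antipode k (A := H)

/-- A linear image of a convolution product, computed factor by factor. -/
lemma comp_convMul {C R S : Type*} [AddCommGroup C] [Module k C]
    [Coalgebra k C] [Ring R] [Algebra k R] [Ring S] [Algebra k S]
    {L : R →ₗ[k] S} {φ ψ : WithConv (C →ₗ[k] R)} {φ' ψ' : WithConv (C →ₗ[k] S)}
    (h : ∀ c d, L (φ c * ψ d) = φ' c * ψ' d) :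
    toConv (L ∘ₗ (φ * ψ).ofConv) = φ' * ψ' :=
  congrArg toConv ((comp_convMul_congr (L' := LinearMap.id) h).trans (LinearMap.id_comp _))

local notation "𝒊" => (Algebra.TensorProduct.includeLeft : H →ₐ[k] H ⊗[k] H)
local notation "𝒋" => (Algebra.TensorProduct.includeRight : H →ₐ[k] H ⊗[k] H)

lemma includeLeft_mul_includeRight :
    toConv 𝒊.toLinearMap * toConv 𝒋.toLinearMap = toConv (comul (R := k) (A := H)) := by
  ext h
  rw [(ℛ k h).convMul_apply]
  simpa using (ℛ k h).eq

lemma coad_repr {ι κ : Type*} {h : H} (𝓗 : Coalgebra.Repr k h ι)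
    (𝓙 : ∀ i, Coalgebra.Repr k (𝓗.right i) κ) : coad k H h =
      ∑ i ∈ 𝓗.index, ∑ j ∈ (𝓙 i).index,
        (𝓙 i).left j ⊗ₜ[k] (𝑺 (𝓗.left i) * (𝓙 i).right j) := by
  simp only [coad, LinearMap.comp_apply]
  rw [← 𝓗.eq]
  simp only [map_sum, LinearMap.lTensor_tmul]
  refine Finset.sum_congr rfl fun i _ => ?_
  rw [← (𝓙 i).eq]
  simp [TensorProduct.tmul_sum]

/-- The coadjoint coaction as the convolution product of `1 ⊗ S` and the coproduct. -/
lemma coad_eq : toConv (coad k H) =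
    toConv (𝒋.toLinearMap ∘ₗ 𝑺) * toConv (comul (R := k) (A := H)) := by
  ext h
  rw [(ℛ k h).convMul_apply]
  refine (coad_repr (ℛ k h) (fun i => ℛ k _)).trans (Finset.sum_congr rfl fun i _ => ?_)
  conv_rhs => rw [ofConv_toConv, ofConv_toConv, ← (ℛ k ((ℛ k h).right i)).eq]
  simp [Finset.mul_sum]

@[simp] lemma coad_one : coad k H 1 = 1 ⊗ₜ 1 := by
  simp [coad, Algebra.TensorProduct.one_def]

/-- `(f ⊗ id)` of the coadjoint coaction is the convolution product of `S`, `f` and `id`. -/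
lemma rTensor_coad {R : Type*} [Ring R] [Algebra k R] (f : H →ₗ[k] R) :
    toConv (f.rTensor H ∘ₗ coad k H) =
      toConv ((Algebra.TensorProduct.includeRight : H →ₐ[k] R ⊗[k] H).toLinearMap ∘ₗ 𝑺) *
        (toConv ((Algebra.TensorProduct.includeLeft : R →ₐ[k] R ⊗[k] H).toLinearMap ∘ₗ f) *
          toConv (Algebra.TensorProduct.includeRight : H →ₐ[k] R ⊗[k] H).toLinearMap) := by
  have e : coad k H = (toConv (coad k H)).ofConv := rfl
  rw [e, coad_eq, ← includeLeft_mul_includeRight]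
  refine comp_convMul fun c d => ?_
  rw [(ℛ k d).convMul_apply, (ℛ k d).convMul_apply]
  simp [Finset.mul_sum]

/-- The coadjoint coaction is a coaction. Both sides of coassociativity are convolution products
of algebra maps and their composites with the antipode, by `coad_eq`. -/
lemma isCoaction_coad : IsCoaction (coad k H) where
  coassoc := by
    -- Through the algebra map `ψ(x ⊗ y) = x ⊗ Δ(y)`, coassociativity is an identity between
    -- convolution products with values in `H ⊗ H ⊗ H`.
    let i₁₂ : H ⊗[k] H →ₐ[k] (H ⊗[k] H) ⊗[k] H := Algebra.TensorProduct.includeLeft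
    let j₃ : H →ₐ[k] (H ⊗[k] H) ⊗[k] H := Algebra.TensorProduct.includeRight
    let ψ : H ⊗[k] H →ₐ[k] (H ⊗[k] H) ⊗[k] H :=
      (Algebra.TensorProduct.assoc k k k H H H).symm.toAlgHom.comp
        (Algebra.TensorProduct.map (AlgHom.id k H) (Bialgebra.comulAlgHom k H))
    have e₁ : toConv (ψ.comp 𝒋).toLinearMap =
        toConv (i₁₂.comp 𝒋).toLinearMap * toConv j₃.toLinearMap := by
      ext h
      rw [(ℛ k h).convMul_apply]
      simp only [AlgHom.toLinearMap_apply, AlgHom.comp_apply, ψ,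
        Algebra.TensorProduct.includeRight_apply, Algebra.TensorProduct.map_tmul,
        Bialgebra.comulAlgHom_apply]
      rw [← (ℛ k h).eq]
      simp [TensorProduct.tmul_sum, i₁₂, j₃]
    have e₂ : toConv ((ψ.comp 𝒋).toLinearMap ∘ₗ 𝑺) =
        toConv (j₃.toLinearMap ∘ₗ 𝑺) * toConv ((i₁₂.comp 𝒋).toLinearMap ∘ₗ 𝑺) := by
      refine left_inv_eq_right_inv (conv_comp_antipode_mul (ψ.comp 𝒋)) ?_
      rw [e₁, mul_assoc, ← mul_assoc (toConv j₃.toLinearMap), conv_mul_comp_antipode, one_mul,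
        conv_mul_comp_antipode]
    have e₃ : toConv (ψ.toLinearMap ∘ₗ comul (R := k) (A := H)) =
        toConv (i₁₂.toLinearMap ∘ₗ comul (R := k) (A := H)) * toConv j₃.toLinearMap := by
      ext h
      rw [(ℛ k h).convMul_apply]
      have := congrArg (TensorProduct.assoc k H H H).symm
        (LinearMap.congr_fun (Coalgebra.coassoc (R := k) (A := H)) h)
      refine Eq.trans this.symm ?_
      simp only [LinearMap.comp_apply, LinearEquiv.coe_coe, LinearEquiv.symm_apply_apply]
      rw [← (ℛ k h).eq]
      simp [i₁₂, j₃]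
    have lhs : toConv ((coad k H).rTensor H ∘ₗ coad k H) =
        toConv (ψ.toLinearMap ∘ₗ coad k H) := by
      have e₄ := congrArg (convPush H i₁₂) (coad_eq (k := k) (H := H))
      have e₅ := congrArg (convPush H ψ) (coad_eq (k := k) (H := H))
      rw [map_mul] at e₄ e₅
      refine (rTensor_coad (coad k H)).trans (Eq.trans ?_ e₅.symm)
      change toConv (j₃.toLinearMap ∘ₗ 𝑺) * (convPush H i₁₂ (toConv (coad k H)) *
        toConv j₃.toLinearMap) = toConv ((ψ.comp 𝒋).toLinearMap ∘ₗ 𝑺) *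
          toConv (ψ.toLinearMap ∘ₗ comul (R := k) (A := H))
      rw [e₄, e₂, e₃]
      simp only [mul_assoc]
      rfl
    have key : (coad k H).rTensor H ∘ₗ coad k H = ψ.toLinearMap ∘ₗ coad k H :=
      congrArg WithConv.ofConv lhs
    rw [key]
    ext h
    simp only [LinearMap.comp_apply, LinearEquiv.coe_coe]
    exact (TensorProduct.assoc k H H H).apply_symm_apply _
  counit_id := by
    ext h
    have e : (counit (R := k) (A := H)).lTensor H ∘ₗ coad k H =
        (counit (R := k) (A := H)).lTensor H ∘ₗ comul := by
      have h₁ := coad_eq (k := k) (H := H)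
      have h₂ := congrArg (convPush H (Algebra.TensorProduct.map (AlgHom.id k H)
        (Bialgebra.counitAlgHom k H))) h₁
      rw [map_mul] at h₂
      have h₃ : convPush H (Algebra.TensorProduct.map (AlgHom.id k H)
        (Bialgebra.counitAlgHom k H)) (toConv (𝒋.toLinearMap ∘ₗ 𝑺)) = 1 := by
        ext h
        have : (1 : H) ⊗ₜ[k] counit (R := k) h = (counit (R := k) h • 1) ⊗ₜ[k] (1 : k) := by
          rw [TensorProduct.smul_tmul, smul_eq_mul, mul_one]
        simpa [Algebra.algebraMap_eq_smul_one, Algebra.TensorProduct.one_def,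
          TensorProduct.smul_tmul'] using this
      rw [h₃, one_mul] at h₂
      exact congrArg WithConv.ofConv h₂
    have := LinearMap.congr_fun e h
    simp only [LinearMap.comp_apply] at this
    simp [LinearMap.comp_apply, this]

/-- `(1 ⊗ h₍₁₎) coad(x h₍₂₎) = coad(x) Δ(h)`. -/
lemma includeRight_mul_coad : slot₂ H (toConv 𝒋.toLinearMap) * mulPull (toConv (coad k H)) =
    slot₁ H (toConv (coad k H)) * slot₂ H (toConv (comul (R := k) (A := H))) := by
  have h₁ : mulPull (toConv (𝒋.toLinearMap ∘ₗ 𝑺)) =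
      slot₂ H (toConv (𝒋.toLinearMap ∘ₗ 𝑺)) * slot₁ H (toConv (𝒋.toLinearMap ∘ₗ 𝑺)) :=
    mulPull_of_map_mul_rev fun g h => by
      simp [HopfAlgebra.antipode_mul_antidistrib]
  have h₂ : mulPull (toConv (comul (R := k) (A := H))) =
      slot₁ H (toConv (comul (R := k) (A := H))) * slot₂ H (toConv (comul (R := k) (A := H))) :=
    mulPull_of_map_mul fun g h => Bialgebra.comul_mul g h
  rw [coad_eq, map_mul, map_mul, h₁, h₂, ← mul_assoc, ← mul_assoc, ← mul_assoc,
    ← map_mul (slot₂ H), conv_mul_comp_antipode, map_one, one_mul]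

lemma includeRight_mul_coad_repr {ι : Type*} (x : H) {h : H} (𝓗 : Coalgebra.Repr k h ι) :
    ∑ i ∈ 𝓗.index, (1 ⊗ₜ[k] 𝓗.left i) * coad k H (x * 𝓗.right i) =
      coad k H x * comul (R := k) h := by
  have := congrArg (fun φ => φ.ofConv (x ⊗ₜ h)) (includeRight_mul_coad (k := k) (H := H))
  rw [slot₁_mul_slot₂_apply, slot₂_mul_apply _ _ _ 𝓗] at this
  exact this

end Coadjoint

/-! ### The transmuted product -/

section Transmutation

open Coalgebra TensorProduct WithConv CoquasitriangularStructure

variable {k H : Type u} [Field k] [Ring H] [HopfAlgebra k H]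

local notation "𝑺" => HopfAlgebra.antipode k (A := H)

/-- `S(h₍₁₎) h₍₂₎ ⊗ h₍₃₎ = 1 ⊗ h`. -/
lemma sum_antipode_mul_tmul {ι κ : Type*} {h : H} (𝓗 : Coalgebra.Repr k h ι)
    (𝓙 : ∀ i, Coalgebra.Repr k (𝓗.right i) κ) :
    ∑ i ∈ 𝓗.index, ∑ j ∈ (𝓙 i).index,
      (𝑺 (𝓗.left i) * (𝓙 i).left j) ⊗ₜ[k] (𝓙 i).right j = (1 : H) ⊗ₜ[k] h := by
  have e : toConv ((Algebra.TensorProduct.includeLeft : H →ₐ[k] H ⊗[k] H).toLinearMap ∘ₗ 𝑺) *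
      toConv (comul (R := k) (A := H)) =
      toConv (Algebra.TensorProduct.includeRight : H →ₐ[k] H ⊗[k] H).toLinearMap := by
    rw [← includeLeft_mul_includeRight, ← mul_assoc, conv_comp_antipode_mul, one_mul]
  have := congrArg (fun φ => φ.ofConv h) e
  refine Eq.trans ?_ this
  rw [𝓗.convMul_apply]
  refine Finset.sum_congr rfl fun i _ => ?_
  rw [ofConv_toConv, ofConv_toConv, ← (𝓙 i).eq]
  simp [Finset.mul_sum]

variable (k H) in
/-- Right multiplication, with values in the endomorphisms of `H`. -/
def rightMulOp : WithConv (H →ₗ[k] Module.End k H) := convPush H (Algebra.lsmul k k H) (convOp k H)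

@[simp] lemma rightMulOp_apply (g x : H) : rightMulOp k H g x = x * g := rfl

/-- Right multiplication is antimultiplicative. -/
lemma mulPull_rightMulOp : mulPull (rightMulOp k H) =
    slot₂ H (rightMulOp k H) * slot₁ H (rightMulOp k H) :=
  mulPull_of_map_mul_rev fun g h => by ext x; simp [mul_assoc]

variable [CoquasitriangularStructure k H]

variable (k H) in
/-- `x ↦ x₍₀₎ r(g ⊗ x₍₁₎)` for the coadjoint coaction, an algebra map in `g`. -/
def coadHit : H →ₐ[k] Module.End k H := (hitHom isCoaction_coad).comp (rLeftHom k H)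

lemma coadHit_apply (g x : H) : coadHit k H g x =
    TensorProduct.rid k H ((TensorProduct.curry r g).lTensor H (coad k H x)) := rfl

lemma mulPull_coadHit : mulPull (toConv (coadHit k H).toLinearMap) =
    slot₁ H (toConv (coadHit k H).toLinearMap) * slot₂ H (toConv (coadHit k H).toLinearMap) :=
  mulPull_of_map_mul fun g h => map_mul (coadHit k H) g h

variable (k H) in
/-- `y ⊗ w ↦ r(h ⊗ w) y`. -/
def contractRight (h : H) : H ⊗[k] H →ₗ[k] H :=
  (TensorProduct.rid k H).toLinearMap ∘ₗ (TensorProduct.curry r h).lTensor H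

@[simp] lemma contractRight_tmul (h y w : H) :
    contractRight k H h (y ⊗ₜ w) = r (h ⊗ₜ[k] w) • y := by simp [contractRight]

lemma contractRight_one_tmul_mul {ι : Type*} (g : H) {h : H} (𝓗 : Coalgebra.Repr k h ι)
    (z : H ⊗[k] H) : contractRight k H h ((1 ⊗ₜ g) * z) =
      ∑ j ∈ 𝓗.index, r (𝓗.right j ⊗ₜ[k] g) • contractRight k H (𝓗.left j) z := by
  induction z using TensorProduct.induction_on with
  | zero => simp
  | add x y hx hy =>
    rw [mul_add, map_add, hx, hy, ← Finset.sum_add_distrib]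
    simp only [map_add, smul_add]
  | tmul y w =>
    rw [Algebra.TensorProduct.tmul_mul_tmul, one_mul, contractRight_tmul, r_mul_right, ← 𝓗.eq]
    simp [Finset.sum_smul, smul_smul, mul_comm]

lemma contractRight_mul_tmul {ι : Type*} (a b : H) {h : H} (𝓗 : Coalgebra.Repr k h ι)
    (z : H ⊗[k] H) : contractRight k H h (z * (a ⊗ₜ b)) =
      ∑ j ∈ 𝓗.index, r (𝓗.left j ⊗ₜ[k] b) • (contractRight k H (𝓗.right j) z * a) := by
  induction z using TensorProduct.induction_on with
  | zero => simp
  | add x y hx hy =>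
    rw [add_mul, map_add, hx, hy, ← Finset.sum_add_distrib]
    simp only [map_add, add_mul, smul_add]
  | tmul y w =>
    rw [Algebra.TensorProduct.tmul_mul_tmul, contractRight_tmul, r_mul_right, ← 𝓗.eq]
    simp [Finset.sum_smul, smul_smul]

/-- The exchange relation of `coadHit` and right multiplication. -/
lemma coadHit_rFlip_rightMulOp :
    slot₂ H (toConv (coadHit k H).toLinearMap) * rFlip k H (Module.End k H) *
        slot₁ H (rightMulOp k H) =
      slot₁ H (rightMulOp k H) * rFlip k H (Module.End k H) *
        slot₂ H (toConv (coadHit k H).toLinearMap) := by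
  refine conv_ext_tmul fun g h => LinearMap.ext fun x => ?_
  have lhs : (slot₂ H (toConv (coadHit k H).toLinearMap) * rFlip k H (Module.End k H) *
      slot₁ H (rightMulOp k H)) (g ⊗ₜ h) x = ∑ i ∈ (ℛ k g).index, ∑ j ∈ (ℛ k h).index,
        r ((ℛ k h).right j ⊗ₜ[k] (ℛ k g).left i) •
          contractRight k H ((ℛ k h).left j) (coad k H (x * (ℛ k g).right i)) := by
    rw [mul_assoc, slot₂_mul_apply _ _ _ (ℛ k h)]
    simp_rw [mul_slot₁_apply _ _ (ℛ k g)]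
    rw [LinearMap.sum_apply, Finset.sum_comm]
    simp only [rFlip_apply, Algebra.algebraMap_eq_smul_one, smul_mul_assoc, one_mul,
      Finset.mul_sum, LinearMap.sum_apply, mul_smul_comm, LinearMap.smul_apply]
    rfl
  have rhs : (slot₁ H (rightMulOp k H) * rFlip k H (Module.End k H) *
      slot₂ H (toConv (coadHit k H).toLinearMap)) (g ⊗ₜ h) x =
        ∑ i ∈ (ℛ k g).index, ∑ j ∈ (ℛ k h).index,
        r ((ℛ k h).left j ⊗ₜ[k] (ℛ k g).right i) •
          (contractRight k H ((ℛ k h).right j) (coad k H x) * (ℛ k g).left i) := by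
    rw [mul_assoc, slot₁_mul_apply _ _ (ℛ k g)]
    simp_rw [mul_slot₂_apply _ _ _ (ℛ k h)]
    simp only [rFlip_apply, Algebra.algebraMap_eq_smul_one, smul_mul_assoc, one_mul,
      Finset.mul_sum, LinearMap.sum_apply, mul_smul_comm, LinearMap.smul_apply]
    rfl
  rw [lhs, rhs]
  simp_rw [← contractRight_one_tmul_mul, ← contractRight_mul_tmul]
  rw [← map_sum, ← map_sum, includeRight_mul_coad_repr, ← Finset.mul_sum, (ℛ k g).eq]

lemma contractMid_repr {ι κ : Type*} (φ : H ⊗[k] H →ₗ[k] k) {g h : H} (𝓖 : Coalgebra.Repr k g ι)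
    (𝓗 : Coalgebra.Repr k h κ) :
    contractMid φ (TensorProduct.map (comul (R := k)) (comul (R := k)) (g ⊗ₜ h)) =
      ∑ j ∈ 𝓗.index, ∑ i ∈ 𝓖.index,
        φ (𝓖.right i ⊗ₜ 𝓗.left j) • (𝓖.left i ⊗ₜ[k] 𝓗.right j) := by
  rw [TensorProduct.map_tmul, ← 𝓖.eq, ← 𝓗.eq]
  simp [contractMid, TensorProduct.tmul_sum, TensorProduct.sum_tmul]

variable {R : Type*} [Ring R] [Algebra k R]

/-- The values `κ(g • x)` as a convolution product in `g`. -/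
lemma map_transMul_repr {ι μ : Type*} (κ : H →ₗ[k] R) (g : H) {x : H} (𝓧 : Coalgebra.Repr k x ι)
    (𝓙 : ∀ i, Coalgebra.Repr k (𝓧.right i) μ) : κ (transMul k H g x) =
      ∑ i ∈ 𝓧.index, ((∑ j ∈ (𝓙 i).index, toConv (κ ∘ₗ LinearMap.mulLeft k ((𝓙 i).left j)) *
        convScalar R (rRight k H ((𝓙 i).right j))) *
          convScalar R (rRight k H (𝑺 (𝓧.left i)))) g := by
  have h₁ : ∀ (y g : H) (𝓨 : Coalgebra.Repr k y μ),
      κ (((TensorProduct.lid k H).toLinearMap ∘ₗ TensorProduct.map r (LinearMap.mul' k H) ∘ₗ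
        comul (R := k) (A := H ⊗[k] H)) (g ⊗ₜ y)) =
      (∑ j ∈ 𝓨.index, toConv (κ ∘ₗ LinearMap.mulLeft k (𝓨.left j)) *
        convScalar R (rRight k H (𝓨.right j))) g := by
    intro y g 𝓨
    rw [comm_r, LinearMap.comp_apply, LinearMap.comp_apply, comul_tmul_repr (ℛ k g) 𝓨,
      WithConv.ofConv_sum, LinearMap.sum_apply, Finset.sum_comm]
    simp only [map_sum]
    refine Finset.sum_congr rfl fun j _ => ?_
    rw [(ℛ k g).convMul_apply]
    simp [convScalar_apply, Algebra.algebraMap_eq_smul_one]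
  have h₂ : κ (transMul k H g x) = κ (((TensorProduct.lid k H).toLinearMap ∘ₗ
      TensorProduct.map r (LinearMap.mul' k H) ∘ₗ comul (R := k) (A := H ⊗[k] H))
        (contractMid (r ∘ₗ 𝑺.lTensor H)
          (TensorProduct.map (comul (R := k)) (comul (R := k)) (g ⊗ₜ x)))) := rfl
  rw [h₂, contractMid_repr _ (ℛ k g) 𝓧]
  simp only [map_sum, map_smul, h₁ _ _ (𝓙 _)]
  refine Finset.sum_congr rfl fun i _ => ?_
  rw [(ℛ k g).convMul_apply]
  refine Finset.sum_congr rfl fun j _ => ?_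
  simp [convScalar_apply, Algebra.algebraMap_eq_smul_one]

/-- `g • x = x₍₀₎ g₍₁₎ r(g₍₂₎ ⊗ x₍₁₎)`. -/
lemma transMul_eq : toConv (transMul k H) =
    rightMulOp k H * toConv (coadHit k H).toLinearMap := by
  ext g x
  refine (map_transMul_repr LinearMap.id g (ℛ k x) (fun i => ℛ k _)).trans ?_
  rw [(ℛ k g).convMul_apply, LinearMap.sum_apply]
  -- `h ↦ r(- | h)` is antimultiplicative, so the two factors combine to the coadjoint coaction.
  simp only [Finset.sum_mul, mul_assoc, ← map_mul, ← rRight_mul]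
  simp only [Module.End.mul_apply, rightMulOp_apply, AlgHom.toLinearMap_apply,
    coadHit_apply, coad_repr (ℛ k x) (fun i => ℛ k _), map_sum, LinearMap.lTensor_tmul,
    TensorProduct.curry_apply, TensorProduct.rid_tmul, WithConv.ofConv_sum,
    LinearMap.sum_apply]
  rw [Finset.sum_comm]
  refine Finset.sum_congr rfl fun i _ => ?_
  rw [Finset.sum_comm]
  refine Finset.sum_congr rfl fun j _ => ?_
  rw [(ℛ k g).convMul_apply]
  refine Finset.sum_congr rfl fun l _ => ?_
  simp [convScalar_apply, Algebra.algebraMap_eq_smul_one]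

lemma transMul_one_left (x : H) : transMul k H 1 x = x := by
  have := congrArg (fun φ => φ.ofConv 1 x) (transMul_eq (k := k) (H := H))
  refine Eq.trans this ?_
  simp [LinearMap.convMul_apply, Algebra.TensorProduct.one_def]

lemma transMul_one_right (g : H) : transMul k H g 1 = g := by
  have := congrArg (fun φ => φ.ofConv g 1) (transMul_eq (k := k) (H := H))
  refine Eq.trans this ?_
  rw [(ℛ k g).convMul_apply, LinearMap.sum_apply]
  simp [coadHit_apply, r_one_right, sum_counit_right_smul]

/-- `g ↦ (x ↦ g • x)` satisfies the reflection equation. -/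
lemma mulPull_transMul : mulPull (toConv (transMul k H)) * rFlip k H (Module.End k H) =
    slot₂ H (toConv (transMul k H)) * rFlip k H (Module.End k H) *
      slot₁ H (toConv (transMul k H)) := by
  have h := rFlip_mul_flip_mulPull (toConv (coadHit k H).toLinearMap)
  rw [mulPull_coadHit, map_mul, convFlip_slot₁, convFlip_slot₂] at h
  have h' := coadHit_rFlip_rightMulOp (k := k) (H := H)
  rw [transMul_eq, map_mul, map_mul, map_mul, mulPull_rightMulOp, mulPull_coadHit]
  calc slot₂ H (rightMulOp k H) * slot₁ H (rightMulOp k H) *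
        (slot₁ H (toConv (coadHit k H).toLinearMap) * slot₂ H (toConv (coadHit k H).toLinearMap)) *
          rFlip k H (Module.End k H)
      = slot₂ H (rightMulOp k H) * (slot₁ H (rightMulOp k H) * rFlip k H (Module.End k H) *
          slot₂ H (toConv (coadHit k H).toLinearMap)) *
            slot₁ H (toConv (coadHit k H).toLinearMap) := by
        simp only [mul_assoc] at h ⊢
        rw [← h]
    _ = _ := by
        rw [← h']
        simp only [mul_assoc]

/-- `g ↦ (x ↦ g • x)` is convolution invertible. -/
lemma exists_transMul_inv : ∃ ψ : WithConv (H →ₗ[k] Module.End k H),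
    ψ * toConv (transMul k H) = 1 ∧ toConv (transMul k H) * ψ = 1 := by
  obtain ⟨s, hs₁, hs₂⟩ := exists_convOp_inv (k := k) (H := H)
  have h₁ : convPush H (Algebra.lsmul k k H) s * rightMulOp k H = 1 := by
    rw [rightMulOp, ← map_mul, hs₁, map_one]
  have h₂ : rightMulOp k H * convPush H (Algebra.lsmul k k H) s = 1 := by
    rw [rightMulOp, ← map_mul, hs₂, map_one]
  refine ⟨toConv ((coadHit k H).toLinearMap ∘ₗ 𝑺) * convPush H (Algebra.lsmul k k H) s, ?_, ?_⟩
  · rw [transMul_eq, mul_assoc, ← mul_assoc (convPush _ _ _), h₁, one_mul, conv_comp_antipode_mul]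
  · rw [transMul_eq, mul_assoc, ← mul_assoc (toConv (coadHit k H).toLinearMap),
      conv_mul_comp_antipode, one_mul, h₂]

end Transmutation

/-! ### Reflective pairs -/

section ReflectivePairs

open Coalgebra TensorProduct WithConv CoquasitriangularStructure RightModuleAlgebra

variable {k H A : Type u} [Field k] [Ring H] [HopfAlgebra k H]

section Push

variable {C D R S : Type*} [AddCommGroup C] [Module k C] [Coalgebra k C]
variable [AddCommGroup D] [Module k D] [Coalgebra k D] [Ring R] [Algebra k R] [Ring S] [Algebra k S]

lemma convPush_slot₁ (f : R →ₐ[k] S) (φ : WithConv (C →ₗ[k] R)) :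
    convPush (C ⊗[k] D) f (slot₁ D φ) = slot₁ D (convPush C f φ) :=
  conv_ext_tmul fun c d => by simp

lemma convPush_slot₂ (f : R →ₐ[k] S) (φ : WithConv (D →ₗ[k] R)) :
    convPush (C ⊗[k] D) f (slot₂ C φ) = slot₂ C (convPush D f φ) :=
  conv_ext_tmul fun c d => by simp

lemma convPush_mulPull (f : R →ₐ[k] S) (φ : WithConv (H →ₗ[k] R)) :
    convPush (H ⊗[k] H) f (mulPull φ) = mulPull (convPush H f φ) := rfl

lemma convPush_rFlip [CoquasitriangularStructure k H] (f : R →ₐ[k] S) :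
    convPush (H ⊗[k] H) f (rFlip k H R) = rFlip k H S :=
  conv_ext_tmul fun c d => by simp [rFlip_apply]

/-- The reflection equation is preserved by algebra maps. -/
lemma convPush_reflection [CoquasitriangularStructure k H] (f : R →ₐ[k] S)
    {κ : WithConv (H →ₗ[k] R)}
    (h : mulPull κ * rFlip k H R = slot₂ H κ * rFlip k H R * slot₁ H κ) :
    mulPull (convPush H f κ) * rFlip k H S =
      slot₂ H (convPush H f κ) * rFlip k H S * slot₁ H (convPush H f κ) := by
  have := congrArg (convPush _ f) h
  simpa only [map_mul, convPush_slot₁, convPush_slot₂, convPush_mulPull, convPush_rFlip]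
    using this

lemma convPush_injective {f : R →ₐ[k] S} (hf : Function.Injective f) :
    Function.Injective (convPush C f) := fun φ ψ h => by
  ext c
  exact hf (congrArg (fun φ => φ.ofConv c) h)

end Push

variable [CoquasitriangularStructure k H] [Ring A] [Algebra k A] [RightModuleAlgebra k H A]
variable {R S : Type*} [Ring R] [Algebra k R] [Ring S] [Algebra k S]

local notation "𝑺" => HopfAlgebra.antipode k (A := H)

/-- The family `h ↦ ι(a.h)`. -/
def actConv (ι : A →ₐ[k] R) (a : A) : WithConv (H →ₗ[k] R) := toConv (ι.toLinearMap ∘ₗ act a)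

@[simp] lemma actConv_apply (ι : A →ₐ[k] R) (a : A) (h : H) :
    actConv ι a h = ι (act (k := k) a h) := rfl

/-- An algebra map `ι : A → R` and a linear map `κ : H → R` that satisfy the defining relations of
the reflective algebra of `A`. -/
structure IsReflectivePair (ι : A →ₐ[k] R) (κ : WithConv (H →ₗ[k] R)) : Prop where
  map_one : κ 1 = 1
  comm (a : A) : κ * actConv ι a = actConv ι a * κ
  reflection : mulPull κ * rFlip k H R = slot₂ H κ * rFlip k H R * slot₁ H κ

/-- The relations of a reflective pair can be checked after an injective algebra map. -/
lemma IsReflectivePair.of_injective {ι : A →ₐ[k] R} {κ : WithConv (H →ₗ[k] R)} {f : R →ₐ[k] S}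
    (hf : Function.Injective f) (h : IsReflectivePair (f.comp ι) (convPush H f κ)) :
    IsReflectivePair ι κ where
  map_one := hf (h.map_one.trans (_root_.map_one f).symm)
  comm a := convPush_injective hf <| by
    rw [map_mul, map_mul]
    exact h.comm a
  reflection := convPush_injective hf <| by
    simpa only [map_mul, convPush_slot₁, convPush_slot₂, convPush_mulPull, convPush_rFlip]
      using h.reflection

/-- Algebra maps send reflective pairs to reflective pairs. -/
lemma IsReflectivePair.push {ι : A →ₐ[k] R} {κ : WithConv (H →ₗ[k] R)}
    (h : IsReflectivePair ι κ) (f : R →ₐ[k] S) :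
    IsReflectivePair (f.comp ι) (convPush H f κ) where
  map_one := (congrArg f h.map_one).trans (_root_.map_one f)
  comm a := by
    have := congrArg (convPush H f) (h.comm a)
    rw [map_mul, map_mul] at this
    exact this
  reflection := convPush_reflection f h.reflection

/-- `κ(x₍₁₎ g₍₁₎) r(g₍₂₎ ⊗ x₍₂₎) = κ(g₍₁₎) r(g₍₂₎ ⊗ x₍₁₎) κ(x₍₂₎)`, as functions of `g`. -/
lemma sum_mulLeft_of_reflection {κ : WithConv (H →ₗ[k] R)}
    (hκ : mulPull κ * rFlip k H R = slot₂ H κ * rFlip k H R * slot₁ H κ) {ι : Type*} {x : H}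
    (𝓧 : Coalgebra.Repr k x ι) :
    ∑ j ∈ 𝓧.index, toConv (κ.ofConv ∘ₗ LinearMap.mulLeft k (𝓧.left j)) *
        convScalar R (rRight k H (𝓧.right j)) =
      ∑ j ∈ 𝓧.index, toConv (LinearMap.mulRight k (κ (𝓧.right j)) ∘ₗ
        (κ * convScalar R (rRight k H (𝓧.left j))).ofConv) := by
  ext g
  have := congrArg (fun φ => φ.ofConv (x ⊗ₜ g)) hκ
  rw [convMul_tmul_apply _ _ 𝓧 (ℛ k g), mul_assoc, slot₂_mul_apply _ _ _ (ℛ k g)] at this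
  simp_rw [mul_slot₁_apply _ _ 𝓧] at this
  rw [WithConv.ofConv_sum, WithConv.ofConv_sum, LinearMap.sum_apply, LinearMap.sum_apply]
  simp only [LinearMap.comp_apply]
  simp_rw [(ℛ k g).convMul_apply]
  refine this.trans ?_
  simp only [Finset.mul_sum, map_sum]
  rw [Finset.sum_comm]
  simp [rFlip_apply, convScalar_apply, mul_assoc]

/-- A solution of the reflection equation is multiplicative for the transmuted product. -/
lemma map_transMul_of_reflection {κ : WithConv (H →ₗ[k] R)}
    (hκ : mulPull κ * rFlip k H R = slot₂ H κ * rFlip k H R * slot₁ H κ) (g x : H) :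
    κ (transMul k H g x) = κ g * κ x := by
  refine (map_transMul_repr κ.ofConv g (ℛ k x) (fun i => ℛ k _)).trans ?_
  simp_rw [sum_mulLeft_of_reflection hκ]
  -- With `Θ(a ⊗ b) = κ(g₍₁₎) r(g₍₂₎ | a) κ(b)` the claim is `Θ(S(x₍₁₎) x₍₂₎ ⊗ x₍₃₎) = Θ(1 ⊗ x)`.
  let Θ : H ⊗[k] H →ₗ[k] R := TensorProduct.lift
    (((LinearMap.mul k R).compl₂ κ.ofConv) ∘ₗ LinearMap.applyₗ g ∘ₗ
      (WithConv.linearEquiv k _).toLinearMap ∘ₗ LinearMap.mulLeft k κ ∘ₗ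
        (WithConv.linearEquiv k _).symm.toLinearMap ∘ₗ
        LinearMap.compRight k (Algebra.linearMap k R) ∘ₗ
        (WithConv.linearEquiv k _).toLinearMap ∘ₗ rRight k H)
  have hΘ (a b : H) : Θ (a ⊗ₜ b) = (κ * convScalar R (rRight k H a)) g * κ b := rfl
  have key := congrArg Θ (sum_antipode_mul_tmul (ℛ k x) (fun i => ℛ k _))
  have h1 : convScalar R (rRight k H 1) = 1 := by
    rw [← map_one (convScalar R)]
    congr 1
    ext h
    exact r_one_right h
  rw [hΘ, h1, mul_one] at key
  refine Eq.trans ?_ key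
  simp only [map_sum, hΘ]
  refine Finset.sum_congr rfl fun i _ => ?_
  rw [Finset.sum_mul, WithConv.ofConv_sum, LinearMap.sum_apply]
  refine Finset.sum_congr rfl fun j _ => ?_
  rw [rRight_mul, map_mul, ← mul_assoc, (ℛ k g).convMul_apply, (ℛ k g).convMul_apply]
  simp only [Finset.sum_mul, LinearMap.comp_apply, LinearMap.mulRight_apply,
    convScalar_apply, mul_assoc, Algebra.commutes]

/-- `κ(h₍₀₎) ι(a.h₍₁₎) = ι(a) κ(h)` for the coadjoint coaction. -/
lemma IsReflectivePair.coad_comm {ι : A →ₐ[k] R} {κ : WithConv (H →ₗ[k] R)}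
    (hp : IsReflectivePair ι κ) (a : A) (h : H) :
    LinearMap.mul' k R (TensorProduct.map κ.ofConv (actConv ι a).ofConv (coad k H h)) =
      ι a * κ h := by
  let Θ : H ⊗[k] H →ₗ[k] R :=
    LinearMap.mul' k R ∘ₗ TensorProduct.map (actConv ι a).ofConv κ.ofConv
  have key := congrArg Θ (sum_antipode_mul_tmul (ℛ k h) (fun i => ℛ k _))
  have hΘ (g b : H) : Θ (g ⊗ₜ b) = ι (act (k := k) a g) * κ b := rfl
  rw [hΘ, act_unit] at key
  rw [coad_repr (ℛ k h) (fun i => ℛ k _), ← key]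
  simp only [map_sum, hΘ, act_mul]
  refine Finset.sum_congr rfl fun i _ => ?_
  have := congrArg (fun φ => φ.ofConv ((ℛ k h).right i))
    (hp.comm (act (k := k) a (𝑺 ((ℛ k h).left i))))
  rw [(ℛ k _).convMul_apply, (ℛ k _).convMul_apply] at this
  simpa [act_mul] using this

/-- The linear map `g ⊗ a ↦ κ(g) ι(a)`. -/
def pairLift (ι : A →ₐ[k] R) (κ : WithConv (H →ₗ[k] R)) : H ⊗[k] A →ₗ[k] R :=
  LinearMap.mul' k R ∘ₗ TensorProduct.map κ.ofConv ι.toLinearMap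

@[simp] lemma pairLift_tmul (ι : A →ₐ[k] R) (κ : WithConv (H →ₗ[k] R)) (g : H) (a : A) :
    pairLift ι κ (g ⊗ₜ a) = κ g * ι a := rfl

/-- A reflective pair is multiplicative for the product of the reflective algebra. -/
lemma IsReflectivePair.pairLift_mul {ι : A →ₐ[k] R} {κ : WithConv (H →ₗ[k] R)}
    (hp : IsReflectivePair ι κ) (g h : H) (a b : A) :
    pairLift ι κ (TensorProduct.map (transMul k H g) (LinearMap.mulRight k b ∘ₗ act a)
      (coad k H h)) = pairLift ι κ (g ⊗ₜ a) * pairLift ι κ (h ⊗ₜ b) := by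
  rw [pairLift_tmul, pairLift_tmul, mul_assoc, ← mul_assoc (ι a), ← hp.coad_comm]
  induction coad k H h using TensorProduct.induction_on with
  | zero => simp
  | add x y hx hy => simp only [map_add, hx, hy, mul_add, add_mul]
  | tmul x y =>
    simp [map_transMul_of_reflection hp.reflection, mul_assoc]

end ReflectivePairs

/-! ### The reflective algebra and its universal property -/

section SmashProduct

open Coalgebra TensorProduct WithConv CoquasitriangularStructure RightModuleAlgebra

variable {k H A : Type u} [Field k] [Ring H] [HopfAlgebra k H]
variable [Ring A] [Algebra k A] [RightModuleAlgebra k H A]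

/-- The action of a module algebra on `V ⊗ M`, as an algebra map. -/
def actHom {V : Type u} [AddCommGroup V] [Module k V] {ρ : V →ₗ[k] V ⊗[k] H} (hρ : IsCoaction ρ)
    (A M : Type u) [Ring A] [Algebra k A] [RightModuleAlgebra k H A]
    [AddCommGroup M] [Module k M] [Module A M] [IsScalarTower k A M] :
    A →ₐ[k] Module.End k (V ⊗[k] M) where
  toFun a := actMap ρ a
  map_one' := LinearMap.ext fun t => by
    have := actMap_algebraMap (A := A) (M := M) hρ 1 t
    rwa [map_one, one_smul] at this
  map_mul' a b := LinearMap.ext fun t => actMap_mul hρ a b t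
  map_zero' := LinearMap.ext fun t => by
    have := actMap_algebraMap (A := A) (M := M) hρ 0 t
    rwa [map_zero, zero_smul] at this
  map_add' a b := actMap_add ρ a b
  commutes' c := LinearMap.ext fun t => actMap_algebraMap hρ c t

lemma actHom_eq_convAct {V : Type u} [AddCommGroup V] [Module k V] {ρ : V →ₗ[k] V ⊗[k] H}
    (hρ : IsCoaction ρ) (M : Type u) [AddCommGroup M] [Module k M] [Module A M]
    [IsScalarTower k A M] (a : A) :
    actHom hρ A M a = convAct hρ M (actConv (Algebra.lsmul k k M) a) := rfl

variable (k H A) in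
/-- The algebra `A` acting on `H ⊗ A` through the coadjoint coaction. -/
def smashIota : A →ₐ[k] Module.End k (H ⊗[k] A) := actHom isCoaction_coad A A

/-- `a (x ⊗ b) = x₍₀₎ ⊗ (a.x₍₁₎) b` for the coadjoint coaction. -/
lemma smashIota_tmul (a b : A) (x : H) : smashIota k H A a (x ⊗ₜ b) =
    TensorProduct.map LinearMap.id (LinearMap.mulRight k b ∘ₗ act a) (coad k H x) := by
  change actMap (coad k H) a (x ⊗ₜ b) = _
  rw [actMap_tmul]
  induction coad k H x using TensorProduct.induction_on with
  | zero => simp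
  | add x y hx hy => simp only [map_add, TensorProduct.add_tmul, hx, hy]
  | tmul x y => simp

variable [CoquasitriangularStructure k H]

variable (k H A) in
/-- The transmuted product of `H`, acting on `H ⊗ A`. -/
def smashKappa : WithConv (H →ₗ[k] Module.End k (H ⊗[k] A)) :=
  convPush H (Module.End.rTensorAlgHom k H A) (toConv (transMul k H))

@[simp] lemma smashKappa_tmul (g x : H) (a : A) :
    smashKappa k H A g (x ⊗ₜ a) = transMul k H g x ⊗ₜ a := rfl

/-- The operators `x ⊗ b ↦ x₍₀₎ ⊗ (a.(x₍₁₎ h)) b`. -/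
def smashMid (a : A) : WithConv (H →ₗ[k] Module.End k (H ⊗[k] A)) :=
  convPush H (convAct isCoaction_coad A)
    (convCurry k H H _ (convFlip k H H _ (mulPull (actConv (Algebra.lsmul k k A) a))))

lemma smashMid_tmul (a b : A) (h x : H) : smashMid a h (x ⊗ₜ b) =
    TensorProduct.map LinearMap.id (LinearMap.mulRight k b ∘ₗ act a)
      (coad k H x * (1 ⊗ₜ h)) := by
  rw [smashMid, convPush_apply, convAct_tmul]
  induction coad k H x using TensorProduct.induction_on with
  | zero => simp
  | add x y hx hy => simp only [map_add, add_mul, hx, hy]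
  | tmul x y => simp

lemma convPush_rTensor_tmul {C : Type*} [AddCommGroup C] [Module k C] [Coalgebra k C]
    (φ : WithConv (C →ₗ[k] Module.End k H)) (c : C) (x : H) (a : A) :
    convPush C (Module.End.rTensorAlgHom k H A) φ c (x ⊗ₜ a) = φ c x ⊗ₜ a := rfl

/-- Moving `A` past right multiplication by `h` leaves a factor of `h` on the right of the
coaction, which `smashMid` records. -/
lemma actConv_mul_rightMulOp (a : A) :
    actConv (smashIota k H A) a * convPush H (Module.End.rTensorAlgHom k H A) (rightMulOp k H) =
      convPush H (Module.End.rTensorAlgHom k H A) (rightMulOp k H) * smashMid a := by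
  ext h : 2
  refine TensorProduct.ext' fun x b => ?_
  have key := congrArg (TensorProduct.map LinearMap.id (LinearMap.mulRight k b ∘ₗ act a))
    (includeRight_mul_coad_repr x (ℛ k h))
  rw [(ℛ k h).convMul_apply, (ℛ k h).convMul_apply, LinearMap.sum_apply, LinearMap.sum_apply]
  rw [map_sum] at key
  refine Eq.trans (Finset.sum_congr rfl fun i _ => ?_) (key.trans ?_)
  · rw [Module.End.mul_apply, convPush_rTensor_tmul, rightMulOp_apply, actConv_apply,
      smashIota_tmul]
    induction coad k H (x * (ℛ k h).right i) using TensorProduct.induction_on with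
    | zero => simp
    | add x y hx hy => simp only [map_add, mul_add, hx, hy]
    | tmul x y => simp [act_mul]
  · conv_lhs => rw [← (ℛ k h).eq, Finset.mul_sum, map_sum]
    refine Finset.sum_congr rfl fun i _ => ?_
    rw [Module.End.mul_apply, smashMid_tmul]
    induction coad k H x using TensorProduct.induction_on with
    | zero => simp
    | add x y hx hy => simp only [map_add, add_mul, hx, hy]
    | tmul x y =>
      simp only [Algebra.TensorProduct.tmul_mul_tmul, TensorProduct.map_tmul,
        convPush_rTensor_tmul]
      simp

/-- Moving `A` past `coadHit` is the commutation rule of `r`: it turns `a.(x₍₁₎ h)` into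
`a.(h x₍₁₎)`. -/
lemma smashMid_mul_coadHit (a : A) :
    smashMid a * convPush H (Module.End.rTensorAlgHom k H A) (toConv (coadHit k H).toLinearMap) =
      convPush H (Module.End.rTensorAlgHom k H A) (toConv (coadHit k H).toLinearMap) *
        actConv (smashIota k H A) a := by
  have h₁ : convPush H (Module.End.rTensorAlgHom k H A) (toConv (coadHit k H).toLinearMap) =
      convPush H (convAct isCoaction_coad A) (convCurry k H H _ (rConv k H (Module.End k A))) := by
    ext h : 2
    exact (convAct_convScalar isCoaction_coad (rLeft k H h)).symm
  have h₂ : actConv (smashIota k H A) a = convPush H (convAct isCoaction_coad A)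
      (convCurry k H H _ (mulPull (actConv (Algebra.lsmul k k A) a))) := by
    ext h : 2
    change actHom isCoaction_coad A A (act a h) = _
    rw [actHom_eq_convAct, convPush_apply]
    congr 1
    ext c : 2
    simp [act_mul]
  rw [h₁, h₂, smashMid, ← map_mul, ← map_mul, ← map_mul, ← map_mul, rConv_mul_mulPull]

variable (k H A) in
/-- The operators on `H ⊗ A` given by `A` and by the transmuted product satisfy the relations of
the reflective algebra. -/
lemma isReflectivePair_smash : IsReflectivePair (smashIota k H A) (smashKappa k H A) where
  map_one := TensorProduct.ext' fun x a => by simp [transMul_one_left]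
  comm a := by
    rw [smashKappa, transMul_eq, map_mul, mul_assoc, ← smashMid_mul_coadHit, ← mul_assoc,
      ← actConv_mul_rightMulOp, mul_assoc]
  reflection := convPush_reflection _ mulPull_transMul

variable (k H A) in
/-- The product of the reflective algebra: left multiplications as operators on `H ⊗ A`. -/
def smashMul : H ⊗[k] A →ₗ[k] Module.End k (H ⊗[k] A) :=
  pairLift (smashIota k H A) (smashKappa k H A)

lemma smashMul_tmul_tmul (g h : H) (a b : A) : smashMul k H A (g ⊗ₜ a) (h ⊗ₜ b) =
    TensorProduct.map (transMul k H g) (LinearMap.mulRight k b ∘ₗ act a) (coad k H h) := by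
  rw [smashMul, pairLift_tmul, Module.End.mul_apply, smashIota_tmul]
  induction coad k H h using TensorProduct.induction_on with
  | zero => simp
  | add x y hx hy => simp only [map_add, hx, hy]
  | tmul x y => simp

/-- Associativity, in the form that left multiplications are multiplicative. -/
lemma smashMul_mul (p q : H ⊗[k] A) :
    smashMul k H A (smashMul k H A p q) = smashMul k H A p * smashMul k H A q := by
  induction p using TensorProduct.induction_on with
  | zero => simp
  | add x y hx hy => simp only [map_add, LinearMap.add_apply, add_mul, hx, hy]
  | tmul g a =>
    induction q using TensorProduct.induction_on with
    | zero => simp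
    | add x y hx hy => simp only [map_add, mul_add, hx, hy]
    | tmul h b =>
      rw [smashMul_tmul_tmul]
      exact (isReflectivePair_smash k H A).pairLift_mul g h a b

lemma smashMul_one_left : smashMul k H A (1 ⊗ₜ 1) = 1 := by
  rw [smashMul, pairLift_tmul, (isReflectivePair_smash k H A).map_one, map_one, one_mul]

lemma smashMul_one_right (p : H ⊗[k] A) : smashMul k H A p (1 ⊗ₜ 1) = p := by
  induction p using TensorProduct.induction_on with
  | zero => simp
  | add x y hx hy => rw [map_add, LinearMap.add_apply, hx, hy]
  | tmul g a => simp [smashMul_tmul_tmul, transMul_one_right, act_unit]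

variable (k H A) in
/-- The reflective algebra `A[H]`, with underlying vector space `H ⊗ A`. -/
def ReflectiveAlgebra : Type u := H ⊗[k] A

namespace ReflectiveAlgebra

instance : AddCommGroup (ReflectiveAlgebra k H A) := inferInstanceAs (AddCommGroup (H ⊗[k] A))

instance : Module k (ReflectiveAlgebra k H A) := inferInstanceAs (Module k (H ⊗[k] A))

instance : Ring (ReflectiveAlgebra k H A) where
  __ := (inferInstance : AddCommGroup (ReflectiveAlgebra k H A))
  mul p q := smashMul k H A p q
  one := (1 : H) ⊗ₜ[k] (1 : A)
  mul_assoc p q s := LinearMap.congr_fun (smashMul_mul p q) s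
  one_mul p := LinearMap.congr_fun smashMul_one_left p
  mul_one p := smashMul_one_right p
  left_distrib p q s := map_add (smashMul k H A p) q s
  right_distrib p q s := LinearMap.congr_fun (map_add (smashMul k H A) p q) s
  zero_mul p := LinearMap.congr_fun (map_zero (smashMul k H A)) p
  mul_zero p := map_zero (smashMul k H A p)

instance : Algebra k (ReflectiveAlgebra k H A) :=
  Algebra.ofModule (fun c p q => LinearMap.congr_fun (map_smul (smashMul k H A) c p) q)
    (fun c p q => map_smul (smashMul k H A p) c q)

variable (k H A) in
/-- The underlying vector space of the reflective algebra. -/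
def equiv : H ⊗[k] A ≃ₗ[k] ReflectiveAlgebra k H A := LinearEquiv.refl k _

lemma equiv_mul (g h : H) (x y : A) : equiv k H A (g ⊗ₜ x) * equiv k H A (h ⊗ₜ y) =
    equiv k H A (TensorProduct.map (transMul k H g) (LinearMap.mulRight k y ∘ₗ act x)
      (coad k H h)) := smashMul_tmul_tmul g h x y

lemma equiv_one : equiv k H A (1 ⊗ₜ 1) = 1 := rfl

variable (k H A) in
/-- Left multiplication, an embedding into the operators on `H ⊗ A`. -/
def lmulHom : ReflectiveAlgebra k H A →ₐ[k] Module.End k (H ⊗[k] A) :=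
  AlgHom.ofLinearMap (smashMul k H A) smashMul_one_left smashMul_mul

lemma lmulHom_injective : Function.Injective (lmulHom k H A) := fun p q h => by
  have := LinearMap.congr_fun h (1 ⊗ₜ 1)
  exact (smashMul_one_right p).symm.trans (this.trans (smashMul_one_right q))

variable (k H A) in
/-- The inclusion `x ↦ 1 # x` of the module algebra. -/
def iota : A →ₐ[k] ReflectiveAlgebra k H A :=
  AlgHom.ofLinearMap ((equiv k H A).toLinearMap ∘ₗ TensorProduct.mk k H A 1) rfl fun x y => by
    simp only [LinearMap.comp_apply, LinearEquiv.coe_coe, TensorProduct.mk_apply]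
    rw [equiv_mul]
    simp [transMul_one_left, act_unit]

lemma iota_apply (x : A) : iota k H A x = equiv k H A (1 ⊗ₜ x) := rfl

variable (k H A) in
/-- The reflective structure `h ↦ h # 1`. -/
def kappa : H →ₗ[k] ReflectiveAlgebra k H A :=
  (equiv k H A).toLinearMap ∘ₗ (TensorProduct.mk k H A).flip 1

lemma kappa_apply (h : H) : kappa k H A h = equiv k H A (h ⊗ₜ 1) := rfl

lemma kappa_mul_iota (h : H) (x : A) :
    kappa k H A h * iota k H A x = equiv k H A (h ⊗ₜ x) := by
  rw [kappa_apply, iota_apply, equiv_mul]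
  simp [transMul_one_right, act_unit]

lemma lmulHom_comp_iota : (lmulHom k H A).comp (iota k H A) = smashIota k H A := by
  ext x : 1
  change smashMul k H A (1 ⊗ₜ x) = _
  rw [smashMul, pairLift_tmul, (isReflectivePair_smash k H A).map_one, one_mul]

lemma convPush_lmulHom_kappa :
    convPush H (lmulHom k H A) (toConv (kappa k H A)) = smashKappa k H A := by
  ext h : 2
  change smashMul k H A (h ⊗ₜ 1) = _
  rw [smashMul, pairLift_tmul, map_one, mul_one]

/-- The universal reflective pair. -/
lemma isReflectivePair : IsReflectivePair (iota k H A) (toConv (kappa k H A)) := by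
  refine IsReflectivePair.of_injective lmulHom_injective ?_
  rw [lmulHom_comp_iota, convPush_lmulHom_kappa]
  exact isReflectivePair_smash k H A

/-- The universal property of the reflective algebra: a reflective pair with values in `R` extends
to the algebra map `g # a ↦ κ(g) ι(a)`. -/
def lift {R : Type*} [Ring R] [Algebra k R] {ι : A →ₐ[k] R} {κ : WithConv (H →ₗ[k] R)}
    (h : IsReflectivePair ι κ) : ReflectiveAlgebra k H A →ₐ[k] R :=
  AlgHom.ofLinearMap (pairLift ι κ ∘ₗ (equiv k H A).symm.toLinearMap)
    (by
      rw [← equiv_one]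
      simp [h.map_one])
    (fun p q => by
      obtain ⟨p, rfl⟩ := (equiv k H A).surjective p
      obtain ⟨q, rfl⟩ := (equiv k H A).surjective q
      induction p using TensorProduct.induction_on with
      | zero => simp
      | add x y hx hy => simp only [map_add, add_mul, hx, hy]
      | tmul g a =>
        induction q using TensorProduct.induction_on with
        | zero => simp
        | add x y hx hy => simp only [map_add, mul_add, hx, hy]
        | tmul b y =>
          rw [equiv_mul]
          exact h.pairLift_mul _ _ _ _)

lemma lift_equiv {R : Type*} [Ring R] [Algebra k R] {ι : A →ₐ[k] R} {κ : WithConv (H →ₗ[k] R)}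
    (h : IsReflectivePair ι κ) (g : H) (x : A) :
    lift h (equiv k H A (g ⊗ₜ x)) = κ g * ι x := rfl

end ReflectiveAlgebra

end SmashProduct

/-! ### The module algebra structure of the reflective algebra -/

section ModuleAlgebra

open Coalgebra TensorProduct WithConv CoquasitriangularStructure RightModuleAlgebra

variable {k H A : Type u} [Field k] [Ring H] [HopfAlgebra k H]
variable [CoquasitriangularStructure k H] [Ring A] [Algebra k A] [RightModuleAlgebra k H A]
variable {R : Type u} [Ring R] [Algebra k R]

/-- `κ(g ↼ h) = r(h₍₁₎ ⊗ g₍₁₎) κ(g₍₂₎) r(g₍₃₎ ⊗ h₍₂₎)`, as a convolution product. -/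
lemma map_centralHit (κ : H →ₗ[k] R) : toConv (κ ∘ₗ TensorProduct.lift (centralHit k H)) =
    rFlip k H R * slot₁ H (toConv κ) * rConv k H R := by
  refine conv_ext_tmul fun g h => ?_
  have h₁ : ∀ g h : H, κ (((TensorProduct.lid k H).toLinearMap ∘ₗ r.rTensor H ∘ₗ
        (TensorProduct.assoc k H H H).symm.toLinearMap ∘ₗ
          (comul (R := k) (A := H)).lTensor H ∘ₗ (TensorProduct.comm k H H).toLinearMap)
            (g ⊗ₜ h)) = (rFlip k H R * slot₁ H (toConv κ)) (g ⊗ₜ h) := by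
    intro g h
    rw [mul_slot₁_apply _ _ (ℛ k g)]
    simp only [LinearMap.comp_apply, LinearEquiv.coe_coe, TensorProduct.comm_tmul,
      LinearMap.lTensor_tmul]
    rw [← (ℛ k g).eq]
    simp [TensorProduct.tmul_sum, rFlip_apply, Algebra.algebraMap_eq_smul_one]
  rw [convMul_tmul_apply _ _ (ℛ k g) (ℛ k h)]
  simp only [LinearMap.comp_apply, TensorProduct.lift.tmul, centralHit, TensorProduct.curry_apply]
  rw [comul_tmul_repr (ℛ k g) (ℛ k h)]
  simp only [map_sum, LinearMap.lTensor_tmul, LinearEquiv.coe_coe, TensorProduct.rid_tmul, map_smul]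
  refine Finset.sum_congr rfl fun i _ => Finset.sum_congr rfl fun j _ => ?_
  rw [← h₁, rConv_apply, ← Algebra.commutes, ← Algebra.smul_def]
  rfl

/-- `κ(g ↼ h)` as a convolution product in `g`, with `h` fixed. -/
lemma centralHit_repr {ι : Type*} (κ : H →ₗ[k] R) {h : H} (𝓗 : Coalgebra.Repr k h ι) :
    toConv (κ ∘ₗ (centralHit k H).flip h) = ∑ j ∈ 𝓗.index,
      convScalar R (rLeft k H (𝓗.left j)) * toConv κ *
        convScalar R (rRight k H (𝓗.right j)) := by
  ext g
  refine (congrArg (fun φ => φ.ofConv (g ⊗ₜ h)) (map_centralHit κ)).trans ?_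
  rw [convMul_tmul_apply _ _ (ℛ k g) 𝓗, WithConv.ofConv_sum, LinearMap.sum_apply, Finset.sum_comm]
  refine Finset.sum_congr rfl fun j _ => ?_
  rw [(ℛ k g).convMul_apply]
  refine Finset.sum_congr rfl fun i _ => ?_
  rw [mul_slot₁_apply _ _ (ℛ k _), (ℛ k _).convMul_apply]
  rfl

/-- A representation of the coproduct of a product. -/
def reprMul {ι κ : Type*} {g h : H} (𝓖 : Coalgebra.Repr k g ι) (𝓗 : Coalgebra.Repr k h κ) :
    Coalgebra.Repr k (g * h) (ι × κ) where
  index := 𝓖.index ×ˢ 𝓗.index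
  left i := 𝓖.left i.1 * 𝓗.left i.2
  right i := 𝓖.right i.1 * 𝓗.right i.2
  eq := by
    rw [Bialgebra.comul_mul, ← 𝓖.eq, ← 𝓗.eq, Finset.sum_mul_sum, Finset.sum_product]
    simp

lemma centralHit_one_right (g : H) : centralHit k H g 1 = g := by
  have h₁ : rLeft k H 1 = 1 := by ext h; exact r_one_left h
  have h₂ : rRight k H 1 = 1 := by ext h; exact r_one_right h
  have := congrArg (fun φ => φ.ofConv g) (centralHit_repr (k := k) LinearMap.id
    (⟨{()}, fun _ => (1 : H), fun _ => (1 : H), by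
      simp [Algebra.TensorProduct.one_def]⟩ : Coalgebra.Repr k (1 : H) Unit))
  simpa [h₁, h₂] using this

lemma centralHit_mul_right (g h l : H) :
    centralHit k H g (h * l) = centralHit k H (centralHit k H g h) l := by
  have e₁ := centralHit_repr (k := k) LinearMap.id (reprMul (ℛ k h) (ℛ k l))
  have e₂ := centralHit_repr (k := k) ((centralHit k H).flip l) (ℛ k h)
  have e₃ := centralHit_repr (k := k) LinearMap.id (ℛ k l)
  have e : toConv ((centralHit k H).flip (h * l)) =
      toConv ((centralHit k H).flip l ∘ₗ (centralHit k H).flip h) := by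
    refine Eq.trans e₁ (Eq.trans ?_ e₂.symm)
    rw [LinearMap.id_comp] at e₃
    simp only [e₃, reprMul, Finset.sum_product, Finset.mul_sum, Finset.sum_mul]
    refine Finset.sum_congr rfl fun i _ => Finset.sum_congr rfl fun j _ => ?_
    rw [rLeft_mul, rRight_mul, map_mul, map_mul]
    simp only [mul_assoc]
  exact congrArg (fun φ => φ.ofConv g) e

lemma centralHit_one_left (h : H) : centralHit k H 1 h = counit (R := k) h • (1 : H) := by
  have := congrArg (fun φ => φ.ofConv (1 ⊗ₜ h)) (map_centralHit (k := k) (H := H) LinearMap.id)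
  refine Eq.trans this ?_
  rw [convMul_tmul_apply _ _ (⟨{()}, fun _ => (1 : H), fun _ => (1 : H), by
      simp [Algebra.TensorProduct.one_def]⟩ : Coalgebra.Repr k (1 : H) Unit) (ℛ k h)]
  conv_rhs => rw [← sum_counit_smul (ℛ k h)]
  simp only [mul_slot₁_apply _ _ (⟨{()}, fun _ => (1 : H), fun _ => (1 : H), by
      simp [Algebra.TensorProduct.one_def]⟩ : Coalgebra.Repr k (1 : H) Unit)]
  simp [rFlip_apply, rConv_apply, r_one_left, r_one_right, Algebra.algebraMap_eq_smul_one,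
    Finset.sum_smul, smul_smul, mul_comm]

/-- The action of a module algebra as an algebra map to the convolution algebra. -/
def actConvHom (ι : A →ₐ[k] R) : A →ₐ[k] WithConv (H →ₗ[k] R) :=
  AlgHom.ofLinearMap
    { toFun := actConv ι
      map_add' := fun a b => by ext h; simp
      map_smul' := fun c a => by ext h; simp }
    (by ext h; simp [one_act, Algebra.algebraMap_eq_smul_one])
    (fun a b => by
      ext h
      rw [(ℛ k h).convMul_apply]
      simp only [LinearMap.coe_mk, AddHom.coe_mk, actConv_apply, mul_act]
      rw [← (ℛ k h).eq]
      simp)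

@[simp] lemma actConvHom_apply (ι : A →ₐ[k] R) (a : A) :
    actConvHom (H := H) ι a = actConv ι a := rfl

/-- Constant families, `b ↦ (h ↦ ε(h) b)`. -/
def convConst (k H R : Type u) [Field k] [Ring H] [HopfAlgebra k H] [Ring R] [Algebra k R] :
    R →ₐ[k] WithConv (H →ₗ[k] R) :=
  AlgHom.ofLinearMap
    { toFun := fun b => toConv ((counit (R := k) (A := H)).smulRight b)
      map_add' := fun a b => by ext h; simp
      map_smul' := fun c a => by ext h; simp [smul_smul, mul_comm] }
    (by ext h; simp [Algebra.algebraMap_eq_smul_one])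
    (fun a b => by
      ext h
      rw [(ℛ k h).convMul_apply]
      conv_lhs => rw [← sum_counit_smul (ℛ k h)]
      simp [smul_smul, mul_comm])

@[simp] lemma convConst_apply_apply (b : R) (h : H) :
    convConst k H R b h = counit (R := k) h • b := rfl

/-- Scalar families commute with constant families. -/
lemma convScalar_mul_convConst (φ : WithConv (H →ₗ[k] k)) (b : R) :
    convScalar R φ * convConst k H R b = convConst k H R b * convScalar R φ := by
  ext h
  rw [(ℛ k h).convMul_apply, (ℛ k h).convMul_apply]
  trans φ h • b
  · conv_rhs => rw [← sum_counit_right_smul (ℛ k h)]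
    simp [convScalar_apply, Algebra.algebraMap_eq_smul_one, Finset.sum_smul, smul_smul, mul_comm]
  · conv_lhs => rw [← sum_counit_smul (ℛ k h)]
    simp [convScalar_apply, Algebra.algebraMap_eq_smul_one, Finset.sum_smul, smul_smul, mul_comm]

variable (k H R) in
/-- `g ↦ r(g ⊗ -)` with values in scalars. -/
def rLeftConv : WithConv (H →ₗ[k] WithConv (H →ₗ[k] R)) := convCurry k H H R (rConv k H R)

variable (k H R) in
/-- `g ↦ r(- ⊗ g)` with values in scalars. -/
def rRightConv : WithConv (H →ₗ[k] WithConv (H →ₗ[k] R)) := convCurry k H H R (rFlip k H R)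

lemma rLeftConv_apply (g : H) : rLeftConv k H R g = convScalar R (rLeft k H g) := rfl

lemma rRightConv_apply (g : H) : rRightConv k H R g = convScalar R (rRight k H g) := rfl

/-- The family `g ↦ (h ↦ κ(g ↼ h))`. -/
def hitConv (κ : WithConv (H →ₗ[k] R)) : WithConv (H →ₗ[k] WithConv (H →ₗ[k] R)) :=
  convCurry k H H R (toConv (κ.ofConv ∘ₗ TensorProduct.lift (centralHit k H)))

lemma hitConv_apply_apply (κ : WithConv (H →ₗ[k] R)) (g h : H) :
    hitConv κ g h = κ (centralHit k H g h) := rfl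

/-- The family `h ↦ κ(g ↼ h)` is a constant family, multiplied by `r` on both sides. -/
lemma hitConv_eq (κ : WithConv (H →ₗ[k] R)) : hitConv κ =
    rRightConv k H R * convPush H (convConst k H R) κ * rLeftConv k H R := by
  rw [hitConv, map_centralHit, map_mul, map_mul, rLeftConv, rRightConv]
  congr 2
  ext g h
  simp

/-- The Yang-Baxter equation for `r`. -/
lemma yang_baxter_repr {ι κ : Type*} {g h : H} (𝓖 : Coalgebra.Repr k g ι)
    (𝓗 : Coalgebra.Repr k h κ) :
    ∑ j ∈ 𝓗.index, ∑ i ∈ 𝓖.index, r (𝓗.right j ⊗ₜ[k] 𝓖.left i) •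
        (rLeft k H (𝓗.left j) * rRight k H (𝓖.right i)) =
      ∑ j ∈ 𝓗.index, ∑ i ∈ 𝓖.index, r (𝓗.left j ⊗ₜ[k] 𝓖.right i) •
        (rRight k H (𝓖.left i) * rLeft k H (𝓗.right j)) := by
  -- The commutation rule of `r`, applied to `r(h | -)`.
  have e : mulPull (rLeft k H h) = ∑ j ∈ 𝓗.index,
      slot₂ H (rLeft k H (𝓗.left j)) * slot₁ H (rLeft k H (𝓗.right j)) := by
    refine conv_ext_tmul fun l g => ?_
    rw [WithConv.ofConv_sum, LinearMap.sum_apply]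
    simp only [slot₂_mul_slot₁_apply, mulPull_apply_tmul, rLeft_apply_apply, r_mul_right]
    rw [← 𝓗.eq]
    simp
  have h₁ := rConv_mul_mulPull (rLeft k H h)
  rw [e] at h₁
  ext l
  have h₂ := congrArg (fun φ => φ.ofConv (l ⊗ₜ g)) h₁
  simp only [Finset.mul_sum, Finset.sum_mul, map_sum, map_mul, convFlip_slot₁, convFlip_slot₂,
    WithConv.ofConv_sum, LinearMap.sum_apply] at h₂ ⊢
  refine Eq.trans (Finset.sum_congr rfl fun j _ => ?_)
    (h₂.symm.trans (Finset.sum_congr rfl fun j _ => ?_))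
  · rw [mul_assoc, slot₁_mul_apply _ _ (ℛ k l)]
    simp_rw [slot₂_mul_apply _ _ _ 𝓖, Finset.mul_sum]
    rw [Finset.sum_comm]
    refine Finset.sum_congr rfl fun i _ => ?_
    rw [WithConv.ofConv_smul, LinearMap.smul_apply, (ℛ k l).convMul_apply, Finset.smul_sum]
    refine Finset.sum_congr rfl fun x _ => ?_
    simp only [rLeft_apply_apply, rRight_apply_apply, rConv_apply, Algebra.algebraMap_self_apply,
      smul_eq_mul]
    ring
  · rw [← mul_assoc, mul_slot₁_apply _ _ (ℛ k l)]
    simp_rw [mul_slot₂_apply _ _ _ 𝓖, Finset.sum_mul]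
    rw [Finset.sum_comm]
    refine Finset.sum_congr rfl fun i _ => ?_
    rw [WithConv.ofConv_smul, LinearMap.smul_apply, (ℛ k l).convMul_apply, Finset.smul_sum]
    refine Finset.sum_congr rfl fun x _ => ?_
    simp only [rLeft_apply_apply, rRight_apply_apply, rConv_apply, Algebra.algebraMap_self_apply,
      smul_eq_mul]
    ring

/-- The exchange relation of `rLeftConv` and `rRightConv`, a form of the Yang-Baxter equation. -/
lemma rLeftConv_rFlip_rRightConv :
    slot₂ H (rLeftConv k H R) * rFlip k H _ * slot₁ H (rRightConv k H R) =
      slot₁ H (rRightConv k H R) * rFlip k H _ * slot₂ H (rLeftConv k H R) := by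
  refine conv_ext_tmul fun g h => ?_
  have key := congrArg (convScalar R) (yang_baxter_repr (ℛ k g) (ℛ k h))
  have hs (c : k) (φ : WithConv (H →ₗ[k] k)) : convScalar R (c • φ) = c • convScalar R φ := by
    ext l
    simp [convScalar_apply, Algebra.algebraMap_eq_smul_one, smul_smul]
  simp only [map_sum, map_mul, hs] at key
  refine Eq.trans ?_ (key.trans ?_)
  · rw [mul_assoc, slot₂_mul_apply _ _ _ (ℛ k h)]
    simp_rw [mul_slot₁_apply _ _ (ℛ k g), Finset.mul_sum, rFlip_apply, rLeftConv_apply,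
      rRightConv_apply, Algebra.algebraMap_eq_smul_one, smul_mul_assoc, one_mul, mul_smul_comm]
  · rw [mul_assoc, slot₁_mul_apply _ _ (ℛ k g), Finset.sum_comm]
    simp_rw [mul_slot₂_apply _ _ _ (ℛ k h), Finset.mul_sum, rFlip_apply, rLeftConv_apply,
      rRightConv_apply, Algebra.algebraMap_eq_smul_one, smul_mul_assoc, one_mul, mul_smul_comm]

/-- If `κ` solves the reflection equation, so does `g ↦ (h ↦ κ(g ↼ h))`, with values in the
convolution algebra: the outer factors of `hitConv_eq` pass each other by the Yang-Baxter
equation. -/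
lemma hitConv_reflection {κ : WithConv (H →ₗ[k] R)}
    (hκ : mulPull κ * rFlip k H R = slot₂ H κ * rFlip k H R * slot₁ H κ) :
    mulPull (hitConv κ) * rFlip k H _ =
      slot₂ H (hitConv κ) * rFlip k H _ * slot₁ H (hitConv κ) := by
  have hl : mulPull (rLeftConv k H R) = slot₁ H (rLeftConv k H R) * slot₂ H (rLeftConv k H R) :=
    mulPull_of_map_mul fun g h => by simp only [rLeftConv_apply, rLeft_mul, map_mul]
  have hr : mulPull (rRightConv k H R) = slot₂ H (rRightConv k H R) * slot₁ H (rRightConv k H R) :=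
    mulPull_of_map_mul_rev fun g h => by simp only [rRightConv_apply, rRight_mul, map_mul]
  have hl' := rFlip_mul_flip_mulPull (rLeftConv k H R)
  rw [hl, map_mul, convFlip_slot₁, convFlip_slot₂] at hl'
  have hc : slot₁ H (rRightConv k H R) * slot₂ H (convPush H (convConst k H R) κ) =
      slot₂ H (convPush H (convConst k H R) κ) * slot₁ H (rRightConv k H R) :=
    slot₁_slot₂_comm fun g h => by
      rw [rRightConv_apply, convPush_apply, convScalar_mul_convConst]
  have hc' : slot₁ H (convPush H (convConst k H R) κ) * slot₂ H (rLeftConv k H R) =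
      slot₂ H (rLeftConv k H R) * slot₁ H (convPush H (convConst k H R) κ) :=
    slot₁_slot₂_comm fun g h => by
      rw [rLeftConv_apply, convPush_apply, convScalar_mul_convConst]
  have hK := convPush_reflection (convConst k H R) hκ
  have hy := rLeftConv_rFlip_rRightConv (k := k) (H := H) (R := R)
  rw [hitConv_eq]
  generalize convPush H (convConst k H R) κ = X at *
  generalize rRightConv k H R = Y at *
  generalize rLeftConv k H R = Z at *
  generalize rFlip k H (WithConv (H →ₗ[k] R)) = F at *
  simp only [map_mul, hl, hr]
  calc slot₂ H Y * slot₁ H Y * mulPull X * (slot₁ H Z * slot₂ H Z) * F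
      = slot₂ H Y * slot₁ H Y * mulPull X * (slot₁ H Z * slot₂ H Z * F) := by
        simp only [mul_assoc]
    _ = slot₂ H Y * slot₁ H Y * (mulPull X * F) * (slot₂ H Z * slot₁ H Z) := by
        rw [← hl']; simp only [mul_assoc]
    _ = slot₂ H Y * (slot₁ H Y * slot₂ H X) * F * (slot₁ H X * slot₂ H Z) * slot₁ H Z := by
        rw [hK]; simp only [mul_assoc]
    _ = slot₂ H Y * slot₂ H X * (slot₁ H Y * F * slot₂ H Z) * slot₁ H X * slot₁ H Z := by
        rw [hc, hc']; simp only [mul_assoc]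
    _ = _ := by rw [← hy]; simp only [mul_assoc]

/-- The pair of `a ↦ (h ↦ ι(a.h))` and `g ↦ (h ↦ κ(g ↼ h))`, with values in the convolution
algebra, is again reflective. The algebra map it induces is the action of `H` on the reflective
algebra. -/
lemma IsReflectivePair.hit {ι : A →ₐ[k] R} {κ : WithConv (H →ₗ[k] R)}
    (hp : IsReflectivePair ι κ) : IsReflectivePair (actConvHom ι) (hitConv κ) where
  map_one := by
    ext h
    rw [hitConv_apply_apply, centralHit_one_left, map_smul, hp.map_one]
    simp [Algebra.algebraMap_eq_smul_one]
  comm a := by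
    have e : actConv (actConvHom ι) a = convCurry k H H R (mulPull (actConv ι a)) := by
      ext g h
      simp [act_mul]
    have hc : slot₁ H κ * convFlip k H H R (mulPull (actConv ι a)) =
        convFlip k H H R (mulPull (actConv ι a)) * slot₁ H κ := by
      refine conv_ext_tmul fun g h => ?_
      have := congrArg (fun φ => φ.ofConv g) (hp.comm (act (k := k) a h))
      rw [(ℛ k g).convMul_apply, (ℛ k g).convMul_apply] at this
      rw [slot₁_mul_apply _ _ (ℛ k g), mul_slot₁_apply _ _ (ℛ k g)]
      simpa [act_mul] using this
    rw [e, hitConv, map_centralHit, ← map_mul, ← map_mul]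
    congr 1
    change rFlip k H R * slot₁ H κ * rConv k H R * _ = _ * (rFlip k H R * slot₁ H κ * rConv k H R)
    rw [mul_assoc, rConv_mul_mulPull, mul_assoc, ← mul_assoc (slot₁ H κ), hc, ← mul_assoc,
      ← mul_assoc, rFlip_mul_flip_mulPull]
    simp only [mul_assoc]
  reflection := hitConv_reflection hp.reflection

namespace ReflectiveAlgebra

variable (k H A) in
/-- `(g # x).h = g ↼ h₍₁₎ # x.h₍₂₎`. -/
def actLin : ReflectiveAlgebra k H A →ₗ[k] H →ₗ[k] ReflectiveAlgebra k H A :=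
  (WithConv.linearEquiv k _).toLinearMap ∘ₗ
    (lift (isReflectivePair (k := k) (H := H) (A := A)).hit).toLinearMap

lemma actLin_equiv (g h : H) (x : A) : actLin k H A (equiv k H A (g ⊗ₜ x)) h =
    equiv k H A (TensorProduct.map (centralHit k H g) (act x) (comul (R := k) h)) := by
  have : actLin k H A (equiv k H A (g ⊗ₜ x)) h =
    (hitConv (toConv (kappa k H A)) g * actConv (iota k H A) x :
      WithConv (H →ₗ[k] ReflectiveAlgebra k H A)) h := rfl
  rw [this, (ℛ k h).convMul_apply, ← (ℛ k h).eq]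
  simp only [hitConv_apply_apply, actConv_apply, kappa_mul_iota]
  simp

instance : RightModuleAlgebra k H (ReflectiveAlgebra k H A) where
  act := actLin k H A
  act_unit p := by
    obtain ⟨p, rfl⟩ := (equiv k H A).surjective p
    induction p using TensorProduct.induction_on with
    | zero => simp
    | add x y hx hy => simp only [map_add, LinearMap.add_apply, hx, hy]
    | tmul g a =>
      rw [actLin_equiv]
      simp [Algebra.TensorProduct.one_def, centralHit_one_right, act_unit]
  act_mul p h l := by
    obtain ⟨p, rfl⟩ := (equiv k H A).surjective p
    induction p using TensorProduct.induction_on with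
    | zero => simp
    | add x y hx hy => simp only [map_add, LinearMap.add_apply, hx, hy]
    | tmul g a =>
      rw [actLin_equiv, actLin_equiv, ← (reprMul (ℛ k h) (ℛ k l)).eq]
      conv_rhs => rw [← (ℛ k h).eq]
      simp only [map_sum, TensorProduct.map_tmul, LinearMap.sum_apply, actLin_equiv]
      conv_rhs => rw [← (ℛ k l).eq]
      simp [reprMul, Finset.sum_product, centralHit_mul_right, act_mul]
  one_act h := by
    have := congrArg (fun φ => φ.ofConv h)
      (map_one (lift (isReflectivePair (k := k) (H := H) (A := A)).hit))
    refine Eq.trans this ?_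
    simp [Algebra.algebraMap_eq_smul_one]
  mul_act p q h := congrArg (fun φ => φ.ofConv h)
    (map_mul (lift (isReflectivePair (k := k) (H := H) (A := A)).hit) p q)

lemma act_equiv (g h : H) (x : A) : act (k := k) (equiv k H A (g ⊗ₜ x)) h =
    equiv k H A (TensorProduct.map (centralHit k H g) (act x) (comul (R := k) h)) :=
  actLin_equiv g h x

lemma act_iota (x : A) (h : H) : act (k := k) (iota k H A x) h = iota k H A (act (k := k) x h) := by
  rw [iota_apply, act_equiv, iota_apply, ← (ℛ k h).eq]
  conv_rhs => rw [← sum_counit_smul (ℛ k h)]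
  simp [centralHit_one_left, TensorProduct.smul_tmul, TensorProduct.tmul_sum]

lemma act_kappa (g h : H) :
    act (k := k) (kappa k H A g) h = kappa k H A (centralHit k H g h) := by
  rw [kappa_apply, act_equiv, kappa_apply, ← (ℛ k h).eq]
  conv_rhs => rw [← sum_counit_right_smul (ℛ k h)]
  simp [one_act, TensorProduct.smul_tmul', TensorProduct.sum_tmul]

end ReflectiveAlgebra

end ModuleAlgebra

/-! ### The reflective structure of the reflective algebra -/

section ReflectiveStructure

open Coalgebra TensorProduct WithConv CoquasitriangularStructure RightModuleAlgebra

variable {k H A : Type u} [Field k] [Ring H] [HopfAlgebra k H]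
variable [CoquasitriangularStructure k H] [Ring A] [Algebra k A] [RightModuleAlgebra k H A]
variable {R : Type u} [Ring R] [Algebra k R]

/-- A solution `κ` of the reflection equation commutes with the family `h ↦ κ(g ↼ h)`. -/
lemma mul_hitConv_comm {κ : WithConv (H →ₗ[k] R)}
    (hκ : mulPull κ * rFlip k H R = slot₂ H κ * rFlip k H R * slot₁ H κ) (g : H) :
    κ * hitConv κ g = hitConv κ g * κ := by
  have hκ' := congrArg (convFlip k H H R) hκ
  simp only [map_mul, convFlip_slot₁, convFlip_slot₂, convFlip_rFlip] at hκ'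
  have e : slot₂ H κ * (rFlip k H R * slot₁ H κ * rConv k H R) =
      rFlip k H R * slot₁ H κ * rConv k H R * slot₂ H κ := by
    rw [← mul_assoc, ← mul_assoc, ← hκ, mul_assoc (rFlip k H R), mul_assoc (rFlip k H R), ← hκ',
      ← mul_assoc (rFlip k H R), rFlip_mul_flip_mulPull]
  rw [← map_centralHit] at e
  ext h
  have := congrArg (fun φ => φ.ofConv (g ⊗ₜ h)) e
  rw [slot₂_mul_apply _ _ _ (ℛ k h), mul_slot₂_apply _ _ _ (ℛ k h)] at this
  rw [(ℛ k h).convMul_apply, (ℛ k h).convMul_apply]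
  exact this

/-- Elements whose families `h ↦ b.h` commute with `κ` are closed under products. -/
lemma mul_actConv_id [RightModuleAlgebra k H R] {κ : WithConv (H →ₗ[k] R)} {a b : R}
    (ha : κ * actConv (AlgHom.id k R) a = actConv (AlgHom.id k R) a * κ)
    (hb : κ * actConv (AlgHom.id k R) b = actConv (AlgHom.id k R) b * κ) :
    κ * actConv (AlgHom.id k R) (a * b) = actConv (AlgHom.id k R) (a * b) * κ := by
  have e : actConv (AlgHom.id k R) (a * b) =
      actConv (H := H) (AlgHom.id k R) a * actConv (AlgHom.id k R) b :=
    map_mul (actConvHom (AlgHom.id k R)) a b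
  rw [e, ← mul_assoc, ha, mul_assoc, hb, mul_assoc]

/-- The product formula for a reflective structure, from the reflection equation. -/
lemma map_mul_of_reflection {κ : H →ₗ[k] R}
    (hκ : mulPull (toConv κ) * rFlip k H R =
      slot₂ H (toConv κ) * rFlip k H R * slot₁ H (toConv κ)) :
    κ ∘ₗ LinearMap.mul' k H =
    (LinearMap.mul' k R ∘ₗ TensorProduct.map κ κ ∘ₗ contractMid r ∘ₗ
        TensorProduct.map (comul (R := k) (A := H)) (comul (R := k) (A := H)) ∘ₗ
          (TensorProduct.comm k H H).toLinearMap) ∘ₗ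
      ((TensorProduct.rid k (H ⊗[k] H)).toLinearMap ∘ₗ
        (rInv ∘ₗ (TensorProduct.comm k H H).toLinearMap).lTensor (H ⊗[k] H) ∘ₗ
          comul (R := k) (A := H ⊗[k] H)) := by
  have e : mulPull (toConv κ) = slot₂ H (toConv κ) * (rFlip k H R * slot₁ H (toConv κ)) *
      rFlipInv k H R := by
    rw [← mul_assoc, ← hκ, mul_assoc, rFlip_mul_rFlipInv, mul_one]
  refine TensorProduct.ext' fun g h => ?_
  refine (congrArg (fun φ => φ.ofConv (g ⊗ₜ h)) e).trans ?_
  rw [convMul_tmul_apply _ _ (ℛ k g) (ℛ k h)]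
  simp only [LinearMap.comp_apply]
  rw [comul_tmul_repr (ℛ k g) (ℛ k h)]
  simp only [map_sum, LinearMap.lTensor_tmul, LinearEquiv.coe_coe, TensorProduct.rid_tmul, map_smul,
    TensorProduct.comm_tmul, LinearMap.comp_apply]
  refine Finset.sum_congr rfl fun i _ => Finset.sum_congr rfl fun j _ => ?_
  rw [contractMid_repr _ (ℛ k _) (ℛ k _), slot₂_mul_apply _ _ _ (ℛ k _)]
  simp_rw [mul_slot₁_apply _ _ (ℛ k _)]
  have h₁ : rFlipInv k H R ((ℛ k g).right i ⊗ₜ (ℛ k h).right j) =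
    algebraMap k R (rInv ((ℛ k h).right j ⊗ₜ[k] (ℛ k g).right i)) := rfl
  rw [h₁, ← Algebra.commutes, ← Algebra.smul_def]
  congr 1
  simp only [map_sum, map_smul, TensorProduct.map_tmul, LinearMap.mul'_apply, Finset.mul_sum]
  rw [Finset.sum_comm]
  simp [rFlip_apply, Algebra.algebraMap_eq_smul_one]

namespace ReflectiveAlgebra

/-- The reflective structure `h ↦ h # 1` is convolution invertible. -/
lemma exists_kappa_inv : ∃ K' : WithConv (H →ₗ[k] ReflectiveAlgebra k H A),
    toConv (kappa k H A) * K' = 1 ∧ K' * toConv (kappa k H A) = 1 := by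
  obtain ⟨ψ, hψ₁, hψ₂⟩ := exists_transMul_inv (k := k) (H := H)
  let Ψ := convPush H (Module.End.rTensorAlgHom k H A) ψ
  have h₁ : Ψ * smashKappa k H A = 1 := by rw [smashKappa, ← map_mul, hψ₁, map_one]
  have h₂ : smashKappa k H A * Ψ = 1 := by rw [smashKappa, ← map_mul, hψ₂, map_one]
  -- The operator inverse, applied to the unit, is a right inverse; it is two-sided since left
  -- multiplication is faithful and the operator inverse is two-sided.
  let K' : WithConv (H →ₗ[k] ReflectiveAlgebra k H A) :=
    toConv ((equiv k H A).toLinearMap ∘ₗ LinearMap.applyₗ (1 ⊗ₜ 1) ∘ₗ Ψ.ofConv)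
  have hK : toConv (kappa k H A) * K' = 1 := by
    ext h
    have := congrArg (fun φ => equiv k H A (φ.ofConv h (1 ⊗ₜ 1))) h₂
    rw [(ℛ k h).convMul_apply, LinearMap.sum_apply, map_sum] at this
    rw [(ℛ k h).convMul_apply]
    refine Eq.trans (Finset.sum_congr rfl fun i _ => ?_) (this.trans ?_)
    · rw [← convPush_lmulHom_kappa]
      rfl
    · rw [LinearMap.convOne_apply, LinearMap.convOne_apply, Algebra.algebraMap_eq_smul_one,
        Algebra.algebraMap_eq_smul_one, LinearMap.smul_apply, map_smul]
      rfl
  refine ⟨K', hK, convPush_injective lmulHom_injective ?_⟩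
  have hK₂ := congrArg (convPush H (lmulHom k H A)) hK
  rw [map_mul, map_one, convPush_lmulHom_kappa] at hK₂
  rw [map_mul, map_one, convPush_lmulHom_kappa, ← left_inv_eq_right_inv h₁ hK₂, h₁]

/-- `K(h₍₁₎) (b.h₍₂₎) = (b.h₍₁₎) K(h₍₂₎)` for all `b`. Both sides are multiplicative in `b`, so it
is enough to treat `b = K(g)`, the reflection equation, and `b` in `A`, a defining relation. -/
lemma kappa_mul_actConv (b : ReflectiveAlgebra k H A) :
    toConv (kappa k H A) * actConv (AlgHom.id k _) b =
      actConv (AlgHom.id k _) b * toConv (kappa k H A) := by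
  obtain ⟨b, rfl⟩ := (equiv k H A).surjective b
  induction b using TensorProduct.induction_on with
  | zero =>
    rw [map_zero, ← actConvHom_apply, map_zero, zero_mul, mul_zero]
  | add x y hx hy =>
    simp only [← actConvHom_apply] at hx hy ⊢
    rw [map_add, map_add, mul_add, hx, hy, add_mul]
  | tmul g x =>
    rw [← kappa_mul_iota]
    refine mul_actConv_id ?_ ?_
    · have : actConv (AlgHom.id k _) (kappa k H A g) = hitConv (toConv (kappa k H A)) g := by
        ext h
        exact act_kappa g h
      rw [this, mul_hitConv_comm isReflectivePair.reflection]
    · have : actConv (H := H) (AlgHom.id k _) (iota k H A x) = actConv (iota k H A) x := by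
        ext h
        exact act_iota x h
      rw [this, isReflectivePair.comm]

lemma isReflectiveStructure : IsReflectiveStructure (kappa k H A) where
  exists_inv := by
    obtain ⟨K', h₁, h₂⟩ := exists_kappa_inv (k := k) (H := H) (A := A)
    exact ⟨K'.ofConv, congrArg WithConv.ofConv h₁, congrArg WithConv.ofConv h₂⟩
  comm b h := congrArg (fun φ => φ.ofConv h) (kappa_mul_actConv b)
  map_mul := map_mul_of_reflection isReflectivePair.reflection
  act_map g h := act_kappa g h

end ReflectiveAlgebra

end ReflectiveStructure

/-! ### Operators of functionals on tensor products of comodules -/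

section CoactionOperators

open Coalgebra TensorProduct WithConv CoquasitriangularStructure

variable {k : Type u} [Field k] {V W C D M : Type u}
variable [AddCommGroup V] [Module k V] [AddCommGroup W] [Module k W]
variable [AddCommGroup C] [Module k C] [Coalgebra k C]
variable [AddCommGroup D] [Module k D] [Coalgebra k D]
variable [AddCommGroup M] [Module k M]

lemma coactOp_tmul_repr {ρ : V →ₗ[k] V ⊗[k] C} (φ : C →ₗ[k] Module.End k M) {v : V} (m : M)
    {S : Finset (V × C)} (hS : ρ v = ∑ p ∈ S, p.1 ⊗ₜ[k] p.2) :
    coactOp ρ φ (v ⊗ₜ m) = ∑ p ∈ S, p.1 ⊗ₜ[k] φ p.2 m := by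
  rw [coactOp_tmul', hS]
  simp

lemma sum_counit_smul_of_isCoaction {ρ : V →ₗ[k] V ⊗[k] C} (hρ : IsCoaction ρ) {v : V}
    {S : Finset (V × C)} (hS : ρ v = ∑ p ∈ S, p.1 ⊗ₜ[k] p.2) :
    ∑ p ∈ S, counit (R := k) p.2 • p.1 = v := by
  have := hρ.counitApply v
  rw [hS] at this
  simpa using this

/-- On `(V ⊗ W) ⊗ M` a functional of two variables acts by
`v ⊗ w ⊗ m ↦ v₍₀₎ ⊗ w₍₀₎ ⊗ φ(v₍₁₎ ⊗ w₍₁₎) m`. -/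
lemma coactOp_tensorCoact_repr {ρ : V →ₗ[k] V ⊗[k] C} {ρ' : W →ₗ[k] W ⊗[k] D}
    (φ : C ⊗[k] D →ₗ[k] Module.End k M) {v : V} {w : W} (m : M)
    {S : Finset (V × C)} (hS : ρ v = ∑ p ∈ S, p.1 ⊗ₜ[k] p.2)
    {T : Finset (W × D)} (hT : ρ' w = ∑ q ∈ T, q.1 ⊗ₜ[k] q.2) :
    coactOp (tensorCoact ρ ρ') φ ((v ⊗ₜ w) ⊗ₜ m) =
      ∑ p ∈ S, ∑ q ∈ T, (p.1 ⊗ₜ[k] q.1) ⊗ₜ[k] φ (p.2 ⊗ₜ q.2) m := by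
  rw [coactOp_tmul', tensorCoact, LinearMap.comp_apply, TensorProduct.map_tmul, hS, hT]
  simp only [TensorProduct.sum_tmul, TensorProduct.tmul_sum, map_sum, LinearEquiv.coe_coe,
    TensorProduct.tensorTensorTensorComm_tmul, LinearMap.lTensor_tmul, LinearMap.flip_apply]
  exact Finset.sum_comm

/-- A functional in the second slot acts through `W` alone. -/
lemma coactOp_slot₂ {ρ : V →ₗ[k] V ⊗[k] C} (hρ : IsCoaction ρ) (ρ' : W →ₗ[k] W ⊗[k] D)
    (φ : WithConv (D →ₗ[k] Module.End k M)) (v : V) {w : W} (m : M)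
    {T : Finset (W × D)} (hT : ρ' w = ∑ q ∈ T, q.1 ⊗ₜ[k] q.2) :
    coactOp (tensorCoact ρ ρ') (slot₂ C φ).ofConv ((v ⊗ₜ w) ⊗ₜ m) =
      ∑ q ∈ T, (v ⊗ₜ[k] q.1) ⊗ₜ[k] φ q.2 m := by
  obtain ⟨S, hS⟩ := TensorProduct.exists_finset (ρ v)
  rw [coactOp_tensorCoact_repr _ m hS hT, Finset.sum_comm]
  refine Finset.sum_congr rfl fun q _ => ?_
  conv_rhs => rw [← sum_counit_smul_of_isCoaction hρ hS]
  simp [TensorProduct.sum_tmul, TensorProduct.smul_tmul']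

/-- The flip of the first two factors of `(V ⊗ W) ⊗ M`. -/
def flipFst (k V W M : Type u) [Field k] [AddCommGroup V] [Module k V] [AddCommGroup W] [Module k W]
    [AddCommGroup M] [Module k M] : (V ⊗[k] W) ⊗[k] M →ₗ[k] (W ⊗[k] V) ⊗[k] M :=
  (TensorProduct.comm k V W).toLinearMap.rTensor M

@[simp] lemma flipFst_tmul (v : V) (w : W) (m : M) :
    flipFst k V W M ((v ⊗ₜ w) ⊗ₜ m) = (w ⊗ₜ v) ⊗ₜ m := rfl

lemma flipFst_flipFst (t : (V ⊗[k] W) ⊗[k] M) : flipFst k W V M (flipFst k V W M t) = t := by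
  rw [flipFst, flipFst, ← LinearMap.rTensor_comp_apply]
  simp

/-- The flip of `V` and `W` carries the operator of a functional to that of the flipped
functional. -/
lemma flipFst_coactOp (ρ : V →ₗ[k] V ⊗[k] C) (ρ' : W →ₗ[k] W ⊗[k] D)
    (φ : WithConv (C ⊗[k] D →ₗ[k] Module.End k M)) (t : (V ⊗[k] W) ⊗[k] M) :
    flipFst k V W M (coactOp (tensorCoact ρ ρ') φ.ofConv t) =
      coactOp (tensorCoact ρ' ρ) (convFlip k C D _ φ).ofConv (flipFst k V W M t) := by
  refine LinearMap.congr_fun (f := flipFst k V W M ∘ₗ coactOp (tensorCoact ρ ρ') φ.ofConv)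
    (g := coactOp (tensorCoact ρ' ρ) (convFlip k C D _ φ).ofConv ∘ₗ flipFst k V W M) ?_ t
  refine TensorProduct.ext_threefold fun v w m => ?_
  obtain ⟨S, hS⟩ := TensorProduct.exists_finset (ρ v)
  obtain ⟨T, hT⟩ := TensorProduct.exists_finset (ρ' w)
  rw [LinearMap.comp_apply, LinearMap.comp_apply, flipFst_tmul,
    coactOp_tensorCoact_repr _ m hS hT, coactOp_tensorCoact_repr _ m hT hS, Finset.sum_comm]
  simp

variable {H : Type u} [Ring H] [HopfAlgebra k H]

/-- On the tensor product of comodules a functional acts through the product of `H`. -/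
lemma coactOp_diagCoact (ρ : V →ₗ[k] V ⊗[k] H) (ρ' : W →ₗ[k] W ⊗[k] H)
    (φ : WithConv (H →ₗ[k] Module.End k M)) :
    coactOp (diagCoact ρ ρ') φ.ofConv = coactOp (tensorCoact ρ ρ') (mulPull φ).ofConv := by
  refine TensorProduct.ext_threefold fun v w m => ?_
  obtain ⟨S, hS⟩ := TensorProduct.exists_finset (ρ v)
  obtain ⟨T, hT⟩ := TensorProduct.exists_finset (ρ' w)
  rw [coactOp_tensorCoact_repr _ m hS hT, coactOp_tmul', diagCoact_tmul, hS, hT]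
  simp only [TensorProduct.sum_tmul, TensorProduct.tmul_sum, map_sum,
    TensorProduct.tensorTensorTensorComm_tmul, LinearMap.lTensor_tmul, LinearMap.mul'_apply,
    LinearMap.flip_apply]
  exact Finset.sum_comm

lemma braidMap_repr (φ : H ⊗[k] H →ₗ[k] k) {ρ : V →ₗ[k] V ⊗[k] H} {ρ' : W →ₗ[k] W ⊗[k] H} {v : V}
    {w : W} {S : Finset (V × H)} (hS : ρ v = ∑ p ∈ S, p.1 ⊗ₜ[k] p.2)
    {T : Finset (W × H)} (hT : ρ' w = ∑ q ∈ T, q.1 ⊗ₜ[k] q.2) :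
    braidMap φ ρ ρ' (v ⊗ₜ w) = ∑ p ∈ S, ∑ q ∈ T, φ (p.2 ⊗ₜ q.2) • (q.1 ⊗ₜ[k] p.1) := by
  rw [braidMap, hit, tensorCoact, LinearMap.comp_apply, LinearMap.comp_apply, LinearMap.comp_apply,
    LinearMap.comp_apply, TensorProduct.map_tmul, hS, hT]
  simp only [TensorProduct.sum_tmul, TensorProduct.tmul_sum, map_sum, LinearEquiv.coe_coe,
    TensorProduct.tensorTensorTensorComm_tmul, LinearMap.lTensor_tmul, TensorProduct.rid_tmul,
    map_smul, TensorProduct.comm_tmul]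
  exact Finset.sum_comm

/-- The braiding of comodules, tensored with `M`, is the action of `r` followed by the flip. -/
lemma rTensor_braidMap [CoquasitriangularStructure k H] (ρ : V →ₗ[k] V ⊗[k] H)
    (ρ' : W →ₗ[k] W ⊗[k] H) : (braidMap r ρ ρ').rTensor M =
      flipFst k V W M ∘ₗ coactOp (tensorCoact ρ ρ') (rConv k H (Module.End k M)).ofConv := by
  refine TensorProduct.ext_threefold fun v w m => ?_
  obtain ⟨S, hS⟩ := TensorProduct.exists_finset (ρ v)
  obtain ⟨T, hT⟩ := TensorProduct.exists_finset (ρ' w)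
  rw [LinearMap.comp_apply, coactOp_tensorCoact_repr _ m hS hT, LinearMap.rTensor_tmul,
    braidMap_repr r hS hT]
  simp [TensorProduct.sum_tmul, rConv_apply, Algebra.algebraMap_eq_smul_one,
    TensorProduct.smul_tmul']

lemma isCoaction_comul : IsCoaction (comul (R := k) (A := C)) where
  coassoc := Coalgebra.coassoc
  counit_id := by
    ext c
    simp [Coalgebra.lTensor_counit_comul]

lemma lid_counit_coactOp_comul (φ : C →ₗ[k] Module.End k M) (c : C) (m : M) :
    TensorProduct.lid k M ((counit (R := k) (A := C)).rTensor M (coactOp comul φ (c ⊗ₜ m))) =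
      φ c m := by
  rw [coactOp_tmul', ← (ℛ k c).eq]
  conv_rhs => rw [← sum_counit_smul (ℛ k c)]
  simp

/-- A functional is determined by its operator on the regular comodule. -/
lemma coactOp_comul_injective : Function.Injective
    (coactOp (M := M) (comul (R := k) (A := C))) := fun φ ψ h => by
  ext c m
  rw [← lid_counit_coactOp_comul φ, h, lid_counit_coactOp_comul ψ]

end CoactionOperators

/-! ### Objects of the reflective center from reflective pairs -/

section ReflectiveObjects

open Coalgebra TensorProduct WithConv CoquasitriangularStructure RightModuleAlgebra

variable {k H A : Type u} [Field k] [Ring H] [HopfAlgebra k H] [Ring A] [Algebra k A]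
variable [RightModuleAlgebra k H A]

/-- The operator of an `End M`-valued functional `φ` on the `A`-module `V ▷ M`; it is `A`-linear
if `φ` commutes with the families `h ↦ a.h`. -/
def reflHom {M : ModuleCat.{u} A} {φ : WithConv (H →ₗ[k] Module.End k M)}
    (hφ : ∀ a : A, φ * actConv (Algebra.lsmul k k M) a = actConv (Algebra.lsmul k k M) a * φ)
    (V : RComod k H) : V ⊙ₗ M ⟶ V ⊙ₗ M :=
  ModuleCat.ofHom
    { toFun := fun t => Act.of A V M (coactOp V.coact φ.ofConv ((Act.of A V M).symm t))
      map_add' := fun s t => map_add (coactOp (M := M) V.coact φ.ofConv) _ _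
      map_smul' := fun a t => by
        have h₁ := LinearMap.congr_fun (coactOp_mul V.isCoaction φ
          (actConv (Algebra.lsmul k k M) a)) ((Act.of A V M).symm t)
        rw [hφ, coactOp_mul V.isCoaction] at h₁
        exact h₁.symm }

/-- For an invertible functional the operators are isomorphisms. -/
def reflIso {M : ModuleCat.{u} A} {φ ψ : WithConv (H →ₗ[k] Module.End k M)}
    (hφ : ∀ a : A, φ * actConv (Algebra.lsmul k k M) a = actConv (Algebra.lsmul k k M) a * φ)
    (h₁ : φ * ψ = 1) (h₂ : ψ * φ = 1) (V : RComod k H) : V ⊙ₗ M ≅ V ⊙ₗ M where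
  hom := reflHom hφ V
  inv := reflHom (φ := ψ) (fun a => by
    calc ψ * actConv (Algebra.lsmul k k M) a = ψ * (actConv (Algebra.lsmul k k M) a * φ) * ψ := by
          rw [mul_assoc, mul_assoc, h₁, mul_one]
      _ = actConv (Algebra.lsmul k k M) a * ψ := by rw [← hφ, ← mul_assoc, h₂, one_mul]) V
  hom_inv_id := by
    ext t
    have h := LinearMap.congr_fun (coactOp_mul V.isCoaction ψ φ) ((Act.of A V M).symm t)
    rw [h₂, coactOp_one V.isCoaction] at h
    exact h.symm
  inv_hom_id := by
    ext t
    have h := LinearMap.congr_fun (coactOp_mul V.isCoaction φ ψ) ((Act.of A V M).symm t)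
    rw [h₁, coactOp_one V.isCoaction] at h
    exact h.symm

/-- The identification of `(V ⊗ W) ⊗ M` with `V ▷ (W ▷ M)`. -/
def actTensor (V W : RComod k H) (M : ModuleCat.{u} A) :
    (V ⊗[k] W) ⊗[k] M ≃+ ((V ⊙ₗ (W ⊙ₗ M) : ModuleCat.{u} A)) :=
  (Act.of A (V ⊗ W) M).trans (Act.assoc V W).toAddEquiv

lemma actTensor_tmul (V W : RComod k H) (M : ModuleCat.{u} A) (v : V) (w : W) (m : M) :
    actTensor V W M ((v ⊗ₜ w) ⊗ₜ m) = Act.tmul A v (Act.tmul A w m) := rfl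

lemma actAssocIso_inv_actTensor (V W : RComod k H) (M : ModuleCat.{u} A) (t : (V ⊗[k] W) ⊗[k] M) :
    (αₗ V W M).inv.hom (actTensor V W M t) = Act.of A (V ⊗ W) M t :=
  congrArg (fun f => f.hom (Act.of A (V ⊗ W) M t)) (αₗ V W M).hom_inv_id

lemma actTensor_ext {V W : RComod k H} {M N : ModuleCat.{u} A} {f g : V ⊙ₗ (W ⊙ₗ M) ⟶ N}
    (h : ∀ t, f.hom (actTensor V W M t) = g.hom (actTensor V W M t)) : f = g := by
  ext t
  obtain ⟨t, rfl⟩ := (actTensor V W M).surjective t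
  exact h t

/-- On `V ▷ (W ▷ M)`, the morphism `V ▷ e_W` is the operator of the functional in the second slot.
-/
lemma actionHomRight_reflHom {M : ModuleCat.{u} A} {φ : WithConv (H →ₗ[k] Module.End k M)}
    (hφ : ∀ a : A, φ * actConv (Algebra.lsmul k k M) a = actConv (Algebra.lsmul k k M) a * φ)
    (V W : RComod k H) (t : (V ⊗[k] W) ⊗[k] M) :
    (V ⊴ₗ reflHom hφ W).hom (actTensor V W M t) =
      actTensor V W M (coactOp (tensorCoact V.coact W.coact) (slot₂ H φ).ofConv t) := by
  induction t using TensorProduct.induction_on with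
  | zero => simp only [map_zero]
  | add x y hx hy => simp only [map_add, hx, hy]
  | tmul x m =>
    induction x using TensorProduct.induction_on with
    | zero => simp only [TensorProduct.zero_tmul, map_zero]
    | add x y hx hy => simp only [TensorProduct.add_tmul, map_add, hx, hy]
    | tmul v w =>
      obtain ⟨T, hT⟩ := TensorProduct.exists_finset (W.coact w)
      rw [coactOp_slot₂ V.isCoaction W.coact φ v m hT, map_sum, actTensor_tmul,
        actionHomRight_tmul]
      have h₁ : (reflHom hφ W).hom (Act.tmul A w m) =
          Act.of A W M (∑ q ∈ T, q.1 ⊗ₜ[k] φ q.2 m) :=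
        congrArg (Act.of A W M) (coactOp_tmul_repr φ.ofConv m hT)
      rw [h₁]
      have h₂ := congrArg (Act.of A V (Act A W M)) (congrArg (v ⊗ₜ[k] ·)
        (map_sum (Act.ofₗ A W M) (fun q : W × H => q.1 ⊗ₜ[k] φ q.2 m) T))
      refine h₂.trans ?_
      rw [TensorProduct.tmul_sum, map_sum]
      rfl

/-- Linear maps that intertwine the functionals commute with their operators. -/
lemma reflHom_naturality_right {M N : ModuleCat.{u} A} {φ : WithConv (H →ₗ[k] Module.End k M)}
    {χ : WithConv (H →ₗ[k] Module.End k N)}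
    (hφ : ∀ a : A, φ * actConv (Algebra.lsmul k k M) a = actConv (Algebra.lsmul k k M) a * φ)
    (hχ : ∀ a : A, χ * actConv (Algebra.lsmul k k N) a = actConv (Algebra.lsmul k k N) a * χ)
    {g : M ⟶ N} (hg : ∀ c m, g.hom (φ c m) = χ c (g.hom m)) (V : RComod k H) :
    V ⊴ₗ g ≫ reflHom hχ V = reflHom hφ V ≫ V ⊴ₗ g := by
  ext : 1
  refine Act.ext_tmul fun v m => ?_
  obtain ⟨S, hS⟩ := TensorProduct.exists_finset (V.coact v)
  refine (congrArg (Act.of A V N) (coactOp_tmul_repr χ.ofConv (g.hom m) hS)).trans ?_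
  refine Eq.trans ?_ (congrArg (fun s => (V ⊴ₗ g).hom (Act.of A V M s))
    (coactOp_tmul_repr φ.ofConv m hS).symm)
  simp only [map_sum, ← hg]
  rfl

/-- If the functional `χ` on `P` is given along `g : W ▷ M → P` by
`c (w ⊗ m) = w₍₀₎ ⊗ φ(c ⊗ w₍₁₎) m`, its operator on `V ▷ P` is given along `V ▷ g` by the operator
of `φ` on `(V ⊗ W) ⊗ M`. -/
lemma reflHom_actTensor {M P : ModuleCat.{u} A} {V W : RComod k H} {g : W ⊙ₗ M ⟶ P}
    {χ : WithConv (H →ₗ[k] Module.End k P)}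
    (hχ : ∀ a : A, χ * actConv (Algebra.lsmul k k P) a = actConv (Algebra.lsmul k k P) a * χ)
    {φ : H ⊗[k] H →ₗ[k] Module.End k M}
    (h : ∀ (c : H) (w : W) (m : M) (T : Finset (W × H)), W.coact w = ∑ q ∈ T, q.1 ⊗ₜ[k] q.2 →
      χ c (g.hom (Act.tmul A w m)) = g.hom (Act.of A W M (∑ q ∈ T, q.1 ⊗ₜ[k] φ (c ⊗ₜ q.2) m)))
    (t : (V ⊗[k] W) ⊗[k] M) :
    (reflHom hχ V).hom ((V ⊴ₗ g).hom (actTensor V W M t)) =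
      (V ⊴ₗ g).hom (actTensor V W M (coactOp (tensorCoact V.coact W.coact) φ t)) := by
  induction t using TensorProduct.induction_on with
  | zero => simp only [map_zero]
  | add x y hx hy => simp only [map_add, hx, hy]
  | tmul x m =>
    induction x using TensorProduct.induction_on with
    | zero => simp only [TensorProduct.zero_tmul, map_zero]
    | add x y hx hy => simp only [TensorProduct.add_tmul, map_add, hx, hy]
    | tmul v w =>
      obtain ⟨S, hS⟩ := TensorProduct.exists_finset (V.coact v)
      obtain ⟨T, hT⟩ := TensorProduct.exists_finset (W.coact w)
      rw [coactOp_tensorCoact_repr _ m hS hT, actTensor_tmul]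
      refine (congrArg (Act.of A V P) (coactOp_tmul_repr
        χ.ofConv (g.hom (Act.tmul A w m)) hS)).trans ?_
      simp only [map_sum]
      refine Finset.sum_congr rfl fun p _ => ?_
      refine (congrArg (fun n => Act.tmul A p.1 n) (h p.2 w m T hT)).trans ?_
      have h₂ := congrArg (fun s => Act.of A V (Act A W M) (p.1 ⊗ₜ[k] s))
        (map_sum (Act.ofₗ A W M) (fun q : W × H => q.1 ⊗ₜ[k] φ (p.2 ⊗ₜ q.2) m) T)
      refine (congrArg (V ⊴ₗ g).hom h₂).trans ?_
      rw [TensorProduct.tmul_sum, map_sum, map_sum]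
      rfl

/-- On `V ▷ (W ▷ M)`, the morphism `e_{V ⊗ W}` is the operator of `φ` precomposed with the
product. -/
lemma reflHom_tensor_actTensor {M : ModuleCat.{u} A} {φ : WithConv (H →ₗ[k] Module.End k M)}
    (hφ : ∀ a : A, φ * actConv (Algebra.lsmul k k M) a = actConv (Algebra.lsmul k k M) a * φ)
    (V W : RComod k H) (t : (V ⊗[k] W) ⊗[k] M) :
    (αₗ V W M).hom.hom ((reflHom hφ (V ⊗ W)).hom ((αₗ V W M).inv.hom (actTensor V W M t))) =
      actTensor V W M (coactOp (tensorCoact V.coact W.coact) (mulPull φ).ofConv t) := by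
  rw [actAssocIso_inv_actTensor]
  exact congrArg (actTensor V W M) (LinearMap.congr_fun (coactOp_diagCoact _ _ φ) t)

variable [CoquasitriangularStructure k H]

/-- On `V ▷ (W ▷ M)`, the braiding of `V` and `W` is the operator of `r` followed by the flip. -/
lemma swap_hom_actTensor (V W : RComod k H) (M : ModuleCat.{u} A) (t : (V ⊗[k] W) ⊗[k] M) :
    (swap V W M).hom.hom (actTensor V W M t) = actTensor W V M (flipFst k V W M
      (coactOp (tensorCoact V.coact W.coact) (rConv k H (Module.End k M)).ofConv t)) := by
  have h := LinearMap.congr_fun (rTensor_braidMap (M := M) V.coact W.coact) t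
  refine Eq.trans ?_ (congrArg (actTensor W V M) h)
  rw [swap]
  change (αₗ W V M).hom.hom (((β_ V W).hom ⊵ₗ M).hom ((αₗ V W M).inv.hom (actTensor V W M t))) = _
  rw [actAssocIso_inv_actTensor]
  rfl

/-- The left-hand side of the reflection equation, as a morphism `W ▷ (V ▷ M) ⟶ V ▷ (W ▷ M)`. -/
lemma swap_reflHom_tensor {M : ModuleCat.{u} A} {φ : WithConv (H →ₗ[k] Module.End k M)}
    (hφ : ∀ a : A, φ * actConv (Algebra.lsmul k k M) a = actConv (Algebra.lsmul k k M) a * φ)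
    (V W : RComod k H) (t : (W ⊗[k] V) ⊗[k] M) :
    ((swap W V M).hom ≫ (αₗ V W M).inv ≫ reflHom hφ (V ⊗ W) ≫ (αₗ V W M).hom).hom
        (actTensor W V M t) = actTensor V W M (coactOp (tensorCoact V.coact W.coact)
          (mulPull φ * rFlip k H _).ofConv (flipFst k W V M t)) := by
  change (αₗ V W M).hom.hom ((reflHom hφ (V ⊗ W)).hom ((αₗ V W M).inv.hom
    ((swap W V M).hom.hom (actTensor W V M t)))) = _
  rw [swap_hom_actTensor, flipFst_coactOp, coactOp_mul (V.isCoaction.tensor W.isCoaction)]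
  exact reflHom_tensor_actTensor hφ V W _

/-- The right-hand side of the reflection equation, as a morphism `W ▷ (V ▷ M) ⟶ V ▷ (W ▷ M)`. -/
lemma reflHom_swap_reflHom {M : ModuleCat.{u} A} {φ : WithConv (H →ₗ[k] Module.End k M)}
    (hφ : ∀ a : A, φ * actConv (Algebra.lsmul k k M) a = actConv (Algebra.lsmul k k M) a * φ)
    (V W : RComod k H) (t : (W ⊗[k] V) ⊗[k] M) :
    (W ⊴ₗ reflHom hφ V ≫ (swap W V M).hom ≫ V ⊴ₗ reflHom hφ W).hom (actTensor W V M t) =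
      actTensor V W M (coactOp (tensorCoact V.coact W.coact)
        (slot₂ H φ * rFlip k H _ * slot₁ H φ).ofConv (flipFst k W V M t)) := by
  change (V ⊴ₗ reflHom hφ W).hom
    ((swap W V M).hom.hom ((W ⊴ₗ reflHom hφ V).hom (actTensor W V M t))) = _
  rw [actionHomRight_reflHom, swap_hom_actTensor, actionHomRight_reflHom, flipFst_coactOp,
    flipFst_coactOp, convFlip_slot₂, coactOp_mul (V.isCoaction.tensor W.isCoaction),
    coactOp_mul (V.isCoaction.tensor W.isCoaction)]
  rfl

/-- The tensor axiom of the reflective center, with the braidings moved to one side. -/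
lemma reflHom_tensor_iff {M : ModuleCat.{u} A} {φ : WithConv (H →ₗ[k] Module.End k M)}
    (hφ : ∀ a : A, φ * actConv (Algebra.lsmul k k M) a = actConv (Algebra.lsmul k k M) a * φ)
    (V W : RComod k H) :
    reflHom hφ (V ⊗ W) = (αₗ V W M).hom ≫ (swap W V M).inv ≫ W ⊴ₗ reflHom hφ V ≫
      (swap W V M).hom ≫ V ⊴ₗ reflHom hφ W ≫ (αₗ V W M).inv ↔
    coactOp (M := M) (tensorCoact V.coact W.coact) (mulPull φ * rFlip k H _).ofConv =
      coactOp (tensorCoact V.coact W.coact) (slot₂ H φ * rFlip k H _ * slot₁ H φ).ofConv := by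
  trans (swap W V M).hom ≫ (αₗ V W M).inv ≫ reflHom hφ (V ⊗ W) ≫ (αₗ V W M).hom =
      W ⊴ₗ reflHom hφ V ≫ (swap W V M).hom ≫ V ⊴ₗ reflHom hφ W
  · constructor
    · intro h
      simp [h]
    · intro h
      have := congrArg (fun f => (αₗ V W M).hom ≫ (swap W V M).inv ≫ f ≫ (αₗ V W M).inv) h
      simpa using this
  · constructor
    · intro h
      refine LinearMap.ext fun t => ?_
      have hF : flipFst k W V M (flipFst k V W M t) = t := flipFst_flipFst t
      have := congrArg (fun f => f.hom (actTensor W V M (flipFst k V W M t))) h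
      rw [swap_reflHom_tensor, reflHom_swap_reflHom, hF] at this
      exact (actTensor V W M).injective this
    · intro h
      refine actTensor_ext fun t => ?_
      rw [swap_reflHom_tensor, reflHom_swap_reflHom, h]

/-- An invertible reflective pair for the module structure of `M` makes `M` an object of the
reflective center. -/
def reflObj (M : ModuleCat.{u} A) {φ ψ : WithConv (H →ₗ[k] Module.End k M)}
    (hp : IsReflectivePair (A := A) (Algebra.lsmul k k M) φ) (h₁ : φ * ψ = 1) (h₂ : ψ * φ = 1) :
    ReflectiveCenter (RComod k H) (ModuleCat.{u} A) where
  obj := M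
  e V := reflIso hp.comm h₁ h₂ V
  naturality {V W} f := by
    ext : 1
    refine Act.ext_tmul fun v m => ?_
    obtain ⟨S, hS⟩ := TensorProduct.exists_finset (V.coact v)
    have hS' : W.coact (f.hom v) = ∑ p ∈ S, (f.hom p.1) ⊗ₜ[k] p.2 := by
      rw [RComod.Hom.coact_apply, hS]
      simp
    have h₁ := coactOp_tmul_repr φ.ofConv m hS
    have h₂ : coactOp W.coact φ.ofConv (f.hom v ⊗ₜ m) =
        ∑ p ∈ S, (f.hom p.1) ⊗ₜ[k] φ p.2 m := by
      rw [coactOp_tmul', hS']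
      simp
    refine (congrArg (Act.of A W M) h₂).trans ?_
    refine Eq.trans ?_ (congrArg (fun s => (f ⊵ₗ M).hom (Act.of A V M s)) h₁.symm)
    simp only [map_sum]
    rfl
  e_unit := by
    ext : 1
    refine Act.ext_tmul fun (c : k) m => ?_
    refine congrArg (Act.of A (𝟙_ (RComod k H)) M) ?_
    refine (coactOp_tmul' (trivCoact k H) φ.ofConv c m).trans ?_
    have := congrArg (fun f => c ⊗ₜ[k] f m) hp.map_one
    exact this
  e_tensor V W := (reflHom_tensor_iff hp.comm V W).mpr (by rw [hp.reflection])

/-- The reflection on `V ▷ (W ▷ M)` in the reflective center. -/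
lemma eAct_reflObj {M : ModuleCat.{u} A} {φ ψ : WithConv (H →ₗ[k] Module.End k M)}
    (hp : IsReflectivePair (A := A) (Algebra.lsmul k k M) φ) (h₁ : φ * ψ = 1) (h₂ : ψ * φ = 1)
    (V W : RComod k H) (t : (V ⊗[k] W) ⊗[k] M) :
    ((reflObj M hp h₁ h₂).eAct V W).hom.hom (actTensor V W M t) = actTensor V W M
      (coactOp (tensorCoact V.coact W.coact)
        (φ.ofConv ∘ₗ TensorProduct.lift (centralHit k H)) t) := by
  change (swap W V M).hom.hom ((W ⊴ₗ reflHom hp.comm V).hom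
    ((swap V W M).hom.hom (actTensor V W M t))) = _
  have hT (φ ψ : WithConv (H ⊗[k] H →ₗ[k] Module.End k M)) (t : (V ⊗[k] W) ⊗[k] M) :=
    LinearMap.congr_fun (coactOp_mul (V.isCoaction.tensor W.isCoaction) φ ψ) t
  rw [swap_hom_actTensor, actionHomRight_reflHom, swap_hom_actTensor, flipFst_coactOp W.coact,
    flipFst_coactOp W.coact, flipFst_flipFst, convFlip_slot₂]
  have := congrArg (fun ψ => coactOp (tensorCoact V.coact W.coact) ψ.ofConv t)
    (map_centralHit φ.ofConv)
  rw [hT, Module.End.mul_apply, hT] at this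
  exact congrArg (actTensor V W M) this.symm

end ReflectiveObjects

/-! ### The module braiding of a reflective structure -/

section ModuleBraiding

open Coalgebra TensorProduct WithConv CoquasitriangularStructure RightModuleAlgebra

variable {k H B : Type u} [Field k] [Ring H] [HopfAlgebra k H] [CoquasitriangularStructure k H]
variable [Ring B] [Algebra k B] [RightModuleAlgebra k H B] {K K' : WithConv (H →ₗ[k] B)}

/-- A pair with `ι = id` acts on every `B`-module by a reflective pair of operators. -/
lemma IsReflectivePair.lsmul (hp : IsReflectivePair (AlgHom.id k B) K) (M : ModuleCat.{u} B) :
    IsReflectivePair (A := B) (Algebra.lsmul k k M) (convPush H (Algebra.lsmul k k M) K) := by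
  simpa only [AlgHom.comp_id] using hp.push (Algebra.lsmul k k M)

lemma convPush_mul_eq_one {R S : Type*} [Ring R] [Algebra k R] [Ring S] [Algebra k S]
    (f : R →ₐ[k] S) {φ ψ : WithConv (H →ₗ[k] R)} (h : φ * ψ = 1) :
    convPush H f φ * convPush H f ψ = 1 := by
  rw [← map_mul, h, map_one]

lemma smul_actTmul (W : RComod k H) (M : ModuleCat.{u} B) (b : B) (w : W) (m : M) :
    b • Act.tmul B w m = Act.of B W M ((preAct b).lTensor W
      (TensorProduct.assoc k W H M (W.coact w ⊗ₜ m))) := rfl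

/-- `K(c) (w ⊗ m) = w₍₀₎ ⊗ K(c ↼ w₍₁₎) m`. -/
lemma smul_actTmul_repr (hact : ∀ g h, act (k := k) (K g) h = K (centralHit k H g h))
    (W : RComod k H) (M : ModuleCat.{u} B) (c : H) {w : W} (m : M)
    {T : Finset (W × H)} (hT : W.coact w = ∑ q ∈ T, q.1 ⊗ₜ[k] q.2) :
    K c • Act.tmul B w m = Act.of B W M (∑ q ∈ T, q.1 ⊗ₜ[k] (K (centralHit k H c q.2) • m)) := by
  rw [smul_actTmul]
  refine congrArg (Act.of B W M) ?_
  rw [hT, TensorProduct.sum_tmul, map_sum, map_sum]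
  exact Finset.sum_congr rfl fun q _ => congrArg (fun b => q.1 ⊗ₜ[k] (b • m)) (hact c q.2)

/-- The object of the reflective center that `K` attaches to a `B`-module. -/
def structObj (hp : IsReflectivePair (AlgHom.id k B) K) (h₁ : K * K' = 1) (h₂ : K' * K = 1)
    (M : ModuleCat.{u} B) : ReflectiveCenter (RComod k H) (ModuleCat.{u} B) :=
  reflObj M (φ := convPush H (Algebra.lsmul k k M) K) (ψ := convPush H (Algebra.lsmul k k M) K')
    (hp.lsmul M) (convPush_mul_eq_one _ h₁) (convPush_mul_eq_one _ h₂)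

lemma structObj_naturality_right (hp : IsReflectivePair (AlgHom.id k B) K) (h₁ : K * K' = 1)
    (h₂ : K' * K = 1) (V : RComod k H) {M N : ModuleCat.{u} B} (g : M ⟶ N) :
    V ⊴ₗ g ≫ ((structObj hp h₁ h₂ N).e V).hom = ((structObj hp h₁ h₂ M).e V).hom ≫ V ⊴ₗ g :=
  reflHom_naturality_right (hp.lsmul M).comm (hp.lsmul N).comm (fun c m => map_smul g.hom (K c) m) V

/-- The action axiom of a module braiding is the formula for `K(g).h`. -/
lemma structObj_action (hp : IsReflectivePair (AlgHom.id k B) K) (h₁ : K * K' = 1)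
    (h₂ : K' * K = 1) (hact : ∀ g h, act (k := k) (K g) h = K (centralHit k H g h))
    (V W : RComod k H) (M : ModuleCat.{u} B) :
    ((structObj hp h₁ h₂ (W ⊙ₗ M)).e V).hom = ((structObj hp h₁ h₂ M).eAct V W).hom := by
  refine actTensor_ext fun t => ?_
  refine Eq.trans ?_ (eAct_reflObj (φ := convPush H (Algebra.lsmul k k M) K)
    (ψ := convPush H (Algebra.lsmul k k M) K') (hp.lsmul M) (convPush_mul_eq_one _ h₁)
    (convPush_mul_eq_one _ h₂) V W t).symm
  have := reflHom_actTensor (g := 𝟙 (W ⊙ₗ M)) (V := V)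
    (φ := (convPush H (Algebra.lsmul k k M) K).ofConv ∘ₗ
      TensorProduct.lift (centralHit k H)) (hp.lsmul (W ⊙ₗ M)).comm
    (fun c w m T hT => smul_actTmul_repr hact W M c m hT) t
  simp only [MonoidalLeftAction.actionHomRight_id] at this
  exact this

/-- The module braiding `v ⊗ m ↦ v₍₀₎ ⊗ K(v₍₁₎) m` of a reflective structure `K`. -/
def moduleBraiding (hp : IsReflectivePair (AlgHom.id k B) K) (h₁ : K * K' = 1) (h₂ : K' * K = 1)
    (hact : ∀ g h, act (k := k) (K g) h = K (centralHit k H g h)) :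
    BraidedModuleCategory (RComod k H) (ModuleCat.{u} B) where
  e V M := (structObj hp h₁ h₂ M).e V
  e_naturality_left f M := (structObj hp h₁ h₂ M).naturality f
  e_naturality_right V _ _ g := structObj_naturality_right hp h₁ h₂ V g
  e_tensor V W M := (structObj hp h₁ h₂ M).e_tensor V W
  e_action V W M := structObj_action hp h₁ h₂ hact V W M

namespace ReflectiveAlgebra

variable {A : Type u} [Ring A] [Algebra k A] [RightModuleAlgebra k H A]

/-- The universal pair, as a pair for the reflective algebra itself. -/
lemma isReflectivePair_id :
    IsReflectivePair (AlgHom.id k (ReflectiveAlgebra k H A)) (toConv (kappa k H A)) where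
  map_one := isReflectivePair.map_one
  comm := kappa_mul_actConv
  reflection := isReflectivePair.reflection

end ReflectiveAlgebra

end ModuleBraiding

/-! ### Restriction of scalars and the action of comodules -/

section Restriction

open Coalgebra TensorProduct WithConv CoquasitriangularStructure RightModuleAlgebra

variable {k H A B : Type u} [Field k] [Ring H] [HopfAlgebra k H] [Ring A] [Algebra k A]
variable [Ring B] [Algebra k B]

/-- The identity of `M`, from its restriction of scalars along `f : A → B`. The `k`-module
structures that come from `A` and from `B` agree, but not by definition. -/
def resEquiv (f : A →ₐ[k] B) (M : ModuleCat.{u} B) :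
    (ModuleCat.restrictScalars f.toRingHom).obj M ≃ₗ[k] M where
  __ := AddEquiv.refl M
  map_smul' c m := congrArg (fun b : B => b • (show M from m)) (f.commutes c)

/-- The action of `B` on the restriction of scalars of a `B`-module. -/
def resEnd (f : A →ₐ[k] B) (M : ModuleCat.{u} B) :
    B →ₐ[k] Module.End k ((ModuleCat.restrictScalars f.toRingHom).obj M) :=
  ((resEquiv f M).symm.conjAlgEquiv k).toAlgHom.comp (Algebra.lsmul k k M)

variable [RightModuleAlgebra k H A] [RightModuleAlgebra k H B]

/-- `V ▷ M` for the restriction of scalars of `M` along a map of module algebras. -/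
def resActEquiv (f : A →ₐ[k] B)
    (hf : ∀ a h, act (k := k) (f a) h = f (act (k := k) (H := H) a h))
    (V : RComod k H) (M : ModuleCat.{u} B) :
    (V ⊙ₗ (ModuleCat.restrictScalars f.toRingHom).obj M : ModuleCat.{u} A) ≃ₗ[A]
      ((ModuleCat.restrictScalars f.toRingHom).obj (V ⊙ₗ M : ModuleCat.{u} B)) where
  __ := ((Act.of A V _).symm.trans ((resEquiv f M).lTensor V).toAddEquiv).trans (Act.of B V M)
  map_smul' a t := by
    refine congrArg (Act.of B V M) ?_
    have h : ∀ t, (resEquiv f M).lTensor V (actMap V.coact a t) =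
        actMap V.coact (f a) ((resEquiv f M).lTensor V t) := by
      intro t
      induction t using TensorProduct.induction_on with
      | zero => simp only [map_zero]
      | add x y hx hy => simp only [map_add, hx, hy]
      | tmul v m =>
        obtain ⟨S, hS⟩ := TensorProduct.exists_finset (V.coact v)
        rw [LinearEquiv.lTensor_tmul, actMap_tmul, actMap_tmul, hS, TensorProduct.sum_tmul,
          TensorProduct.sum_tmul]
        simp only [map_sum]
        refine Finset.sum_congr rfl fun p _ => ?_
        simp only [TensorProduct.assoc_tmul, LinearMap.lTensor_tmul, LinearEquiv.lTensor_tmul,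
          preAct_tmul, hf]
        rfl
    exact h t

/-- The identity map `v ⊗ m ↦ v ⊗ m` as an isomorphism between the action on a restriction of
scalars and the restriction of the action. -/
def resAct (f : A →ₐ[k] B) (hf : ∀ a h, act (k := k) (f a) h = f (act (k := k) (H := H) a h))
    (V : RComod k H) (M : ModuleCat.{u} B) :
    V ⊙ₗ (ModuleCat.restrictScalars f.toRingHom).obj M ≅
      (ModuleCat.restrictScalars f.toRingHom).obj (V ⊙ₗ M) :=
  (resActEquiv f hf V M).toModuleIso

end Restriction

/-! ### The functor from modules to the reflective center -/

section CenterFunctor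

open Coalgebra TensorProduct WithConv CoquasitriangularStructure RightModuleAlgebra

variable {k H A B : Type u} [Field k] [Ring H] [HopfAlgebra k H] [CoquasitriangularStructure k H]
variable [Ring A] [Algebra k A] [RightModuleAlgebra k H A] [Ring B] [Algebra k B]
variable {f : A →ₐ[k] B} {K K' : WithConv (H →ₗ[k] B)}

lemma IsReflectivePair.resEnd (hp : IsReflectivePair f K) (M : ModuleCat.{u} B) :
    IsReflectivePair (A := A)
      (Algebra.lsmul k k ((ModuleCat.restrictScalars f.toRingHom).obj M))
      (convPush H (ReflAlg.resEnd f M) K) := hp.push (ReflAlg.resEnd f M)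

/-- The restriction of scalars of a `B`-module along `f`, as an object of the reflective center. -/
def resObj (hp : IsReflectivePair f K) (h₁ : K * K' = 1) (h₂ : K' * K = 1) (M : ModuleCat.{u} B) :
    ReflectiveCenter (RComod k H) (ModuleCat.{u} A) :=
  reflObj ((ModuleCat.restrictScalars f.toRingHom).obj M) (φ := convPush H (resEnd f M) K)
    (ψ := convPush H (resEnd f M) K') (hp.resEnd M) (convPush_mul_eq_one _ h₁)
    (convPush_mul_eq_one _ h₂)

/-- The functor from modules over `B` to the reflective center that a reflective pair `(f, K)`
with values in `B` defines. -/
def resFunctor (hp : IsReflectivePair f K) (h₁ : K * K' = 1) (h₂ : K' * K = 1) :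
    ModuleCat.{u} B ⥤ ReflectiveCenter (RComod k H) (ModuleCat.{u} A) where
  obj M := resObj hp h₁ h₂ M
  map {M N} g := ⟨(ModuleCat.restrictScalars f.toRingHom).map g, fun V =>
    reflHom_naturality_right (hp.resEnd M).comm (hp.resEnd N).comm
      (fun c m => map_smul g.hom (K c) m) V⟩
  map_id M := ReflectiveCenter.hom_ext ((ModuleCat.restrictScalars f.toRingHom).map_id M)
  map_comp g g' := ReflectiveCenter.hom_ext ((ModuleCat.restrictScalars f.toRingHom).map_comp g g')

instance (hp : IsReflectivePair f K) (h₁ : K * K' = 1) (h₂ : K' * K = 1) :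
    (resFunctor hp h₁ h₂).Faithful where
  map_injective {M N} g g' h := by
    ext m
    exact congrArg (fun u => u.hom.hom m) h

/-- The regular comodule. -/
def regComod (k H : Type u) [Field k] [Ring H] [HopfAlgebra k H] : RComod k H where
  carrier := H
  coact := comul
  isCoaction := isCoaction_comul

/-- `c ⊗ m ↦ ε(c) m` on the regular comodule. -/
def counitHit (k H M : Type u) [Field k] [Ring H] [HopfAlgebra k H] [AddCommGroup M] [Module k M] :
    H ⊗[k] M →ₗ[k] M :=
  (TensorProduct.lid k M).toLinearMap ∘ₗ (counit (R := k) (A := H)).rTensor M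

lemma counitHit_coactOp {M : Type u} [AddCommGroup M] [Module k M] (φ : H →ₗ[k] Module.End k M)
    (c : H) (m : M) : counitHit k H M (coactOp comul φ (c ⊗ₜ m)) = φ c m :=
  lid_counit_coactOp_comul φ c m

/-- Naturality on the regular comodule recovers the functionals. -/
lemma map_of_reflHom_naturality {M N : ModuleCat.{u} A} {φ : WithConv (H →ₗ[k] Module.End k M)}
    {χ : WithConv (H →ₗ[k] Module.End k N)}
    (hφ : ∀ a : A, φ * actConv (Algebra.lsmul k k M) a = actConv (Algebra.lsmul k k M) a * φ)
    (hχ : ∀ a : A, χ * actConv (Algebra.lsmul k k N) a = actConv (Algebra.lsmul k k N) a * χ)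
    {g : M ⟶ N} (hg : regComod k H ⊴ₗ g ≫ reflHom hχ (regComod k H) =
      reflHom hφ (regComod k H) ≫ regComod k H ⊴ₗ g) (c : H) (m : M) :
    g.hom (φ c m) = χ c (g.hom m) := by
  have h := congrArg (fun u => counitHit k H N ((Act.of A (regComod k H) N).symm
    (u.hom (Act.tmul A (V := regComod k H) c m)))) hg
  have h' : counitHit k H N (coactOp comul χ.ofConv (c ⊗ₜ g.hom m)) =
      counitHit k H N ((g.hom.restrictScalars k).lTensor H (coactOp comul φ.ofConv (c ⊗ₜ m))) := h
  have hn : ∀ t, counitHit k H N ((g.hom.restrictScalars k).lTensor H t) =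
      g.hom.restrictScalars k (counitHit k H M t) := fun t => by
    induction t using TensorProduct.induction_on with
    | zero => simp only [map_zero]
    | add x y hx hy => simp only [map_add, hx, hy]
    | tmul x y => simp [counitHit]
  rw [hn, counitHit_coactOp, counitHit_coactOp] at h'
  exact h'.symm

/-- If `B` is spanned by the products `K(c) f(a)`, then a map that is `A`-linear and commutes with
the reflections is `B`-linear. -/
lemma resFunctor_full (hp : IsReflectivePair f K) (h₁ : K * K' = 1) (h₂ : K' * K = 1)
    (hspan : ∀ b : B, b ∈ Submodule.span k (Set.range fun p : H × A => K p.1 * f p.2)) :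
    (resFunctor hp h₁ h₂).Full where
  map_surjective {M N} g := by
    let γ : M →+ N := { toFun := g.hom.hom, map_zero' := map_zero g.hom.hom,
                        map_add' := map_add g.hom.hom }
    have hK (c : H) (m : M) : γ (K c • m) = K c • γ m :=
      map_of_reflHom_naturality (hp.resEnd M).comm (hp.resEnd N).comm (g.comm (regComod k H)) c m
    have hA (a : A) (m : M) : γ (f a • m) = f a • γ m := g.hom.hom.map_smul a m
    have hB (b : B) (m : M) : γ (b • m) = b • γ m := by
      have hb := hspan b
      induction hb using Submodule.span_induction generalizing m with
      | mem x hx =>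
        obtain ⟨⟨c, a⟩, rfl⟩ := hx
        change γ ((K c * f a) • m) = (K c * f a) • γ m
        rw [mul_smul, mul_smul, ← hA, ← hK]
      | zero => rw [zero_smul, zero_smul, map_zero]
      | add x y _ _ hx hy => rw [add_smul, add_smul, ← hx, ← hy, map_add]
      | smul c x _ hx => rw [Algebra.smul_def, mul_smul, mul_smul, ← hx, ← f.commutes, ← hA]
    exact ⟨ModuleCat.ofHom { toFun := γ, map_add' := map_add γ, map_smul' := hB }, rfl⟩

end CenterFunctor

/-! ### The functor as a functor of braided module categories -/

section LinearStructure

open Coalgebra TensorProduct WithConv CoquasitriangularStructure RightModuleAlgebra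

variable {k H A B : Type u} [Field k] [Ring H] [HopfAlgebra k H] [CoquasitriangularStructure k H]
variable [Ring A] [Algebra k A] [RightModuleAlgebra k H A] [Ring B] [Algebra k B]
variable [RightModuleAlgebra k H B] {f : A →ₐ[k] B} {K K' : WithConv (H →ₗ[k] B)}

/-- The identification of `W ▷ M` with its restriction of scalars is a morphism of the reflective
center; this is the formula for `K(g).h` again. -/
lemma resAct_comm (hp : IsReflectivePair f K) (h₁ : K * K' = 1) (h₂ : K' * K = 1)
    (hf : ∀ a h, act (k := k) (f a) h = f (act (k := k) (H := H) a h))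
    (hact : ∀ g h, act (k := k) (K g) h = K (centralHit k H g h))
    (V W : RComod k H) (M : ModuleCat.{u} B) :
    V ⊴ₗ (resAct f hf W M).hom ≫ ((resObj hp h₁ h₂ (W ⊙ₗ M)).e V).hom =
      ((resObj hp h₁ h₂ M).eAct V W).hom ≫ V ⊴ₗ (resAct f hf W M).hom := by
  refine actTensor_ext fun t => ?_
  refine Eq.trans ?_ (congrArg (V ⊴ₗ (resAct f hf W M).hom).hom
    (eAct_reflObj (φ := convPush H (resEnd f M) K) (ψ := convPush H (resEnd f M) K')
      (hp.resEnd M) (convPush_mul_eq_one _ h₁) (convPush_mul_eq_one _ h₂) V W t).symm)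
  refine reflHom_actTensor (g := (resAct f hf W M).hom) (V := V)
    (φ := (convPush H (resEnd f M) K).ofConv ∘ₗ
      TensorProduct.lift (centralHit k H)) (hp.resEnd (W ⊙ₗ M)).comm
    (fun c w m T hT => ?_) t
  refine (smul_actTmul_repr hact W M c (resEquiv f M m) hT).trans ?_
  have := map_sum ((resEquiv f M).lTensor W)
    (fun q : W × H => q.1 ⊗ₜ[k] (resEnd f M (K (centralHit k H c q.2)) m)) T
  exact congrArg (Act.of B W M) this.symm

/-- The comparison `V ▷ F(M) ≅ F(V ▷ M)`, `v ⊗ m ↦ v ⊗ m`. -/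
def resLin (hp : IsReflectivePair f K) (h₁ : K * K' = 1) (h₂ : K' * K = 1)
    (hf : ∀ a h, act (k := k) (f a) h = f (act (k := k) (H := H) a h))
    (hact : ∀ g h, act (k := k) (K g) h = K (centralHit k H g h))
    (W : RComod k H) (M : ModuleCat.{u} B) :
    W ⊙ₗ (resFunctor hp h₁ h₂).obj M ≅ (resFunctor hp h₁ h₂).obj (W ⊙ₗ M) :=
  ReflectiveCenter.mkIso (V := ReflectiveCenter.act W (resObj hp h₁ h₂ M))
    (W := resObj hp h₁ h₂ (W ⊙ₗ M)) (resAct f hf W M)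
    (fun V => resAct_comm hp h₁ h₂ hf hact V W M)

lemma resLin_naturality_left (hp : IsReflectivePair f K) (h₁ : K * K' = 1) (h₂ : K' * K = 1)
    (hf : ∀ a h, act (k := k) (f a) h = f (act (k := k) (H := H) a h))
    (hact : ∀ g h, act (k := k) (K g) h = K (centralHit k H g h))
    {V W : RComod k H} (u : V ⟶ W) (M : ModuleCat.{u} B) :
    u ⊵ₗ (resFunctor hp h₁ h₂).obj M ≫ (resLin hp h₁ h₂ hf hact W M).hom =
      (resLin hp h₁ h₂ hf hact V M).hom ≫ (resFunctor hp h₁ h₂).map (u ⊵ₗ M) := by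
  ext : 2
  exact Act.ext_tmul fun v m => rfl

lemma resLin_naturality_right (hp : IsReflectivePair f K) (h₁ : K * K' = 1) (h₂ : K' * K = 1)
    (hf : ∀ a h, act (k := k) (f a) h = f (act (k := k) (H := H) a h))
    (hact : ∀ g h, act (k := k) (K g) h = K (centralHit k H g h))
    (V : RComod k H) {M N : ModuleCat.{u} B} (g : M ⟶ N) :
    V ⊴ₗ (resFunctor hp h₁ h₂).map g ≫ (resLin hp h₁ h₂ hf hact V N).hom =
      (resLin hp h₁ h₂ hf hact V M).hom ≫ (resFunctor hp h₁ h₂).map (V ⊴ₗ g) := by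
  ext : 2
  exact Act.ext_tmul fun v m => rfl

lemma resLin_associativity (hp : IsReflectivePair f K) (h₁ : K * K' = 1) (h₂ : K' * K = 1)
    (hf : ∀ a h, act (k := k) (f a) h = f (act (k := k) (H := H) a h))
    (hact : ∀ g h, act (k := k) (K g) h = K (centralHit k H g h))
    (V W : RComod k H) (M : ModuleCat.{u} B) :
    (resLin hp h₁ h₂ hf hact (V ⊗ W) M).hom ≫ (resFunctor hp h₁ h₂).map (αₗ V W M).hom =
      (αₗ V W ((resFunctor hp h₁ h₂).obj M)).hom ≫ V ⊴ₗ (resLin hp h₁ h₂ hf hact W M).hom ≫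
        (resLin hp h₁ h₂ hf hact V (W ⊙ₗ M)).hom := by
  ext : 2
  exact Act.ext_tmul₂ fun v w m => rfl

lemma resLin_unitality (hp : IsReflectivePair f K) (h₁ : K * K' = 1) (h₂ : K' * K = 1)
    (hf : ∀ a h, act (k := k) (f a) h = f (act (k := k) (H := H) a h))
    (hact : ∀ g h, act (k := k) (K g) h = K (centralHit k H g h))
    (M : ModuleCat.{u} B) : (λₗ[RComod k H] ((resFunctor hp h₁ h₂).obj M)).hom =
      (resLin hp h₁ h₂ hf hact (𝟙_ (RComod k H)) M).hom ≫
        (resFunctor hp h₁ h₂).map (λₗ[RComod k H] M).hom := by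
  ext : 2
  exact Act.ext_tmul fun (c : k) m => (resEquiv f M).map_smul c m

/-- The functor to the reflective center is a functor of module categories. -/
def resLeftLinear (hp : IsReflectivePair f K) (h₁ : K * K' = 1) (h₂ : K' * K = 1)
    (hf : ∀ a h, act (k := k) (f a) h = f (act (k := k) (H := H) a h))
    (hact : ∀ g h, act (k := k) (K g) h = K (centralHit k H g h)) :
    (resFunctor hp h₁ h₂).LeftLinear (RComod k H) where
  μₗ V M := (resLin hp h₁ h₂ hf hact V M).hom
  μₗ_naturality_left u M := resLin_naturality_left hp h₁ h₂ hf hact u M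
  μₗ_naturality_right V _ _ g := resLin_naturality_right hp h₁ h₂ hf hact V g
  μₗ_associativity V W M := resLin_associativity hp h₁ h₂ hf hact V W M
  μₗ_unitality M := resLin_unitality hp h₁ h₂ hf hact M
  δₗ V M := (resLin hp h₁ h₂ hf hact V M).inv
  δₗ_naturality_left u M := by
    rw [Iso.comp_inv_eq, Category.assoc, Iso.eq_inv_comp, resLin_naturality_left]
  δₗ_naturality_right V _ _ g := by
    rw [Iso.comp_inv_eq, Category.assoc, Iso.eq_inv_comp, resLin_naturality_right]
  δₗ_associativity V W M := by
    rw [Iso.inv_comp_eq, reassoc_of% resLin_associativity hp h₁ h₂ hf hact V W M]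
    simp
  δₗ_unitality_inv M := by
    rw [Iso.eq_comp_inv, Iso.inv_comp_eq, resLin_unitality hp h₁ h₂ hf hact, Category.assoc,
      ← Functor.map_comp, Iso.hom_inv_id, CategoryTheory.Functor.map_id, Category.comp_id]
  μₗ_comp_δₗ V M := (resLin hp h₁ h₂ hf hact V M).hom_inv_id
  δₗ_comp_μₗ V M := (resLin hp h₁ h₂ hf hact V M).inv_hom_id

/-- The functor to the reflective center carries the module braiding to the reflections `e_V`. -/
lemma resLin_braided (hp : IsReflectivePair f K) (hid : IsReflectivePair (AlgHom.id k B) K)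
    (h₁ : K * K' = 1) (h₂ : K' * K = 1)
    (hf : ∀ a h, act (k := k) (f a) h = f (act (k := k) (H := H) a h))
    (hact : ∀ g h, act (k := k) (K g) h = K (centralHit k H g h))
    (V : RComod k H) (M : ModuleCat.{u} B) :
    (BraidedModuleCategory.e V ((resFunctor hp h₁ h₂).obj M)).hom ≫
        (resLin hp h₁ h₂ hf hact V M).hom =
      (resLin hp h₁ h₂ hf hact V M).hom ≫
        (resFunctor hp h₁ h₂).map ((moduleBraiding hid h₁ h₂ hact).e V M).hom := by
  ext : 2
  refine Act.ext_tmul fun v m => ?_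
  refine congrArg (Act.of B V M) ?_
  obtain ⟨S, hS⟩ := TensorProduct.exists_finset (V.coact v)
  have e₁ := coactOp_tmul_repr (convPush H (resEnd f M) K).ofConv m hS
  have e₂ := coactOp_tmul_repr (convPush H (Algebra.lsmul k k M) K).ofConv (resEquiv f M m) hS
  refine (congrArg ((resEquiv f M).lTensor V) e₁).trans (Eq.trans ?_ e₂.symm)
  rw [map_sum]
  rfl

end LinearStructure

/-! ### Reflective pairs from objects of the reflective center -/

section CenterObjects

open Coalgebra TensorProduct WithConv CoquasitriangularStructure RightModuleAlgebra

variable {k H A : Type u} [Field k] [Ring H] [HopfAlgebra k H]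

/-- The matrix coefficients `v ↦ l(v₍₀₎) v₍₁₎` of a functional `l` on a comodule. -/
def matrixCoeff (V : RComod k H) (l : Module.Dual k V) : V →ₗ[k] H :=
  (TensorProduct.lid k H).toLinearMap ∘ₗ l.rTensor H ∘ₗ V.coact

/-- Matrix coefficients are compatible with the coaction and the coproduct. -/
lemma comul_comp_matrixCoeff (V : RComod k H) (l : Module.Dual k V) :
    comul ∘ₗ matrixCoeff V l = (matrixCoeff V l).rTensor H ∘ₗ V.coact := by
  ext v
  have h := congrArg ((TensorProduct.lid k (H ⊗[k] H)).toLinearMap ∘ₗ l.rTensor (H ⊗[k] H))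
    (V.isCoaction.coassoc_apply v)
  refine Eq.trans ?_ (h.symm.trans ?_)
  · simp only [matrixCoeff, LinearMap.comp_apply]
    induction V.coact v using TensorProduct.induction_on with
    | zero => simp
    | add x y hx hy => simp only [map_add, hx, hy]
    | tmul x c => simp
  · simp only [LinearMap.comp_apply]
    induction V.coact v using TensorProduct.induction_on with
    | zero => simp
    | add x y hx hy => simp only [map_add, hx, hy]
    | tmul x c =>
      simp only [LinearMap.rTensor_tmul, matrixCoeff, LinearMap.comp_apply]
      induction V.coact x using TensorProduct.induction_on with
      | zero => simp
      | add x y hx hy => simp only [map_add, TensorProduct.add_tmul, hx, hy]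
      | tmul y d => simp [TensorProduct.smul_tmul']

/-- The matrix coefficients as a comodule map to the regular comodule. -/
def matrixCoeffHom (V : RComod k H) (l : Module.Dual k V) : V ⟶ regComod k H where
  hom := matrixCoeff V l
  coact_hom := comul_comp_matrixCoeff V l

lemma matrixCoeff_apply (V : RComod k H) (l : Module.Dual k V) {v : V} {S : Finset (V × H)}
    (hS : V.coact v = ∑ p ∈ S, p.1 ⊗ₜ[k] p.2) :
    matrixCoeff V l v = ∑ p ∈ S, l p.1 • p.2 := by
  rw [matrixCoeff, LinearMap.comp_apply, LinearMap.comp_apply, hS]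
  simp

/-- The functional is recovered from its matrix coefficients by the counit. -/
lemma counit_comp_matrixCoeff (V : RComod k H) (l : Module.Dual k V) :
    counit ∘ₗ matrixCoeff V l = l := by
  ext v
  obtain ⟨S, hS⟩ := TensorProduct.exists_finset (V.coact v)
  rw [LinearMap.comp_apply, matrixCoeff_apply V l hS]
  conv_rhs => rw [← sum_counit_smul_of_isCoaction V.isCoaction hS]
  simp [mul_comm]

/-- Functionals separate the points of `V ⊗ M`. -/
lemma tensor_ext_dual {V M : Type u} [AddCommGroup V] [Module k V] [AddCommGroup M] [Module k M]
    {s t : V ⊗[k] M}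
    (h : ∀ l : Module.Dual k V, l.rTensor M s = l.rTensor M t) : s = t := by
  classical
  let b := Module.Basis.ofVectorSpace k V
  refine (TensorProduct.equivFinsuppOfBasisLeft b).injective (Finsupp.ext fun i => ?_)
  rw [TensorProduct.equivFinsuppOfBasisLeft_apply, TensorProduct.equivFinsuppOfBasisLeft_apply, h]

variable [CoquasitriangularStructure k H]
variable [Ring A] [Algebra k A] [RightModuleAlgebra k H A]

namespace ReflectiveCenter

/-- The operator `e_V` on `V ⊗ M`. -/
def op (X : ReflectiveCenter (RComod k H) (ModuleCat.{u} A)) (V : RComod k H) :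
    Module.End k (V ⊗[k] X.obj) :=
  (Act.ofₗ A V X.obj).symm.toLinearMap ∘ₗ
    ((X.e V).hom.hom : Act A V X.obj →ₗ[A] Act A V X.obj).restrictScalars k ∘ₗ
      (Act.ofₗ A V X.obj).toLinearMap

/-- The operator `e_H` on `H ⊗ M`, for the regular comodule `H`. -/
def regOp (X : ReflectiveCenter (RComod k H) (ModuleCat.{u} A)) :
    Module.End k (H ⊗[k] X.obj) := X.op (regComod k H)

/-- The functional `c ↦ (m ↦ (ε ⊗ 1) e_H(c ⊗ m))` of an object of the reflective center. -/
def functional (X : ReflectiveCenter (RComod k H) (ModuleCat.{u} A)) :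
    WithConv (H →ₗ[k] Module.End k X.obj) :=
  toConv (TensorProduct.curry (counitHit k H X.obj ∘ₗ X.regOp))

lemma functional_apply (X : ReflectiveCenter (RComod k H) (ModuleCat.{u} A)) (c : H) (m : X.obj) :
    X.functional c m = counitHit k H X.obj (X.regOp (c ⊗ₜ m)) := rfl

lemma op_naturality (X : ReflectiveCenter (RComod k H) (ModuleCat.{u} A)) {V W : RComod k H}
    (u : V ⟶ W) (t : V ⊗[k] X.obj) :
    X.op W (u.hom.rTensor X.obj t) = u.hom.rTensor X.obj (X.op V t) :=
  congrArg (fun g => (Act.of A W X.obj).symm (g.hom (Act.of A V X.obj t))) (X.naturality u)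

/-- The operators `e_V` are determined by the functional, by naturality along the matrix
coefficients. -/
lemma op_eq (X : ReflectiveCenter (RComod k H) (ModuleCat.{u} A)) (V : RComod k H) :
    X.op V = coactOp V.coact X.functional.ofConv := by
  refine TensorProduct.ext' fun v m => tensor_ext_dual fun l =>
    (TensorProduct.lid k X.obj).injective ?_
  obtain ⟨S, hS⟩ := TensorProduct.exists_finset (V.coact v)
  have h₁ : X.regOp (matrixCoeff V l v ⊗ₜ m) = (matrixCoeff V l).rTensor X.obj (X.op V (v ⊗ₜ m)) :=
    X.op_naturality (matrixCoeffHom V l) (v ⊗ₜ m)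
  have h₂ := X.functional_apply (matrixCoeff V l v) m
  rw [h₁, counitHit, LinearMap.comp_apply, ← LinearMap.rTensor_comp_apply,
    counit_comp_matrixCoeff, matrixCoeff_apply V l hS] at h₂
  rw [coactOp_tmul_repr _ m hS]
  refine h₂.symm.trans ?_
  simp

lemma regOp_eq (X : ReflectiveCenter (RComod k H) (ModuleCat.{u} A)) :
    X.regOp = coactOp comul X.functional.ofConv := X.op_eq (regComod k H)

/-- `A`-linearity of `e_H` is the commutation relation of a reflective pair. -/
lemma functional_comm (X : ReflectiveCenter (RComod k H) (ModuleCat.{u} A)) (a : A) :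
    X.functional * actConv (Algebra.lsmul k k X.obj) a =
      actConv (Algebra.lsmul k k X.obj) a * X.functional := by
  refine WithConv.ext (coactOp_comul_injective ?_)
  rw [coactOp_mul isCoaction_comul, coactOp_mul isCoaction_comul, ← X.regOp_eq]
  exact LinearMap.ext fun t =>
    (X.e (regComod k H)).hom.hom.map_smul a (Act.of A (regComod k H) X.obj t)

lemma e_hom_eq (X : ReflectiveCenter (RComod k H) (ModuleCat.{u} A)) (V : RComod k H) :
    (X.e V).hom = reflHom X.functional_comm V := by
  ext t
  exact LinearMap.congr_fun (X.op_eq V) ((Act.of A V X.obj).symm t)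

/-- The functional of an object of the reflective center forms a reflective pair with the module
structure: `e_I = id` gives the normalization, and the tensor axiom for two copies of the regular
comodule gives the reflection equation. -/
lemma isReflectivePair_functional (X : ReflectiveCenter (RComod k H) (ModuleCat.{u} A)) :
    IsReflectivePair (A := A) (Algebra.lsmul k k X.obj) X.functional where
  map_one := by
    ext m
    have h := X.e_unit
    rw [e_hom_eq] at h
    have h' : coactOp (trivCoact k H) X.functional.ofConv (1 ⊗ₜ m) = 1 ⊗ₜ m :=
      congrArg (fun g => (Act.of A (𝟙_ (RComod k H)) X.obj).symm
        (g.hom (Act.tmul A (V := 𝟙_ (RComod k H)) (1 : k) m))) h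
    rw [coactOp_tmul'] at h'
    have := congrArg (TensorProduct.lid k X.obj) h'
    simpa [trivCoact] using this
  comm := X.functional_comm
  reflection := by
    have h := X.e_tensor (regComod k H) (regComod k H)
    simp only [e_hom_eq] at h
    exact WithConv.ext (coactOp_comul_injective ((reflHom_tensor_iff _ _ _).mp h))

end ReflectiveCenter

namespace ReflectiveAlgebra

/-- The module over the reflective algebra of an object of the reflective center. -/
def ofCenter (X : ReflectiveCenter (RComod k H) (ModuleCat.{u} A)) :
    ModuleCat.{u} (ReflectiveAlgebra k H A) :=
  letI : Module (ReflectiveAlgebra k H A) X.obj :=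
    Module.compHom X.obj (lift X.isReflectivePair_functional).toRingHom
  ModuleCat.of (ReflectiveAlgebra k H A) X.obj

/-- The restriction of scalars of `ofCenter X` is the underlying module of `X`. -/
def ofCenterEquiv (X : ReflectiveCenter (RComod k H) (ModuleCat.{u} A)) :
    (ModuleCat.restrictScalars (iota k H A).toRingHom).obj (ofCenter X) ≃ₗ[A] X.obj where
  __ := AddEquiv.refl X.obj
  map_smul' a m := by
    have : lift X.isReflectivePair_functional (iota k H A a) = Algebra.lsmul k k X.obj a := by
      rw [iota_apply, lift_equiv, X.isReflectivePair_functional.map_one, one_mul]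
    exact LinearMap.congr_fun this m

/-- An object of the reflective center is the restriction of scalars of the module that its
functional defines. -/
lemma resFunctor_essSurj {K' : WithConv (H →ₗ[k] ReflectiveAlgebra k H A)}
    (h₁ : toConv (kappa k H A) * K' = 1) (h₂ : K' * toConv (kappa k H A) = 1) :
    (resFunctor (isReflectivePair (k := k) (H := H) (A := A)) h₁ h₂).EssSurj where
  mem_essImage X := by
    refine ⟨ofCenter X, ⟨ReflectiveCenter.mkIso (V := resObj isReflectivePair h₁ h₂ (ofCenter X))
      (W := X) (ofCenterEquiv X).toModuleIso fun V => ?_⟩⟩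
    rw [X.e_hom_eq]
    refine reflHom_naturality_right (isReflectivePair.resEnd (ofCenter X)).comm X.functional_comm
      (fun c m => ?_) V
    have : lift X.isReflectivePair_functional (kappa k H A c) = X.functional c := by
      rw [kappa_apply, lift_equiv, map_one, mul_one]
    exact LinearMap.congr_fun this m

end ReflectiveAlgebra

end CenterObjects

/-! ### The equivalence with the reflective center -/

section CenterEquivalence

open Coalgebra TensorProduct WithConv RightModuleAlgebra

variable (k H A : Type u) [Field k] [Ring H] [HopfAlgebra k H] [CoquasitriangularStructure k H]
variable [Ring A] [Algebra k A] [RightModuleAlgebra k H A]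

namespace ReflectiveAlgebra

/-- The convolution inverse of the reflective structure. -/
def kappaInv : WithConv (H →ₗ[k] ReflectiveAlgebra k H A) :=
  (exists_kappa_inv (k := k) (H := H) (A := A)).choose

lemma kappa_mul_kappaInv : toConv (kappa k H A) * kappaInv k H A = 1 :=
  (exists_kappa_inv (k := k) (H := H) (A := A)).choose_spec.1

lemma kappaInv_mul_kappa : kappaInv k H A * toConv (kappa k H A) = 1 :=
  (exists_kappa_inv (k := k) (H := H) (A := A)).choose_spec.2

/-- The module braiding `v ⊗ m ↦ v₍₀₎ ⊗ κ(v₍₁₎) m` on modules over the reflective algebra. -/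
def braiding :
    BraidedModuleCategory (RComod k H) (ModuleCat.{u} (ReflectiveAlgebra k H A)) :=
  moduleBraiding (K := toConv (kappa k H A)) (K' := kappaInv k H A) isReflectivePair_id
    (kappa_mul_kappaInv k H A) (kappaInv_mul_kappa k H A) act_kappa

/-- Restriction of scalars from the reflective algebra, as a functor to the reflective center. -/
def toCenter : ModuleCat.{u} (ReflectiveAlgebra k H A) ⥤
    ReflectiveCenter (RComod k H) (ModuleCat.{u} A) :=
  resFunctor (K := toConv (kappa k H A)) (K' := kappaInv k H A) isReflectivePair
    (kappa_mul_kappaInv k H A) (kappaInv_mul_kappa k H A)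

/-- The reflective algebra is spanned by the elements `h # x = K(h) x`. -/
lemma mem_span_kappa_mul_iota (b : ReflectiveAlgebra k H A) :
    b ∈ Submodule.span k (Set.range fun p : H × A => kappa k H A p.1 * iota k H A p.2) := by
  obtain ⟨b, rfl⟩ := (equiv k H A).surjective b
  induction b using TensorProduct.induction_on with
  | zero => rw [map_zero]; exact Submodule.zero_mem _
  | add x y hx hy => rw [map_add]; exact Submodule.add_mem _ hx hy
  | tmul g x => exact Submodule.subset_span ⟨(g, x), kappa_mul_iota g x⟩

instance : (toCenter k H A).Faithful := by
  unfold toCenter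
  infer_instance

instance : (toCenter k H A).Full :=
  resFunctor_full (K := toConv (kappa k H A)) (K' := kappaInv k H A) isReflectivePair
    (kappa_mul_kappaInv k H A) (kappaInv_mul_kappa k H A) (mem_span_kappa_mul_iota k H A)

instance : (toCenter k H A).EssSurj :=
  resFunctor_essSurj (kappa_mul_kappaInv k H A) (kappaInv_mul_kappa k H A)

instance : (toCenter k H A).IsEquivalence where

/-- The functor to the reflective center is a functor of module categories. -/
def toCenterLeftLinear : (toCenter k H A).LeftLinear (RComod k H) :=
  resLeftLinear (K := toConv (kappa k H A)) (K' := kappaInv k H A) isReflectivePair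
    (kappa_mul_kappaInv k H A) (kappaInv_mul_kappa k H A) act_iota act_kappa

/-- The functor to the reflective center lies over restriction of scalars. -/
def toCenterForget : toCenter k H A ⋙ ReflectiveCenter.forget (RComod k H) (ModuleCat.{u} A) ≅
    ModuleCat.restrictScalars (iota k H A).toRingHom :=
  NatIso.ofComponents fun _ => Iso.refl _

end ReflectiveAlgebra

end CenterEquivalence

end ReflAlg

end

theorem mainTheorem4 {k H A : Type u} [Field k] [Ring H] [HopfAlgebra k H]
    [ReflAlg.CoquasitriangularStructure k H] [Ring A] [Algebra k A]
    [ReflAlg.RightModuleAlgebra k H A] :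
    ∃ (B : Type u) (_ : Ring B) (_ : Algebra k B) (_ : ReflAlg.RightModuleAlgebra k H B)
      (e : H ⊗[k] A ≃ₗ[k] B) (ι : A →ₐ[k] B) (K : H →ₗ[k] B),
      -- `B = H # A` with `1 = 1 # 1` and `(g # x) (h # y) = g • h₍₀₎ # (x.h₍₁₎) y`,
      e (1 ⊗ₜ[k] 1) = 1 ∧
      (∀ (g h : H) (x y : A), e (g ⊗ₜ[k] x) * e (h ⊗ₜ[k] y) =
        e (TensorProduct.map (ReflAlg.transMul k H g)
          (LinearMap.mulRight k y ∘ₗ ReflAlg.RightModuleAlgebra.act x)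
          (ReflAlg.coad k H h))) ∧
      -- module algebra structure `(g # x).h = g ↼ h₍₁₎ # x.h₍₂₎`,
      (∀ (g h : H) (x : A), ReflAlg.RightModuleAlgebra.act (k := k) (e (g ⊗ₜ[k] x)) h =
        e (TensorProduct.map (ReflAlg.centralHit k H g) (ReflAlg.RightModuleAlgebra.act x)
          (Coalgebra.comul (R := k) h))) ∧
      -- the inclusion of `A` and the reflective structure `K(h) = h # 1`,
      (∀ x : A, ι x = e (1 ⊗ₜ[k] x)) ∧
      (∀ h : H, K h = e (h ⊗ₜ[k] 1)) ∧
      ReflAlg.IsReflectiveStructure K ∧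
      -- the module braiding `v ⊗ m ↦ v₍₀₎ ⊗ K(v₍₁₎) m` on the category of `B`-modules,
      ∃ 𝓔 : ReflAlg.BraidedModuleCategory (ReflAlg.RComod k H) (ModuleCat.{u} B),
        (∀ (V : ReflAlg.RComod k H) (M : ModuleCat.{u} B) (t : V ⊗[k] M),
          (𝓔.e V M).hom.hom (ReflAlg.Act.of B V M t) =
            ReflAlg.Act.of B V M (ReflAlg.kMap K V M t)) ∧
      -- and an equivalence of braided module categories with the reflective center
      -- that lies over the restriction of scalars to `A`.
      ∃ (Ψ : ModuleCat.{u} B ≌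
            ReflAlg.ReflectiveCenter (ReflAlg.RComod k H) (ModuleCat.{u} A))
        (_ : Ψ.functor.LeftLinear (ReflAlg.RComod k H))
        (η : Ψ.functor ⋙ ReflAlg.ReflectiveCenter.forget (ReflAlg.RComod k H)
            (ModuleCat.{u} A) ≅ ModuleCat.restrictScalars ι.toRingHom),
        (∀ (V : ReflAlg.RComod k H) (M : ModuleCat.{u} B),
          (ReflAlg.BraidedModuleCategory.e V (Ψ.functor.obj M)).hom ≫
              Functor.LaxLeftLinear.μₗ Ψ.functor V M =
            Functor.LaxLeftLinear.μₗ Ψ.functor V M ≫ Ψ.functor.map (𝓔.e V M).hom) ∧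
        (∀ (V : ReflAlg.RComod k H) (M : ModuleCat.{u} B) (v : V)
          (n : (Ψ.functor.obj M).obj),
          (η.hom.app (V ⊙ₗ M)).hom
              ((Functor.LaxLeftLinear.μₗ Ψ.functor V M).hom.hom (ReflAlg.Act.tmul A v n)) =
            (ReflAlg.Act.tmul B (M := M) v ((η.hom.app M).hom n) : ReflAlg.Act B V M)) := by
  open ReflAlg ReflAlg.ReflectiveAlgebra in
  exact ⟨ReflectiveAlgebra k H A, inferInstance, inferInstance, inferInstance, equiv k H A,
    iota k H A, kappa k H A, equiv_one, equiv_mul, act_equiv, iota_apply, kappa_apply,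
    isReflectiveStructure, braiding k H A, fun _ _ _ => rfl,
    (toCenter k H A).asEquivalence, toCenterLeftLinear k H A, toCenterForget k H A,
    resLin_braided isReflectivePair isReflectivePair_id _ _ act_iota act_kappa,
    fun _ _ _ _ => rfl⟩
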